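/- Let $n\in\mathbb N$ and $\Omega=(0,1)^n\subseteq\mathbb R^n$. For $f\in L^1(\Omega)$ let $$|\mathrm D^2 f|(\Omega)=\sup_F\int_\Omega\sum_{i,j=1}^n f\,\partial_i\partial_jF_{i,j}\,\mathrm d\mathcal L^n\in[0,\infty],$$ the supremum being over all $F\in C_c^\infty(\Omega)^{n\times n}$ such that for every $x\in\Omega$ all singular values of the matrix $F(x)$ are at most $1$ (this is the Hessian–Schatten total variation with Schatten exponent $p=1$). Let $\mathcal A\subseteq L^1(\Omega)$ be the subspace of affine functions and $\pi:L^1(\Omega)\to L^1(\Omega)/\mathcal A$ the canonical projection. Since $|\mathrm D^2 f|(\Omega)$ does not change when an affine function is added to $f$, it is well defined on $L^1(\Omega)/\mathcal A$; let $$\mathcal B=\{g\in L^1(\Omega)/\mathcal A:\ |\mathrm D^2 g|(\Omega)\le 1\}.$$ Let $\mathrm{CPWL}(\Omega)$ be the set of all continuous functions $f$ on $\Omega$ for which there is a decomposition $\{P_k\}_k$ of $\mathbb R^n$ into $n$-dimensional convex polytopes (convex hulls of finitely many points), intersecting only at their boundaries and such that every ball meets only finitely many $P_k$, with $f|_{P_k\cap\Omega}$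 affine for every $k$; such functions are regarded as elements of $L^1(\Omega)$. Finally, let $$\mathcal E=\pi(\mathrm{CPWL}(\Omega))\cap\operatorname{ext}(\mathcal B),$$ where $\operatorname{ext}(\mathcal B)$ is the set of extreme points of $\mathcal B$. Then $$\operatorname{co}(\mathcal E)=\pi(\mathrm{CPWL}(\Omega))\cap\mathcal B,$$ where $\operatorname{co}$ denotes the convex hull (not its closure). -/

import Mathlib

open MeasureTheory Set
open scoped ENNReal ContDiff

namespace HTV

/-- The Euclidean space `ℝⁿ`. -/
abbrev Euc (n : ℕ) : Type := EuclideanSpace ℝ (Fin n)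

/-- The open unit cube `(0,1)ⁿ` in `ℝⁿ`. -/
def cube (n : ℕ) : Set (Euc n) := {x | ∀ i, x i ∈ Ioo (0 : ℝ) 1}

/-! ### Schatten norms and the Hessian-Schatten total variation -/

/-- The Schatten `p`-norm of a square matrix: the `ℓᵖ` norm of the vector
`(s₁(M), …, sₙ(M))` of its singular values, counted with multiplicity. -/
noncomputable def schattenNorm {n : ℕ} (p : ℝ≥0∞) (M : Matrix (Fin n) (Fin n) ℝ) : ℝ :=
  ‖(WithLp.toLp p (fun i : Fin n => (Matrix.toEuclideanLin M).singularValues i) :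
    PiLp p (fun _ : Fin n => ℝ))‖

/-- The partial derivative `∂ᵢ φ`. -/
noncomputable def partialDeriv {n : ℕ} (i : Fin n) (φ : Euc n → ℝ) : Euc n → ℝ :=
  fun x => fderiv ℝ φ x (EuclideanSpace.single i 1)

/-- The test fields for `|D²_p ·|(A)`: matrix fields `F ∈ C_c^∞(A)^{n × n}` (extended by zero to
`ℝⁿ`) whose Schatten `p*`-norm is bounded by one everywhere, `p*` being the conjugate exponent. -/
structure IsTestField {n : ℕ} (p : ℝ≥0∞) (A : Set (Euc n))
    (F : Euc n → Fin n → Fin n → ℝ) : Prop where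
  smooth : ∀ i j, ContDiff ℝ ∞ (fun x => F x i j)
  compact : ∀ i j, HasCompactSupport (fun x => F x i j)
  support : ∀ i j, tsupport (fun x => F x i j) ⊆ A
  bound : ∀ x, schattenNorm (ENNReal.conjExponent p) (Matrix.of (F x)) ≤ 1

/-- The `p`-Hessian-Schatten total variation `|D²_p f|(A)`, a supremum over test fields.  As the
zero field is a test field, the supremum is nonnegative and truncating each integral at zero does
not change it. -/
noncomputable def variation {n : ℕ} (p : ℝ≥0∞) (f : Euc n → ℝ) (A : Set (Euc n)) : ℝ≥0∞ :=
  ⨆ (F : Euc n → Fin n → Fin n → ℝ) (_ : IsTestField p A F),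
    ENNReal.ofReal (∫ x in A, ∑ i, ∑ j,
      f x * partialDeriv i (partialDeriv j (fun y => F y i j)) x)

/-! ### Continuous piecewise linear functions -/

/-- An `n`-dimensional convex polytope in `ℝⁿ`: the convex hull of finitely many points, with
nonempty interior. -/
def IsPolytope {n : ℕ} (P : Set (Euc n)) : Prop :=
  (∃ t : Set (Euc n), t.Finite ∧ P = convexHull ℝ t) ∧ (interior P).Nonempty

/-- A locally finite decomposition of `ℝⁿ` in `n`-dimensional convex polytopes which intersect
only at their boundaries. -/
structure IsPolytopeDecomposition {n : ℕ} (Ps : Set (Set (Euc n))) : Prop where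
  polytope : ∀ P ∈ Ps, IsPolytope P
  cover : ⋃₀ Ps = univ
  boundary : ∀ P ∈ Ps, ∀ Q ∈ Ps, P ≠ Q → P ∩ Q ⊆ frontier P ∩ frontier Q
  locallyFinite : ∀ (x : Euc n) (r : ℝ), {P ∈ Ps | (P ∩ Metric.ball x r).Nonempty}.Finite

/-- `f ∈ CPWL(Ω)`: `f` is continuous on `Ω`, and affine on `P ∩ Ω` for every polytope `P` of some
decomposition of `ℝⁿ`. -/
def IsCPWL {n : ℕ} (Ω : Set (Euc n)) (f : Euc n → ℝ) : Prop :=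
  ContinuousOn f Ω ∧ ∃ Ps : Set (Set (Euc n)), IsPolytopeDecomposition Ps ∧
    ∀ P ∈ Ps, ∃ a : Euc n →ᵃ[ℝ] ℝ, EqOn f a (P ∩ Ω)

/-! ### The quotient `L¹(Ω) / 𝒜` for `Ω = (0,1)ⁿ` -/

/-- `L¹(Ω)` for `Ω = (0,1)ⁿ`. -/
abbrev L1 (n : ℕ) : Type := Lp ℝ 1 ((volume : Measure (Euc n)).restrict (cube n))

/-- The subspace `𝒜` of `L¹(Ω)` of (classes of) affine functions. -/
def affineSubspace (n : ℕ) : Submodule ℝ (L1 n) where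
  carrier := {u | ∃ a : Euc n →ᵃ[ℝ] ℝ, u =ᵐ[volume.restrict (cube n)] a}
  zero_mem' := ⟨0, by simpa using Lp.coeFn_zero ℝ 1 _⟩
  add_mem' := by
    rintro u v ⟨a, ha⟩ ⟨b, hb⟩
    refine ⟨a + b, ?_⟩
    filter_upwards [Lp.coeFn_add u v, ha, hb] with x h1 h2 h3
    rw [h1, Pi.add_apply, h2, h3]; rfl
  smul_mem' := by
    rintro c u ⟨a, ha⟩
    refine ⟨c • a, ?_⟩
    filter_upwards [Lp.coeFn_smul c u, ha] with x h1 h2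
    rw [h1, Pi.smul_apply, h2]; rfl

/-- The quotient space `L¹(Ω) / 𝒜`. -/
abbrev L1ModAffine (n : ℕ) : Type := L1 n ⧸ affineSubspace n

/-- The canonical projection `π : L¹(Ω) → L¹(Ω) / 𝒜`. -/
noncomputable def proj (n : ℕ) : L1 n →ₗ[ℝ] L1ModAffine n := (affineSubspace n).mkQ

lemma contDiff_partialDeriv {n : ℕ} (i : Fin n) {φ : Euc n → ℝ} (h : ContDiff ℝ ∞ φ) :
    ContDiff ℝ ∞ (partialDeriv i φ) :=
  (h.fderiv_right (m := ∞) (by simp)).clm_apply contDiff_const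

lemma hasCompactSupport_partialDeriv {n : ℕ} (i : Fin n) {φ : Euc n → ℝ}
    (h : HasCompactSupport φ) : HasCompactSupport (partialDeriv i φ) :=
  h.fderiv_apply ℝ _

lemma tsupport_partialDeriv {n : ℕ} (i : Fin n) (φ : Euc n → ℝ) :
    tsupport (partialDeriv i φ) ⊆ tsupport φ :=
  tsupport_fderiv_apply_subset ℝ _

/-- Affine functions have vanishing distributional second derivatives. -/
lemma integral_affine_mul {n : ℕ} (a : Euc n →ᵃ[ℝ] ℝ) (i j : Fin n) {φ : Euc n → ℝ}
    (hφ : ContDiff ℝ ∞ φ) (hc : HasCompactSupport φ) :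
    ∫ x, a x * partialDeriv i (partialDeriv j φ) x = 0 := by
  have hd : ∀ x, HasFDerivAt a (LinearMap.toContinuousLinearMap a.linear) x := fun x => by
    have h1 : (a : Euc n → ℝ) =
        fun y => (LinearMap.toContinuousLinearMap a.linear) y + a 0 := by
      funext y
      simpa using congrFun a.decomp y
    rw [h1]
    exact (ContinuousLinearMap.hasFDerivAt _).add_const _
  have hcont : Continuous a := continuous_iff_continuousAt.2 fun x => (hd x).continuousAt
  have h1 := contDiff_partialDeriv j hφ
  have c1 := hasCompactSupport_partialDeriv j hc
  have h2 := contDiff_partialDeriv i h1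
  have c2 := hasCompactSupport_partialDeriv i c1
  have hint : Integrable (partialDeriv j φ) := h1.continuous.integrable_of_hasCompactSupport c1
  have key0 : ∫ x, partialDeriv j φ x = 0 := by
    have := integral_mul_fderiv_eq_neg_fderiv_mul_of_integrable (μ := (volume : Measure (Euc n)))
      (f := fun _ => (1 : ℝ)) (g := φ) (v := EuclideanSpace.single j 1)
      (by simp) (by simp only [one_mul]; exact hint)
      (by simpa using hφ.continuous.integrable_of_hasCompactSupport hc)
      (fun x _ => differentiableAt_const _) (fun x _ => hφ.differentiable (by simp) x)
    simpa [partialDeriv] using this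
  have key := integral_mul_fderiv_eq_neg_fderiv_mul_of_integrable
    (μ := (volume : Measure (Euc n)))
    (f := a) (g := partialDeriv j φ) (v := EuclideanSpace.single i 1)
    (by simpa [fun x => (hd x).fderiv] using hint.const_mul _)
    ((hcont.mul h2.continuous).integrable_of_hasCompactSupport c2.mul_left)
    ((hcont.mul h1.continuous).integrable_of_hasCompactSupport c1.mul_left)
    (fun x _ => (hd x).differentiableAt) (fun x _ => h1.differentiable (by simp) x)
  refine key.trans ?_
  simp [fun x => (hd x).fderiv, integral_const_mul, key0]

/-- The Hessian-Schatten variation does not change if an affine function is added. -/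
lemma variation_congr {n : ℕ} (p : ℝ≥0∞) {u v : Euc n → ℝ} {A : Set (Euc n)}
    (hv : IntegrableOn v A) (a : Euc n →ᵃ[ℝ] ℝ)
    (h : ∀ᵐ x ∂(volume.restrict A), u x = v x + a x) :
    variation p u A = variation p v A := by
  unfold variation
  refine iSup_congr fun F => iSup_congr fun hF => ?_
  congr 1
  have h1 := fun i j => contDiff_partialDeriv i (contDiff_partialDeriv j (hF.smooth i j))
  have c1 := fun i j => hasCompactSupport_partialDeriv i
    (hasCompactSupport_partialDeriv j (hF.compact i j))
  have hcont : Continuous a := AffineMap.continuous_of_finiteDimensional a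
  have hiv : ∀ i j, IntegrableOn
      (fun x => v x * partialDeriv i (partialDeriv j (fun y => F y i j)) x) A := by
    intro i j
    obtain ⟨C, hC⟩ := (c1 i j).exists_bound_of_continuous (h1 i j).continuous
    exact Integrable.mul_bdd (c := C) hv (h1 i j).continuous.aestronglyMeasurable (.of_forall hC)
  have hia : ∀ i j, IntegrableOn
      (fun x => a x * partialDeriv i (partialDeriv j (fun y => F y i j)) x) A := fun i j =>
    ((hcont.mul (h1 i j).continuous).integrable_of_hasCompactSupport
      (c1 i j).mul_left).integrableOn
  have hz : ∀ i j,
      ∫ x in A, a x * partialDeriv i (partialDeriv j (fun y => F y i j)) x = 0 := by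
    intro i j
    rw [setIntegral_eq_integral_of_forall_compl_eq_zero]
    · exact integral_affine_mul a i j (hF.smooth i j) (hF.compact i j)
    · intro x hx
      have : x ∉ tsupport (partialDeriv i (partialDeriv j (fun y => F y i j))) := fun hx' =>
        hx (hF.support i j (tsupport_partialDeriv _ _ (tsupport_partialDeriv _ _ hx')))
      rw [image_eq_zero_of_notMem_tsupport this, mul_zero]
  have e : ∫ x in A, ∑ i, ∑ j,
        u x * partialDeriv i (partialDeriv j (fun y => F y i j)) x =
      ∫ x in A, ∑ i, ∑ j,
        (v x * partialDeriv i (partialDeriv j (fun y => F y i j)) x +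
          a x * partialDeriv i (partialDeriv j (fun y => F y i j)) x) := by
    refine integral_congr_ae ?_
    filter_upwards [h] with x hx
    simp only [hx, add_mul]
  rw [e]
  simp only [Finset.sum_add_distrib]
  rw [integral_add (integrable_finsetSum _ fun i _ => integrable_finsetSum _ fun j _ => hiv i j)
    (integrable_finsetSum _ fun i _ => integrable_finsetSum _ fun j _ => hia i j)]
  have e2 : ∫ x in A, ∑ i, ∑ j,
      a x * partialDeriv i (partialDeriv j (fun y => F y i j)) x = 0 := by
    rw [integral_finsetSum _ fun i _ => integrable_finsetSum _ fun j _ => hia i j]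
    refine Finset.sum_eq_zero fun i _ => ?_
    rw [integral_finsetSum _ fun j _ => hia i j]
    exact Finset.sum_eq_zero fun j _ => hz i j
  rw [e2, add_zero]

/-- The functional `g ↦ |D²_p g|(Ω)` on the quotient `L¹(Ω) / 𝒜`. -/
noncomputable def quotVariation {n : ℕ} (p : ℝ≥0∞) (g : L1ModAffine n) : ℝ≥0∞ :=
  Quotient.liftOn' g (fun u : L1 n => variation p u (cube n)) (by
    intro u v h
    obtain ⟨a, ha⟩ := (Submodule.quotientRel_def _).1 h
    refine variation_congr p (L1.integrable_coeFn v) a ?_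
    filter_upwards [ha, Lp.coeFn_sub u v] with x h1 h2
    rw [h2, Pi.sub_apply] at h1
    linarith)

/-- `π(CPWL(Ω))`, where `CPWL(Ω)` is regarded as a subset of `L¹(Ω)`. -/
def cpwlClasses (n : ℕ) : Set (L1ModAffine n) :=
  proj n '' {u | ∃ f : Euc n → ℝ, IsCPWL (cube n) f ∧ u =ᵐ[volume.restrict (cube n)] f}

/-- The unit ball `ℬ = {g ∈ L¹(Ω) / 𝒜 : |D² g|(Ω) ≤ 1}`, with the Schatten exponent `p = 1`. -/
def unitBall (n : ℕ) : Set (L1ModAffine n) := {g | quotVariation 1 g ≤ 1}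

/-- The set `ℰ = π(CPWL(Ω)) ∩ ext(ℬ)` of CPWL extreme points. -/
def cpwlExtreme (n : ℕ) : Set (L1ModAffine n) :=
  cpwlClasses n ∩ extremePoints ℝ (unitBall n)

end HTV

namespace HTV

/-! ### The spectral norm and its unit ball -/

section

/-! One inclusion is convexity. The unit ball is convex because the variation is a supremum of
linear functionals. The CPWL classes are convex because two polytope decompositions have a common
refinement.

For the other inclusion, fix a CPWL function `f` of variation at most one and a decomposition `Ps`
on whose pieces it is affine. Functions of finite variation that are affine on each piece form a
finite dimensional space `pieceSpace Ps`, since only finitely many pieces meet the cube. Modulo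
affine functions the variation is a norm there, because zero variation forces a function to be
affine (`proj_eq_zero_of_variation_eq_zero`). By Minkowski's theorem the class of `f` is then a
convex combination of extreme points of the finite dimensional unit ball
(`unit_ball_subset_convexHull_extremePoints`). Two facts show that these points belong to
`cpwlExtreme`.

They are extreme in the full ball. Such a point has variation one. If it equals `s • v + t • w` with
`v`, `w` of variation at most one, then no mass of the Hessians can cancel, so those of `v` and `w`
vanish wherever that of `u` does (`hessPairing_eq_zero_of_convex_combination`). Hence `v` and `w`
are affine on the same pieces, and extremality in the finite dimensional ball applies.

They are CPWL. Membership in `pieceSpace` does not demand continuity, but a jump across a face would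
put the derivative of a surface measure into the Hessian, which has infinite variation
(`affine_eq_of_variation_ne_top`). So neighbouring pieces match along faces, and generic segments,
which avoid points common to three pieces, propagate this to a Lipschitz bound
(`IsPolytopeDecomposition.abs_sub_le`).

If `pieceSpace Ps` contains only affine functions, the class is zero. That class is reached through
a cubical grid that carries the non-affine function `|xᵢ - 1/2|`. -/

lemma toEuclideanLin_norm_le_iff_singularValues {n : ℕ} (M : Matrix (Fin n) (Fin n) ℝ) :
    (∀ i : Fin n, (Matrix.toEuclideanLin M).singularValues i ≤ 1) ↔
      ∀ x : Euc n, ‖Matrix.toEuclideanLin M x‖ ≤ ‖x‖ := by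
  set T : Euc n →ₗ[ℝ] Euc n := Matrix.toEuclideanLin M
  have hn : Module.finrank ℝ (Euc n) = n := finrank_euclideanSpace_fin
  have hsym := T.isSymmetric_adjoint_comp_self
  have hsq : ∀ x : Euc n, ‖T x‖ ^ 2 = inner ℝ ((LinearMap.adjoint T ∘ₗ T) x) x := by
    intro x
    rw [LinearMap.comp_apply, LinearMap.adjoint_inner_left, real_inner_self_eq_norm_sq]
  -- Singular values are the lengths of the images of an orthonormal eigenbasis of `T* T`. One
  -- direction expands `x` in this basis, the other evaluates at the basis vectors.
  have heig : ∀ i : Fin n, ‖T (hsym.eigenvectorBasis hn i)‖ ^ 2 = T.singularValues i ^ 2 := by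
    intro i
    rw [hsq, hsym.apply_eigenvectorBasis hn i, T.sq_singularValues_fin hn]
    simp [real_inner_smul_left]
  constructor
  · intro h x
    have key : ‖T x‖ ^ 2 ≤ ‖x‖ ^ 2 := by
      rw [hsq, ← (hsym.eigenvectorBasis hn).sum_inner_mul_inner,
        ← (hsym.eigenvectorBasis hn).sum_sq_norm_inner_right x]
      refine Finset.sum_le_sum fun i _ => ?_
      have e1 : inner ℝ ((LinearMap.adjoint T ∘ₗ T) x) (hsym.eigenvectorBasis hn i) =
          T.singularValues i ^ 2 * inner ℝ (hsym.eigenvectorBasis hn i) x := by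
        rw [hsym, hsym.apply_eigenvectorBasis hn i, T.sq_singularValues_fin hn, inner_smul_right,
          real_inner_comm]
        rfl
      rw [e1, Real.norm_eq_abs, sq_abs, mul_assoc, ← sq]
      have h0 := T.singularValues_nonneg i
      have h1 : T.singularValues i ^ 2 ≤ 1 := pow_le_one₀ h0 (h i)
      exact mul_le_of_le_one_left (sq_nonneg _) h1
    exact (sq_le_sq₀ (norm_nonneg _) (norm_nonneg _)).1 key
  · intro h i
    have h1 := h (hsym.eigenvectorBasis hn i)
    rw [(hsym.eigenvectorBasis hn).orthonormal.1 i] at h1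
    have h2 := heig i
    have h3 := T.singularValues_nonneg i
    have h4 : ‖T (hsym.eigenvectorBasis hn i)‖ = T.singularValues i :=
      (pow_left_inj₀ (norm_nonneg _) h3 two_ne_zero).1 h2
    rwa [h4] at h1

lemma conjExponent_one : ENNReal.conjExponent 1 = ⊤ := by
  simp [ENNReal.conjExponent]

/-- Singular values disappear from here on: an admissible field is one whose values are
contractions. -/
lemma schattenNorm_top_le_one_iff {n : ℕ} (M : Matrix (Fin n) (Fin n) ℝ) :
    schattenNorm ⊤ M ≤ 1 ↔ ∀ x : Euc n, ‖Matrix.toEuclideanLin M x‖ ≤ ‖x‖ := by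
  rw [← toEuclideanLin_norm_le_iff_singularValues, schattenNorm, PiLp.norm_eq_ciSup]
  rcases isEmpty_or_nonempty (Fin n) with h | h
  · simp [Real.iSup_of_isEmpty]
  · have hb := Finite.bddAbove_range
      (fun i : Fin n => ‖(Matrix.toEuclideanLin M).singularValues i‖)
    refine ⟨fun h i => ?_, fun h => ciSup_le fun i => ?_⟩
    · refine (le_abs_self _).trans ((le_ciSup hb i).trans h)
    · simpa [abs_of_nonneg (LinearMap.singularValues_nonneg _ _)] using h i

lemma schattenNorm_top_smul_le_one {n : ℕ} {M : Matrix (Fin n) (Fin n) ℝ}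
    (h : schattenNorm ⊤ M ≤ 1) {c : ℝ} (hc : |c| ≤ 1) : schattenNorm ⊤ (c • M) ≤ 1 := by
  rw [schattenNorm_top_le_one_iff] at h ⊢
  intro x
  rw [map_smul, LinearMap.smul_apply, norm_smul, Real.norm_eq_abs]
  exact (mul_le_of_le_one_left (norm_nonneg _) hc).trans (h x)

lemma toEuclideanLin_apply_apply {n : ℕ} (M : Matrix (Fin n) (Fin n) ℝ) (x : Euc n) (i : Fin n) :
    Matrix.toEuclideanLin M x i = ∑ j, M i j * x j := by
  simp [Matrix.toLpLin_apply, Matrix.mulVec, dotProduct]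

/-- Allows one second derivative to be tested at a time. -/
lemma schattenNorm_top_single_le_one {n : ℕ} (i j : Fin n) {c : ℝ} (hc : |c| ≤ 1) :
    schattenNorm ⊤ (Matrix.single i j c) ≤ 1 := by
  rw [schattenNorm_top_le_one_iff]
  intro x
  have : Matrix.toEuclideanLin (Matrix.single i j c) x = EuclideanSpace.single i (c * x j) := by
    ext k
    rw [toEuclideanLin_apply_apply]
    by_cases hk : k = i
    · subst hk
      rw [Finset.sum_eq_single j] <;> simp +contextual [eq_comm]
    · simp [Ne.symm hk, hk]
  rw [this, PiLp.norm_single, norm_mul, Real.norm_eq_abs]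
  exact (mul_le_of_le_one_left (norm_nonneg _) hc).trans (PiLp.norm_apply_le x j)

lemma abs_entry_le_one_of_schattenNorm_top {n : ℕ} {M : Matrix (Fin n) (Fin n) ℝ}
    (h : schattenNorm ⊤ M ≤ 1) (i j : Fin n) : |M i j| ≤ 1 := by
  rw [schattenNorm_top_le_one_iff] at h
  have h1 := h (EuclideanSpace.single j 1)
  rw [PiLp.norm_single, norm_one] at h1
  refine le_trans ?_ ((PiLp.norm_apply_le _ i).trans h1)
  rw [toEuclideanLin_apply_apply, Finset.sum_eq_single j] <;> simp +contextual

/-! ### Second order test fields -/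

/-- The expression `∑ᵢⱼ ∂ᵢ∂ⱼ Fᵢⱼ`. -/
noncomputable def hessDiv {n : ℕ} (F : Euc n → Fin n → Fin n → ℝ) (x : Euc n) : ℝ :=
  ∑ i, ∑ j, partialDeriv i (partialDeriv j (fun y => F y i j)) x

/-- The action of the distributional Hessian of `u` on `A` on a matrix field. -/
noncomputable def hessPairing {n : ℕ} (A : Set (Euc n)) (u : Euc n → ℝ)
    (F : Euc n → Fin n → Fin n → ℝ) : ℝ := ∫ x in A, u x * hessDiv F x

/-- Smooth matrix fields with compact support in `A`. -/
structure IsSmoothField {n : ℕ} (A : Set (Euc n)) (F : Euc n → Fin n → Fin n → ℝ) : Prop where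
  smooth : ∀ i j, ContDiff ℝ ∞ (fun x => F x i j)
  compact : ∀ i j, HasCompactSupport (fun x => F x i j)
  support : ∀ i j, tsupport (fun x => F x i j) ⊆ A

/-- Smooth functions with compact support in `A`. -/
structure IsTestFun {n : ℕ} (A : Set (Euc n)) (φ : Euc n → ℝ) : Prop where
  smooth : ContDiff ℝ ∞ φ
  compact : HasCompactSupport φ
  support : tsupport φ ⊆ A

variable {n : ℕ} {A B : Set (Euc n)} {F G : Euc n → Fin n → Fin n → ℝ} {u v φ ψ : Euc n → ℝ}

lemma IsTestField.isSmoothField {p : ℝ≥0∞} (h : IsTestField p A F) : IsSmoothField A F :=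
  ⟨h.smooth, h.compact, h.support⟩

lemma IsTestField.norm_le (h : IsTestField 1 A F) (x : Euc n) :
    schattenNorm ⊤ (Matrix.of (F x)) ≤ 1 := by
  have := h.bound x
  rwa [conjExponent_one] at this

lemma IsSmoothField.isTestField (h : IsSmoothField A F)
    (hb : ∀ x, schattenNorm ⊤ (Matrix.of (F x)) ≤ 1) : IsTestField 1 A F :=
  ⟨h.smooth, h.compact, h.support, by simpa only [conjExponent_one] using hb⟩

lemma IsTestFun.mono (h : IsTestFun A φ) (hAB : A ⊆ B) : IsTestFun B φ :=
  ⟨h.smooth, h.compact, h.support.trans hAB⟩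

lemma IsTestFun.mul_left (h : IsTestFun A φ) (hψ : ContDiff ℝ ∞ ψ) :
    IsTestFun A (fun x => ψ x * φ x) :=
  ⟨hψ.mul h.smooth, h.compact.mul_left, (tsupport_mul_subset_right).trans h.support⟩

lemma IsTestFun.partialDeriv (h : IsTestFun A φ) (i : Fin n) :
    IsTestFun A (partialDeriv i φ) :=
  ⟨contDiff_partialDeriv i h.smooth, hasCompactSupport_partialDeriv i h.compact,
    (tsupport_partialDeriv i φ).trans h.support⟩

lemma IsTestFun.add (h : IsTestFun A φ) (h' : IsTestFun A ψ) :
    IsTestFun A (fun x => φ x + ψ x) :=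
  ⟨h.smooth.add h'.smooth, h.compact.add h'.compact,
    (tsupport_add _ _).trans (union_subset h.support h'.support)⟩

lemma IsTestFun.integrable (h : IsTestFun A φ) : Integrable φ :=
  h.smooth.continuous.integrable_of_hasCompactSupport h.compact

lemma IsSmoothField.isTestFun (h : IsSmoothField A F) (i j : Fin n) :
    IsTestFun A (fun x => F x i j) := ⟨h.smooth i j, h.compact i j, h.support i j⟩

lemma isSmoothField_of_isTestFun (h : ∀ i j, IsTestFun A (fun x => F x i j)) :
    IsSmoothField A F :=
  ⟨fun i j => (h i j).smooth, fun i j => (h i j).compact, fun i j => (h i j).support⟩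

lemma IsSmoothField.mono (h : IsSmoothField A F) (hAB : A ⊆ B) : IsSmoothField B F :=
  isSmoothField_of_isTestFun fun i j => (h.isTestFun i j).mono hAB

lemma isTestFun_zero : IsTestFun A (fun _ => 0) :=
  ⟨contDiff_const, HasCompactSupport.zero, by
    rw [show (fun _ : Euc n => (0 : ℝ)) = 0 from rfl, tsupport_zero]; exact empty_subset _⟩

lemma partialDeriv_add (i : Fin n) (hφ : ContDiff ℝ ∞ φ) (hψ : ContDiff ℝ ∞ ψ) :
    partialDeriv i (fun x => φ x + ψ x) = fun x => partialDeriv i φ x + partialDeriv i ψ x := by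
  funext x
  simp only [HTV.partialDeriv]
  rw [fderiv_fun_add (hφ.differentiable (by simp) x) (hψ.differentiable (by simp) x)]
  rfl

lemma partialDeriv_const_mul (i : Fin n) (c : ℝ) (hφ : ContDiff ℝ ∞ φ) :
    partialDeriv i (fun x => c * φ x) = fun x => c * partialDeriv i φ x := by
  funext x
  simp only [HTV.partialDeriv]
  rw [fderiv_const_mul (hφ.differentiable (by simp) x)]
  rfl

lemma partialDeriv_mul (i : Fin n) (hφ : ContDiff ℝ ∞ φ) (hψ : ContDiff ℝ ∞ ψ) :
    partialDeriv i (fun x => φ x * ψ x) =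
      fun x => φ x * partialDeriv i ψ x + partialDeriv i φ x * ψ x := by
  funext x
  simp only [HTV.partialDeriv]
  rw [fderiv_fun_mul (hφ.differentiable (by simp) x) (hψ.differentiable (by simp) x)]
  simp [mul_comm]

lemma hessDiv_add (hF : IsSmoothField A F) (hG : IsSmoothField B G) (x : Euc n) :
    hessDiv (fun y i j => F y i j + G y i j) x = hessDiv F x + hessDiv G x := by
  simp only [hessDiv, ← Finset.sum_add_distrib]
  refine Finset.sum_congr rfl fun i _ => Finset.sum_congr rfl fun j _ => ?_
  rw [partialDeriv_add j (hF.smooth i j) (hG.smooth i j),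
    partialDeriv_add i (contDiff_partialDeriv j (hF.smooth i j))
      (contDiff_partialDeriv j (hG.smooth i j))]

lemma hessDiv_const_mul (c : ℝ) (hF : IsSmoothField A F) (x : Euc n) :
    hessDiv (fun y i j => c * F y i j) x = c * hessDiv F x := by
  simp only [hessDiv, Finset.mul_sum]
  refine Finset.sum_congr rfl fun i _ => Finset.sum_congr rfl fun j _ => ?_
  rw [partialDeriv_const_mul j c (hF.smooth i j),
    partialDeriv_const_mul i c (contDiff_partialDeriv j (hF.smooth i j))]

/-- The matrix field with the single entry `φ` at position `(i, j)`. -/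
def singleField (i j : Fin n) (φ : Euc n → ℝ) : Euc n → Fin n → Fin n → ℝ :=
  fun x => Matrix.single i j (φ x)

lemma isSmoothField_singleField (i j : Fin n) (h : IsTestFun A φ) :
    IsSmoothField A (singleField i j φ) := by
  refine isSmoothField_of_isTestFun fun k l => ?_
  by_cases hkl : i = k ∧ j = l
  · simpa [singleField, Matrix.single_apply, hkl] using h
  · simpa [singleField, Matrix.single_apply, hkl] using isTestFun_zero

lemma hessDiv_singleField (i j : Fin n) (φ : Euc n → ℝ) (x : Euc n) :
    hessDiv (singleField i j φ) x = partialDeriv i (partialDeriv j φ) x := by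
  have hz : ∀ (k l : Fin n) (y : Euc n),
      HTV.partialDeriv k (HTV.partialDeriv l (fun _ : Euc n => (0 : ℝ))) y = 0 := by
    intro k l y
    have : HTV.partialDeriv l (fun _ : Euc n => (0 : ℝ)) = fun _ => 0 := by
      funext z; simp [HTV.partialDeriv]
    rw [this]; simp [HTV.partialDeriv]
  rw [hessDiv, Finset.sum_eq_single i, Finset.sum_eq_single j]
  · simp [singleField]
  · intro l _ hl
    simp [singleField, Ne.symm hl, hz]
  · simp
  · intro k _ hk
    simp [singleField, Ne.symm hk, hz]
  · simp

lemma IsSmoothField.continuous_hessDiv (h : IsSmoothField A F) : Continuous (hessDiv F) := by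
  unfold hessDiv
  exact continuous_finsetSum _ fun i _ => continuous_finsetSum _ fun j _ =>
    (((h.isTestFun i j).partialDeriv j).partialDeriv i).smooth.continuous

lemma IsSmoothField.exists_bound_hessDiv (h : IsSmoothField A F) :
    ∃ C, ∀ x, ‖hessDiv F x‖ ≤ C := by
  have := fun i j =>
    ((((h.isTestFun i j).partialDeriv j).partialDeriv i).compact).exists_bound_of_continuous
    (((h.isTestFun i j).partialDeriv j).partialDeriv i).smooth.continuous
  choose C hC using this
  exact ⟨∑ i, ∑ j, C i j, fun x => norm_sum_le_of_le _ fun i _ => norm_sum_le_of_le _ fun j _ =>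
    hC i j x⟩

lemma IsSmoothField.hessDiv_eq_zero (h : IsSmoothField A F) {x : Euc n} (hx : x ∉ A) :
    hessDiv F x = 0 :=
  Finset.sum_eq_zero fun i _ => Finset.sum_eq_zero fun j _ =>
    image_eq_zero_of_notMem_tsupport fun hx' =>
      hx ((((h.isTestFun i j).partialDeriv j).partialDeriv i).support hx')

lemma IsSmoothField.integrableOn_mul (h : IsSmoothField A F) {S : Set (Euc n)}
    (hu : IntegrableOn u S) : IntegrableOn (fun x => u x * hessDiv F x) S := by
  obtain ⟨C, hC⟩ := h.exists_bound_hessDiv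
  exact Integrable.mul_bdd (c := C) hu h.continuous_hessDiv.aestronglyMeasurable (.of_forall hC)

lemma hessPairing_add_right {S : Set (Euc n)} (hu : IntegrableOn u S) (hF : IsSmoothField A F)
    (hG : IsSmoothField B G) :
    hessPairing S u (fun y i j => F y i j + G y i j) = hessPairing S u F + hessPairing S u G := by
  simp only [hessPairing, hessDiv_add hF hG, mul_add]
  exact integral_add (hF.integrableOn_mul hu) (hG.integrableOn_mul hu)

lemma hessPairing_const_mul_right {S : Set (Euc n)} (c : ℝ) (hF : IsSmoothField A F) :
    hessPairing S u (fun y i j => c * F y i j) = c * hessPairing S u F := by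
  simp only [hessPairing, hessDiv_const_mul c hF, ← integral_const_mul]
  congr 1; funext x; ring

lemma hessPairing_add_left {S : Set (Euc n)} (hu : IntegrableOn u S) (hv : IntegrableOn v S)
    (hF : IsSmoothField A F) :
    hessPairing S (fun x => u x + v x) F = hessPairing S u F + hessPairing S v F := by
  simp only [hessPairing, add_mul]
  exact integral_add (hF.integrableOn_mul hu) (hF.integrableOn_mul hv)

lemma hessPairing_const_mul_left {S : Set (Euc n)} (c : ℝ) :
    hessPairing S (fun x => c * u x) F = c * hessPairing S u F := by
  simp only [hessPairing, ← integral_const_mul, mul_assoc]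

lemma hessPairing_congr {S : Set (Euc n)} (h : u =ᵐ[volume.restrict S] v) :
    hessPairing S u F = hessPairing S v F := by
  refine integral_congr_ae ?_
  filter_upwards [h] with x hx
  rw [hx]

lemma hessPairing_singleField (S : Set (Euc n)) (u : Euc n → ℝ) (i j : Fin n) (φ : Euc n → ℝ) :
    hessPairing S u (singleField i j φ) = ∫ x in S, u x * partialDeriv i (partialDeriv j φ) x := by
  simp only [hessPairing, hessDiv_singleField]

lemma IsTestField.const_mul (h : IsTestField 1 A F) {c : ℝ} (hc : |c| ≤ 1) :
    IsTestField 1 A (fun y i j => c * F y i j) := by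
  refine IsSmoothField.isTestField (isSmoothField_of_isTestFun fun i j =>
    (h.isSmoothField.isTestFun i j).mul_left contDiff_const) fun x => ?_
  exact schattenNorm_top_smul_le_one (h.norm_le x) hc

lemma IsTestField.neg (h : IsTestField 1 A F) : IsTestField 1 A (fun y i j => -1 * F y i j) :=
  h.const_mul (by simp)

lemma isTestField_singleField (i j : Fin n) (h : IsTestFun A φ) (hb : ∀ x, |φ x| ≤ 1) :
    IsTestField 1 A (singleField i j φ) :=
  (isSmoothField_singleField i j h).isTestField fun x =>
    schattenNorm_top_single_le_one i j (hb x)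

/-- The truncation at zero in `variation` is harmless for nonnegative bounds. All later estimates go
through this real-valued form. -/
lemma variation_le_iff {C : ℝ} (hC : 0 ≤ C) :
    variation 1 u A ≤ ENNReal.ofReal C ↔ ∀ F, IsTestField 1 A F → hessPairing A u F ≤ C := by
  have e : ∀ F : Euc n → Fin n → Fin n → ℝ, (∫ x in A, ∑ i, ∑ j,
      u x * partialDeriv i (partialDeriv j (fun y => F y i j)) x) = hessPairing A u F := by
    intro F
    simp only [hessPairing, hessDiv, Finset.mul_sum]
  simp only [variation, iSup_le_iff, e, ENNReal.ofReal_le_ofReal_iff hC]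

lemma hessPairing_le_toReal (h : variation 1 u A ≠ ⊤) (hF : IsTestField 1 A F) :
    hessPairing A u F ≤ (variation 1 u A).toReal :=
  (variation_le_iff ENNReal.toReal_nonneg).1 (by rw [ENNReal.ofReal_toReal h]) F hF

lemma abs_hessPairing_le_toReal (h : variation 1 u A ≠ ⊤) (hF : IsTestField 1 A F) :
    |hessPairing A u F| ≤ (variation 1 u A).toReal := by
  rw [abs_le']
  refine ⟨hessPairing_le_toReal h hF, ?_⟩
  have := hessPairing_le_toReal h hF.neg
  rwa [hessPairing_const_mul_right _ hF.isSmoothField, neg_one_mul] at this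

/-- A function of finite variation pairs continuously, in the sup norm, with test functions. -/
lemma abs_integral_mul_le_of_variation (h : variation 1 u A ≠ ⊤) (i j : Fin n)
    (hφ : IsTestFun A φ) {M : ℝ} (hM : 0 < M) (hb : ∀ x, |φ x| ≤ M) :
    |∫ x in A, u x * partialDeriv i (partialDeriv j φ) x| ≤ (variation 1 u A).toReal * M := by
  have hs : IsTestFun A (fun x => M⁻¹ * φ x) := hφ.mul_left contDiff_const
  have h1 := abs_hessPairing_le_toReal h (isTestField_singleField i j hs fun x => by
    rw [abs_mul, abs_inv, abs_of_pos hM, inv_mul_le_iff₀ hM, mul_one]; exact hb x)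
  have e : singleField i j (fun x => M⁻¹ * φ x) =
      fun y k l => M⁻¹ * singleField i j φ y k l := by
    funext y k l
    simp [singleField, Matrix.single_apply]
  rw [e, hessPairing_const_mul_right _ (isSmoothField_singleField i j hφ),
    hessPairing_singleField, abs_mul, abs_inv, abs_of_pos hM, inv_mul_le_iff₀ hM, mul_comm M] at h1
  exact h1

end

section

open Filter Topology Convolution Metric

variable {n : ℕ} {A B U : Set (Euc n)} {u v φ ψ ρ f : Euc n → ℝ}

/-! ### Functions with vanishing weak Hessian -/

lemma hasFDerivAt_affine (a : Euc n →ᵃ[ℝ] ℝ) (x : Euc n) :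
    HasFDerivAt a (LinearMap.toContinuousLinearMap a.linear) x := by
  have h1 : (a : Euc n → ℝ) =
      fun y => (LinearMap.toContinuousLinearMap a.linear) y + a 0 := by
    funext y
    simpa using congrFun a.decomp y
  rw [h1]
  exact (ContinuousLinearMap.hasFDerivAt _).add_const _

lemma affine_add_smul (a : Euc n →ᵃ[ℝ] ℝ) (x v : Euc n) (t : ℝ) :
    a (x + t • v) = a x + t * a.linear v := by
  have := a.map_vadd x (t • v)
  rw [vadd_eq_add, vadd_eq_add, map_smul, smul_eq_mul, add_comm (t • v), add_comm (t * _)] at this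
  exact this

instance finite_affineMap : Module.Finite ℝ (Euc n →ᵃ[ℝ] ℝ) :=
  Module.Finite.equiv (AffineMap.toConstProdLinearMap (V1 := Euc n) (V2 := ℝ) (k := ℝ) ℝ).symm

/-- Mollification of `f` by the kernel `ρ`. -/
noncomputable def mollify (ρ f : Euc n → ℝ) : Euc n → ℝ :=
  ρ ⋆[ContinuousLinearMap.lsmul ℝ ℝ, volume] f

lemma differentiableAt_mollify (hρ : ContDiff ℝ ∞ ρ) (hc : HasCompactSupport ρ)
    (hf : LocallyIntegrable f) (x : Euc n) : DifferentiableAt ℝ (mollify ρ f) x :=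
  (hc.hasFDerivAt_convolution_left (ContinuousLinearMap.lsmul ℝ ℝ) (hρ.of_le (by simp)) hf
    x).differentiableAt

lemma partialDeriv_mollify (i : Fin n) (hρ : ContDiff ℝ ∞ ρ) (hc : HasCompactSupport ρ)
    (hf : LocallyIntegrable f) : partialDeriv i (mollify ρ f) = mollify (partialDeriv i ρ) f := by
  funext x
  have h1 : ContDiff ℝ 1 ρ := hρ.of_le (by simp)
  have h := hc.hasFDerivAt_convolution_left (ContinuousLinearMap.lsmul ℝ ℝ) h1 hf x
  have hex : ConvolutionExistsAt (fderiv ℝ ρ) f x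
      ((ContinuousLinearMap.lsmul ℝ ℝ).precompL (Euc n)) volume :=
    (hc.fderiv ℝ).convolutionExists_left _ (h1.continuous_fderiv one_ne_zero) hf x
  simp only [HTV.partialDeriv, mollify]
  rw [h.fderiv, convolution_def, ContinuousLinearMap.integral_apply hex.integrable, convolution_def]
  rfl

lemma mollify_eq_integral (ρ f : Euc n → ℝ) (x : Euc n) :
    mollify ρ f x = ∫ y, f y * ρ (x - y) := by
  rw [mollify, convolution_eq_swap]
  refine integral_congr_ae (.of_forall fun y => ?_)
  simp [mul_comm]

lemma partialDeriv_comp_sub_left (i : Fin n) (hρ : ContDiff ℝ ∞ ρ) (x y : Euc n) :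
    partialDeriv i (fun z => ρ (x - z)) y = -partialDeriv i ρ (x - y) := by
  have h1 : HasFDerivAt (fun z => ρ (x - z))
      ((fderiv ℝ ρ (x - y)).comp (-ContinuousLinearMap.id ℝ (Euc n))) y :=
    (hρ.differentiable (by simp) (x - y)).hasFDerivAt.comp y ((hasFDerivAt_id y).const_sub x)
  simp [HTV.partialDeriv, h1.fderiv]

/-- The two reflections cancel in sign, so a second derivative of a mollification is the weak second
derivative tested on `y ↦ ρ (x - y)`. -/
lemma partialDeriv_partialDeriv_comp_sub_left (i j : Fin n) (hρ : ContDiff ℝ ∞ ρ) (x y : Euc n) :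
    partialDeriv i (partialDeriv j (fun z => ρ (x - z))) y =
      partialDeriv i (partialDeriv j ρ) (x - y) := by
  have : partialDeriv j (fun z => ρ (x - z)) = fun y => -partialDeriv j ρ (x - y) :=
    funext fun y => partialDeriv_comp_sub_left j hρ x y
  rw [this]
  have h2 := partialDeriv_comp_sub_left i (contDiff_partialDeriv j hρ) x y
  simp only [HTV.partialDeriv] at h2 ⊢
  rw [fderiv_fun_neg, neg_apply, h2, neg_neg]

lemma isTestFun_comp_sub_left (hρ : ContDiff ℝ ∞ ρ) (hc : HasCompactSupport ρ) {r : ℝ}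
    (hs : tsupport ρ ⊆ closedBall 0 r) {x : Euc n} (hx : closedBall x r ⊆ A) :
    IsTestFun A (fun y => ρ (x - y)) := by
  refine ⟨hρ.comp (contDiff_const.sub contDiff_id),
    hc.comp_homeomorph (Homeomorph.subLeft x), ?_⟩
  intro y hy
  have h1 : x - y ∈ tsupport ρ :=
    tsupport_comp_subset_preimage ρ (continuous_const.sub continuous_id) hy
  apply hx
  have := hs h1
  rwa [mem_closedBall_zero_iff, ← dist_eq_norm, dist_comm] at this

/-- If a second partial derivative of `f` vanishes weakly, so does that of its mollification. -/
lemma partialDeriv_partialDeriv_mollify_eq_zero (i j : Fin n) (hρ : ContDiff ℝ ∞ ρ)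
    (hc : HasCompactSupport ρ) {r : ℝ} (hs : tsupport ρ ⊆ closedBall 0 r)
    (hf : LocallyIntegrable f)
    (h0 : ∀ φ, IsTestFun U φ → ∫ x, f x * partialDeriv i (partialDeriv j φ) x = 0)
    {x : Euc n} (hx : closedBall x r ⊆ U) :
    partialDeriv i (partialDeriv j (mollify ρ f)) x = 0 := by
  rw [partialDeriv_mollify j hρ hc hf, partialDeriv_mollify i (contDiff_partialDeriv j hρ)
    (hasCompactSupport_partialDeriv j hc) hf, mollify_eq_integral]
  simp only [← partialDeriv_partialDeriv_comp_sub_left i j hρ]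
  exact h0 _ (isTestFun_comp_sub_left hρ hc hs hx)

lemma eq_zero_of_apply_single {M : Type*} [AddCommGroup M] [Module ℝ M] (L L' : Euc n →ₗ[ℝ] M)
    (h : ∀ i, L (EuclideanSpace.single i 1) = L' (EuclideanSpace.single i 1)) : L = L' := by
  refine (EuclideanSpace.basisFun (Fin n) ℝ).toBasis.ext fun i => ?_
  simpa using h i

/-- A `C²` function on a convex open set whose second partial derivatives vanish is affine. -/
lemma exists_affine_of_partialDeriv_eq_zero {g : Euc n → ℝ} (hU : IsOpen U) (hc : Convex ℝ U)
    (hg : Differentiable ℝ g) (hg' : ∀ i, Differentiable ℝ (partialDeriv i g))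
    (h0 : ∀ i j, ∀ x ∈ U, partialDeriv i (partialDeriv j g) x = 0) :
    ∃ a : Euc n →ᵃ[ℝ] ℝ, EqOn g a U := by
  rcases U.eq_empty_or_nonempty with rfl | ⟨x₀, hx₀⟩
  · exact ⟨0, by simp⟩
  have hconst : ∀ j, ∀ x ∈ U, partialDeriv j g x = partialDeriv j g x₀ := by
    intro j x hx
    refine hU.is_const_of_fderiv_eq_zero (𝕜 := ℝ) hc.isPreconnected (hg' j).differentiableOn
      ?_ hx hx₀
    intro y hy
    have := eq_zero_of_apply_single (fderiv ℝ (partialDeriv j g) y).toLinearMap 0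
      (fun i => h0 i j y hy)
    ext v
    exact LinearMap.congr_fun this v
  have hfd : ∀ x ∈ U, fderiv ℝ g x = fderiv ℝ g x₀ := by
    intro x hx
    have := eq_zero_of_apply_single (fderiv ℝ g x).toLinearMap (fderiv ℝ g x₀).toLinearMap
      (fun i => hconst i x hx)
    ext v
    exact LinearMap.congr_fun this v
  obtain ⟨c, hcst⟩ := hU.exists_eq_add_of_fderiv_eq (𝕜 := ℝ) hc.isPreconnected hg.differentiableOn
    (fderiv ℝ g x₀).differentiableOn (fun x hx => by rw [hfd x hx, ContinuousLinearMap.fderiv])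
  refine ⟨(fderiv ℝ g x₀).toLinearMap.toAffineMap + AffineMap.const ℝ (Euc n) c, fun x hx => ?_⟩
  rw [hcst hx]
  simp

/-- Restrictions of affine functions to `S` form a finite dimensional subspace of `S → ℝ`, which is
closed under pointwise convergence. -/
lemma exists_affine_of_tendsto {S : Set (Euc n)} {a : ℕ → Euc n →ᵃ[ℝ] ℝ}
    (h : ∀ x ∈ S, Tendsto (fun k => a k x) atTop (𝓝 (f x))) :
    ∃ b : Euc n →ᵃ[ℝ] ℝ, EqOn f b S := by
  let Φ : (Euc n →ᵃ[ℝ] ℝ) →ₗ[ℝ] (S → ℝ) :=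
    { toFun := fun b x => b x
      map_add' := fun _ _ => rfl
      map_smul' := fun _ _ => rfl }
  have hcl : IsClosed (LinearMap.range Φ : Set (S → ℝ)) :=
    (LinearMap.range Φ).closed_of_finiteDimensional
  have hmem : (fun x : S => f x) ∈ LinearMap.range Φ := by
    refine hcl.mem_of_tendsto (f := fun k => Φ (a k)) (b := atTop) ?_
      (.of_forall fun k => ⟨a k, rfl⟩)
    rw [tendsto_pi_nhds]
    exact fun x => h x x.2
  obtain ⟨b, hb⟩ := hmem
  exact ⟨b, fun x hx => (congrFun hb ⟨x, hx⟩).symm⟩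

/-- The standard sequence of mollifiers. -/
noncomputable def bumpSeq (n : ℕ) (k : ℕ) : ContDiffBump (0 : Euc n) where
  rIn := 1 / ((k : ℝ) + 1)
  rOut := 2 / ((k : ℝ) + 1)
  rIn_pos := by positivity
  rIn_lt_rOut := by gcongr; norm_num

lemma tendsto_bumpSeq_rOut : Tendsto (fun k => (bumpSeq n k).rOut) atTop (𝓝 0) := by
  have h := (tendsto_one_div_add_atTop_nhds_zero_nat (𝕜 := ℝ)).const_mul 2
  rw [mul_zero] at h
  refine h.congr fun k => ?_
  simp [bumpSeq, div_eq_mul_inv]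

/-- The mollification kernels. -/
noncomputable def kernelSeq (n k : ℕ) : Euc n → ℝ := (bumpSeq n k).normed volume

lemma contDiff_kernelSeq (k : ℕ) : ContDiff ℝ ∞ (kernelSeq n k) :=
  (bumpSeq n k).contDiff_normed

lemma hasCompactSupport_kernelSeq (k : ℕ) : HasCompactSupport (kernelSeq n k) :=
  (bumpSeq n k).hasCompactSupport_normed

lemma tsupport_kernelSeq (k : ℕ) : tsupport (kernelSeq n k) ⊆ closedBall 0 (bumpSeq n k).rOut :=
  ((bumpSeq n k).tsupport_normed_eq (μ := volume)).le

lemma ae_tendsto_mollify (hf : LocallyIntegrable f) :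
    ∀ᵐ x, Tendsto (fun k => mollify (kernelSeq n k) f x) atTop (𝓝 (f x)) :=
  ContDiffBump.ae_convolution_tendsto_right_of_locallyIntegrable (K := 2) tendsto_bumpSeq_rOut
    -- The outer radius is exactly twice the inner one, whence the ratio bound `K = 2`.
    (.of_forall fun k => by simp only [bumpSeq]; apply le_of_eq; ring) hf

lemma tendsto_mollify_of_continuous (hf : Continuous f) (x : Euc n) :
    Tendsto (fun k => mollify (kernelSeq n k) f x) atTop (𝓝 (f x)) :=
  ContDiffBump.convolution_tendsto_right_of_continuous tendsto_bumpSeq_rOut hf x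

/-- These points lie farther than `r` from the complement of `U`, so a mollification of radius `r`
there only sees values in `U`. For convexity, balls around the two endpoints are moved by the same
vector. -/
lemma convex_inner_parallel (hc : Convex ℝ U) (r : ℝ) :
    Convex ℝ {x : Euc n | ∃ δ > r, ball x δ ⊆ U} := by
  rintro x ⟨δ, hδ, hx⟩ y ⟨δ', hδ', hy⟩ a b ha hb hab
  refine ⟨min δ δ', lt_min hδ hδ', fun z hz => ?_⟩
  have hw : ‖z - (a • x + b • y)‖ < min δ δ' := by rwa [← dist_eq_norm, ← mem_ball]
  have e : z = a • (x + (z - (a • x + b • y))) + b • (y + (z - (a • x + b • y))) := by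
    rw [smul_add, smul_add, add_add_add_comm, ← add_smul, hab, one_smul]
    abel
  rw [e]
  refine hc (hx ?_) (hy ?_) ha hb hab
  · rw [mem_ball, dist_eq_norm, add_sub_cancel_left]
    exact hw.trans_le (min_le_left _ _)
  · rw [mem_ball, dist_eq_norm, add_sub_cancel_left]
    exact hw.trans_le (min_le_right _ _)

lemma isOpen_inner_parallel (U : Set (Euc n)) (r : ℝ) :
    IsOpen {x : Euc n | ∃ δ > r, ball x δ ⊆ U} := by
  rw [Metric.isOpen_iff]
  rintro x ⟨δ, hδ, hx⟩
  refine ⟨(δ - r) / 2, by linarith [hδ.lt], fun y hy => ⟨(δ + r) / 2, by linarith [hδ.lt], ?_⟩⟩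
  refine (ball_subset_ball' ?_).trans hx
  rw [mem_ball] at hy
  linarith

/-- A locally integrable function with vanishing weak Hessian on a convex open set is affine. -/
lemma exists_affine_ae_of_weak_hessian_eq_zero (hU : IsOpen U) (hc : Convex ℝ U)
    (hf : LocallyIntegrable f)
    (h0 : ∀ i j φ, IsTestFun U φ → ∫ x, f x * partialDeriv i (partialDeriv j φ) x = 0) :
    ∃ a : Euc n →ᵃ[ℝ] ℝ, f =ᵐ[volume.restrict U] a := by
  have haff : ∀ k, ∃ a : Euc n →ᵃ[ℝ] ℝ, EqOn (mollify (kernelSeq n k) f) a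
      {x | ∃ δ > (bumpSeq n k).rOut, ball x δ ⊆ U} := by
    intro k
    have h1 := contDiff_kernelSeq (n := n) k
    have h2 := hasCompactSupport_kernelSeq (n := n) k
    refine exists_affine_of_partialDeriv_eq_zero (isOpen_inner_parallel _ _)
      (convex_inner_parallel hc _) (fun x => differentiableAt_mollify h1 h2 hf x) (fun i x => ?_) ?_
    · rw [partialDeriv_mollify i h1 h2 hf]
      exact differentiableAt_mollify (contDiff_partialDeriv i h1)
        (hasCompactSupport_partialDeriv i h2) hf x
    · rintro i j x ⟨δ, hδ, hx⟩
      exact partialDeriv_partialDeriv_mollify_eq_zero i j h1 h2 (tsupport_kernelSeq k) hf (h0 i j)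
        ((closedBall_subset_ball hδ).trans hx)
  choose a ha using haff
  obtain ⟨b, hb⟩ := exists_affine_of_tendsto (f := f) (a := a)
    (S := {x | x ∈ U ∧ Tendsto (fun k => mollify (kernelSeq n k) f x) atTop (𝓝 (f x))}) (by
      -- The mollification radius tends to zero, so each point of `U` eventually lies in the region
      -- where the mollification is affine.
      rintro x ⟨hxU, hx⟩
      obtain ⟨δ, hδ, hball⟩ := Metric.isOpen_iff.1 hU x hxU
      refine hx.congr' ?_
      filter_upwards [tendsto_bumpSeq_rOut.eventually_lt_const hδ] with k hk
      exact ha k ⟨δ, hk, hball⟩)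
  refine ⟨b, ?_⟩
  rw [EventuallyEq, ae_restrict_iff' hU.measurableSet]
  filter_upwards [ae_tendsto_mollify hf] with x hx hxU
  exact hb ⟨hxU, hx⟩

/-- The same for functions which are only defined on a subset. -/
lemma exists_affine_ae_of_setIntegral_eq_zero (hU : IsOpen U) (hc : Convex ℝ U)
    {S : Set (Euc n)} (hS : MeasurableSet S) (hUS : U ⊆ S) (hf : IntegrableOn f S)
    (h0 : ∀ i j φ, IsTestFun U φ → ∫ x in S, f x * partialDeriv i (partialDeriv j φ) x = 0) :
    ∃ a : Euc n →ᵃ[ℝ] ℝ, f =ᵐ[volume.restrict U] a := by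
  obtain ⟨a, ha⟩ := exists_affine_ae_of_weak_hessian_eq_zero (f := S.indicator f) hU hc
    ((integrable_indicator_iff hS).2 hf).locallyIntegrable (fun i j φ hφ => by
      rw [← h0 i j φ hφ, ← integral_indicator hS]
      congr 1; funext x
      by_cases hx : x ∈ S <;> simp [hx])
  refine ⟨a, ?_⟩
  rw [EventuallyEq, ae_restrict_iff' hU.measurableSet] at ha ⊢
  filter_upwards [ha] with x hx hxU
  rw [← hx hxU, indicator_of_mem (hUS hxU)]

end

section

open Filter Topology Convolution Metric

variable {n : ℕ} {A B U : Set (Euc n)} {u v φ ψ ρ f ζ η θ : Euc n → ℝ} {m c : Euc n →ᵃ[ℝ] ℝ}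

/-! ### Jumps across hyperplanes -/

lemma contDiff_affine (a : Euc n →ᵃ[ℝ] ℝ) : ContDiff ℝ ∞ a := by
  have h1 : (a : Euc n → ℝ) =
      fun y => (LinearMap.toContinuousLinearMap a.linear) y + a 0 := by
    funext y
    simpa using congrFun a.decomp y
  rw [h1]
  exact (ContinuousLinearMap.contDiff _).add contDiff_const

lemma partialDeriv_affine (i : Fin n) (a : Euc n →ᵃ[ℝ] ℝ) :
    partialDeriv i a = fun _ => a.linear (EuclideanSpace.single i 1) := by
  funext x
  simp [HTV.partialDeriv, (hasFDerivAt_affine a x).fderiv]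

/-- The square of the positive part is differentiable everywhere, which permits integration by parts
across the hyperplane `{m = 0}`. -/
lemma hasDerivAt_max_zero_sq (s : ℝ) :
    HasDerivAt (fun t : ℝ => max t 0 ^ 2) (2 * max s 0) s := by
  rcases lt_trichotomy s 0 with h | rfl | h
  · rw [max_eq_right h.le, mul_zero]
    refine (hasDerivAt_const s (0 : ℝ)).congr_of_eventuallyEq ?_
    filter_upwards [eventually_lt_nhds h] with t ht
    rw [max_eq_right ht.le]; norm_num
  · rw [max_self, mul_zero, hasDerivAt_iff_isLittleO_nhds_zero]
    have h1 : (fun h : ℝ => h ^ 2) =o[𝓝 0] fun h => h := by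
      simpa using Asymptotics.isLittleO_pow_id (n := 2) (𝕜 := ℝ) (by norm_num)
    refine Asymptotics.IsBigO.trans_isLittleO ?_ h1
    refine Asymptotics.IsBigO.of_bound 1 (.of_forall fun t => ?_)
    simp only [zero_add, max_self, smul_zero, sub_zero, one_mul, Real.norm_eq_abs, abs_pow]
    norm_num
    rcases le_total t 0 with ht | ht
    · rw [max_eq_right ht]; simpa using sq_nonneg t
    · rw [max_eq_left ht]
  · rw [max_eq_left h.le]
    have := (hasDerivAt_pow 2 s)
    simp only [Nat.cast_ofNat, Nat.add_one_sub_one, pow_one] at this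
    refine this.congr_of_eventuallyEq ?_
    filter_upwards [eventually_gt_nhds h] with t ht
    rw [max_eq_left ht.le]

/-- The positive part of an affine function. -/
noncomputable def posPart (m : Euc n →ᵃ[ℝ] ℝ) (x : Euc n) : ℝ := max (m x) 0

lemma continuous_posPart (m : Euc n →ᵃ[ℝ] ℝ) : Continuous (posPart m) :=
  (contDiff_affine m).continuous.max continuous_const

lemma posPart_mul_self (m : Euc n →ᵃ[ℝ] ℝ) (x : Euc n) :
    m x * posPart m x = posPart m x ^ 2 := by
  unfold posPart
  rcases le_total (m x) 0 with h | h
  · simp [max_eq_right h]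
  · rw [max_eq_left h, sq]

lemma setIntegral_mul_eq_integral_posPart (m : Euc n →ᵃ[ℝ] ℝ) (g : Euc n → ℝ) :
    ∫ x in {x | 0 < m x}, m x * g x = ∫ x, posPart m x * g x := by
  have hS : MeasurableSet {x : Euc n | 0 < m x} :=
    (isOpen_lt continuous_const (contDiff_affine m).continuous).measurableSet
  rw [← integral_indicator hS]
  congr 1; funext x
  unfold posPart
  by_cases hx : 0 < m x
  · rw [indicator_of_mem (show x ∈ {x | 0 < m x} from hx), max_eq_left hx.le]
  · rw [indicator_of_notMem (show x ∉ {x | 0 < m x} from hx), max_eq_right (not_lt.1 hx), zero_mul]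

lemma hasFDerivAt_posPart_sq (m : Euc n →ᵃ[ℝ] ℝ) (x : Euc n) :
    HasFDerivAt (fun y => posPart m y ^ 2)
      ((2 * posPart m x) • LinearMap.toContinuousLinearMap m.linear) x :=
  (hasDerivAt_max_zero_sq (m x)).comp_hasFDerivAt x (hasFDerivAt_affine m x)

/-- Integration by parts against `m₊²`. -/
lemma integral_affine_mul_deriv_posPart_sq (m c : Euc n →ᵃ[ℝ] ℝ) (i : Fin n)
    (hζ : IsTestFun univ ζ) :
    ∫ x, c x * (2 * m.linear (EuclideanSpace.single i 1) * posPart m x * ζ x +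
        posPart m x ^ 2 * partialDeriv i ζ x) =
      -(c.linear (EuclideanSpace.single i 1) * ∫ x, posPart m x ^ 2 * ζ x) := by
  have hd : ∀ x, HasFDerivAt (fun y => posPart m y ^ 2 * ζ y)
      (posPart m x ^ 2 • fderiv ℝ ζ x +
        ζ x • ((2 * posPart m x) • LinearMap.toContinuousLinearMap m.linear)) x := fun x =>
    (hasFDerivAt_posPart_sq m x).mul (hζ.smooth.differentiable (by simp) x).hasFDerivAt
  have hdd : ∀ x, fderiv ℝ (fun y => posPart m y ^ 2 * ζ y) x (EuclideanSpace.single i 1) =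
      2 * m.linear (EuclideanSpace.single i 1) * posPart m x * ζ x +
        posPart m x ^ 2 * partialDeriv i ζ x := by
    intro x
    rw [(hd x).fderiv]
    simp [HTV.partialDeriv]
    ring
  have hp := continuous_posPart m
  have hc := (contDiff_affine c).continuous
  have cs1 : HasCompactSupport (fun x =>
      2 * m.linear (EuclideanSpace.single i 1) * posPart m x * ζ x +
        posPart m x ^ 2 * partialDeriv i ζ x) :=
    hζ.compact.mul_left.add (hζ.partialDeriv i).compact.mul_left
  have cs2 : HasCompactSupport (fun x => posPart m x ^ 2 * ζ x) := hζ.compact.mul_left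
  have ct1 : Continuous (fun x => 2 * m.linear (EuclideanSpace.single i 1) * posPart m x * ζ x +
        posPart m x ^ 2 * partialDeriv i ζ x) :=
    ((continuous_const.mul hp).mul hζ.smooth.continuous).add
      ((hp.pow 2).mul (hζ.partialDeriv i).smooth.continuous)
  have ct2 : Continuous (fun x => posPart m x ^ 2 * ζ x) := (hp.pow 2).mul hζ.smooth.continuous
  have key := integral_mul_fderiv_eq_neg_fderiv_mul_of_integrable
    (μ := (volume : Measure (Euc n)))
    (f := c) (g := fun y => posPart m y ^ 2 * ζ y) (v := EuclideanSpace.single i 1)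
    (by
      simp only [(hasFDerivAt_affine c _).fderiv]
      exact (ct2.integrable_of_hasCompactSupport cs2).const_mul _)
    (by
      simp only [hdd]
      exact (hc.mul ct1).integrable_of_hasCompactSupport cs1.mul_left)
    ((hc.mul ct2).integrable_of_hasCompactSupport cs2.mul_left)
    (fun x _ => (hasFDerivAt_affine c x).differentiableAt) (fun x _ => (hd x).differentiableAt)
  simp only [hdd, (hasFDerivAt_affine c _).fderiv] at key
  rw [key, integral_const_mul]
  rfl

lemma partialDeriv_affine_mul (m : Euc n →ᵃ[ℝ] ℝ) (i : Fin n) (hζ : ContDiff ℝ ∞ ζ) :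
    partialDeriv i (fun x => m x * ζ x) =
      fun x => m x * partialDeriv i ζ x + m.linear (EuclideanSpace.single i 1) * ζ x := by
  rw [partialDeriv_mul i (contDiff_affine m) hζ, partialDeriv_affine]

lemma partialDeriv_partialDeriv_affine_mul (m : Euc n →ᵃ[ℝ] ℝ) (i : Fin n)
    (hζ : ContDiff ℝ ∞ ζ) :
    partialDeriv i (partialDeriv i (fun x => m x * ζ x)) = fun x =>
      m x * partialDeriv i (partialDeriv i ζ) x +
        2 * m.linear (EuclideanSpace.single i 1) * partialDeriv i ζ x := by
  have h1 := contDiff_partialDeriv i hζ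
  rw [partialDeriv_affine_mul m i hζ,
    partialDeriv_add i ((contDiff_affine m).mul h1) (contDiff_const.mul hζ),
    partialDeriv_affine_mul m i h1, partialDeriv_const_mul i _ hζ]
  funext x; ring

lemma IsTestFun.affine_mul (h : IsTestFun A ζ) (m : Euc n →ᵃ[ℝ] ℝ) :
    IsTestFun A (fun x => m x * ζ x) := h.mul_left (contDiff_affine m)

/-- Test functions vanishing to third order on `{m = 0}` do not see a jump there. -/
lemma setIntegral_halfspace_cube_mul (m c : Euc n →ᵃ[ℝ] ℝ) (i : Fin n) (hζ : IsTestFun univ ζ) :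
    ∫ x in {x | 0 < m x}, c x * partialDeriv i (partialDeriv i
      (fun x => m x * (m x * (m x * ζ x)))) x = 0 := by
  set ν := m.linear (EuclideanSpace.single i 1) with hν
  -- Chosen so that `∂ᵢ(m³ ζ) = m² ξ`. The remaining derivative still leaves a factor `m`, so the
  -- half-space integral becomes one with `m₊²`.
  let ξ : Euc n → ℝ := fun x => 3 * ν * ζ x + m x * partialDeriv i ζ x
  have hξ : IsTestFun univ ξ := (hζ.mul_left contDiff_const).add ((hζ.partialDeriv i).affine_mul m)
  have h1 : partialDeriv i (fun x => m x * (m x * (m x * ζ x))) =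
      fun x => m x * (m x * ξ x) := by
    rw [partialDeriv_affine_mul m i ((hζ.affine_mul m).affine_mul m).smooth,
      partialDeriv_affine_mul m i (hζ.affine_mul m).smooth, partialDeriv_affine_mul m i hζ.smooth]
    funext x; simp only [ξ]; ring
  have h2 : partialDeriv i (fun x => m x * (m x * ξ x)) =
      fun x => m x * (m x * partialDeriv i ξ x + 2 * ν * ξ x) := by
    rw [partialDeriv_affine_mul m i (hξ.affine_mul m).smooth, partialDeriv_affine_mul m i hξ.smooth]
    funext x; ring
  rw [h1, h2]
  have h3 := integral_affine_mul_deriv_posPart_sq m c i hξ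
  have h4 := integral_affine_mul_deriv_posPart_sq m m i hζ
  rw [← hν] at h3 h4
  have e1 : ∫ x in {x | 0 < m x}, c x * (m x * (m x * partialDeriv i ξ x + 2 * ν * ξ x)) =
      ∫ x, c x * (2 * ν * posPart m x * ξ x + posPart m x ^ 2 * partialDeriv i ξ x) := by
    rw [show (fun x => c x * (m x * (m x * partialDeriv i ξ x + 2 * ν * ξ x))) =
      fun x => m x * (c x * (m x * partialDeriv i ξ x + 2 * ν * ξ x)) from by funext x; ring,
      setIntegral_mul_eq_integral_posPart]
    congr 1; funext x
    rw [← posPart_mul_self]; ring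
  have hp := continuous_posPart m
  -- The integrand is `∂ᵢ(m₊³ ζ)`. Its integral is computed from the integration by parts formula
  -- with `c = m`.
  have e2 : ∫ x, posPart m x ^ 2 * ξ x = 0 := by
    have : ∀ x, posPart m x ^ 2 * ξ x = m x * (2 * ν * posPart m x * ζ x +
        posPart m x ^ 2 * partialDeriv i ζ x) + ν * (posPart m x ^ 2 * ζ x) := by
      intro x
      rw [← posPart_mul_self]; simp only [ξ]; ring
    simp only [this]
    rw [integral_add, integral_const_mul, h4]
    · ring
    · refine Continuous.integrable_of_hasCompactSupport ?_ ?_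
      · exact (contDiff_affine m).continuous.mul
          (((continuous_const.mul hp).mul hζ.smooth.continuous).add
            ((hp.pow 2).mul (hζ.partialDeriv i).smooth.continuous))
      · exact (hζ.compact.mul_left.add (hζ.partialDeriv i).compact.mul_left).mul_left
    · exact (((hp.pow 2).mul hζ.smooth.continuous).integrable_of_hasCompactSupport
        hζ.compact.mul_left).const_mul _
  rw [e1, h3, e2]; simp

/-- If the distribution `∂ᵢ∂ᵢ(c 1_{m > 0})` is of order zero near a point, then it vanishes on test
functions which are divisible by `m`. -/
lemma setIntegral_halfspace_mul_eq_zero (m c : Euc n →ᵃ[ℝ] ℝ) (i : Fin n) {C : ℝ}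
    (hT : ∀ φ M, IsTestFun A φ → 0 < M → (∀ x, |φ x| ≤ M) →
      |∫ x in {x | 0 < m x}, c x * partialDeriv i (partialDeriv i φ) x| ≤ C * M)
    (hη : IsTestFun A η) :
    ∫ x in {x | 0 < m x}, c x * partialDeriv i (partialDeriv i (fun x => m x * η x)) x = 0 := by
  obtain ⟨M, hM⟩ := hη.compact.exists_bound_of_continuous hη.smooth.continuous
  set M' := |M| + 1 with hM'
  have hM'0 : 0 < M' := by positivity
  have hbd : ∀ x, |η x| ≤ M' := fun x => (hM x).trans ((le_abs_self M).trans (by linarith))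
  have key : ∀ ε : ℝ, 0 < ε →
      |∫ x in {x | 0 < m x}, c x * partialDeriv i (partialDeriv i (fun x => m x * η x)) x| ≤
        C * (ε * M') := by
    intro ε hε
    have hpos : ∀ x, 0 < ε ^ 2 + m x ^ 2 := fun x => by positivity
    have hsm : ContDiff ℝ ∞ (fun x => (ε ^ 2 + m x ^ 2)⁻¹) :=
      (contDiff_const.add ((contDiff_affine m).pow 2)).inv fun x => (hpos x).ne'
    -- Split `m η = ε² m ζ + m³ ζ` with `ζ = η / (ε² + m²)`. The cubic term is invisible, and the
    -- other is at most `ε` times the bound on `η`, because `ε |m| ≤ ε² + m²`.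
    let ζ : Euc n → ℝ := fun x => (ε ^ 2 + m x ^ 2)⁻¹ * η x
    have hζ : IsTestFun A ζ := hη.mul_left hsm
    let φ : Euc n → ℝ := fun x => ε ^ 2 * (m x * ζ x)
    have hφ : IsTestFun A φ := (hζ.affine_mul m).mul_left contDiff_const
    have h3 : IsTestFun A (fun x => m x * (m x * (m x * ζ x))) :=
      ((hζ.affine_mul m).affine_mul m).affine_mul m
    have e : (fun x => m x * η x) = fun x => φ x + m x * (m x * (m x * ζ x)) := by
      funext x
      have := (hpos x).ne'
      simp only [φ, ζ]
      field_simp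
    have hint : ∀ ψ, IsTestFun A ψ → IntegrableOn
        (fun x => c x * partialDeriv i (partialDeriv i ψ) x) {x | 0 < m x} := fun ψ hψ =>
      (((hψ.partialDeriv i).partialDeriv i).affine_mul c).integrable.integrableOn
    rw [e, partialDeriv_add i hφ.smooth h3.smooth,
      partialDeriv_add i (hφ.partialDeriv i).smooth (h3.partialDeriv i).smooth]
    simp only [mul_add]
    rw [integral_add (hint _ hφ) (hint _ h3),
      setIntegral_halfspace_cube_mul m c i (hζ.mono (subset_univ _)), add_zero]
    refine hT φ _ hφ (by positivity) fun x => ?_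
    have h4 : ε * |m x| ≤ ε ^ 2 + m x ^ 2 := by
      nlinarith [sq_nonneg (ε - |m x|), sq_abs (m x), abs_nonneg (m x)]
    have h5 : |φ x| = ε * (ε * |m x| * (ε ^ 2 + m x ^ 2)⁻¹) * |η x| := by
      simp only [φ, ζ, abs_mul, abs_inv, abs_of_pos (hpos x), abs_pow, abs_of_pos hε]
      ring
    rw [h5]
    refine mul_le_mul ?_ (hbd x) (abs_nonneg _) hε.le
    refine mul_le_of_le_one_right hε.le ?_
    rw [← div_eq_mul_inv, div_le_one (hpos x)]
    exact h4
  have hlim : Tendsto (fun ε : ℝ => C * (ε * M')) (𝓝[>] 0) (𝓝 0) := by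
    have : Tendsto (fun ε : ℝ => C * (ε * M')) (𝓝 0) (𝓝 (C * (0 * M'))) :=
      (continuous_const.mul (continuous_id.mul continuous_const)).tendsto 0
    rw [zero_mul, mul_zero] at this
    exact this.mono_left nhdsWithin_le_nhds
  have := ge_of_tendsto hlim (by filter_upwards [self_mem_nhdsWithin] with ε hε using key ε hε)
  exact abs_eq_zero.1 (le_antisymm this (abs_nonneg _))

lemma lipschitzWith_posPart (m : Euc n →ᵃ[ℝ] ℝ) : ∃ K, LipschitzWith K (posPart m) :=
  (AffineMap.lipschitzWith_of_finiteDimensional m).imp fun _ h => h.max_const 0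

lemma addHaar_affine_eq_zero (m : Euc n →ᵃ[ℝ] ℝ) {v : Euc n} (hv : m.linear v ≠ 0) :
    volume {x | m x = 0} = 0 := by
  have e : {x | m x = 0} = ((AffineSubspace.mk' (0 : ℝ) ⊥).comap m : Set (Euc n)) := by
    ext x; simp
  rw [e]
  refine Measure.addHaar_affineSubspace _ _ fun htop => ?_
  have h1 : ∀ x, m x = 0 := fun x => by
    have : x ∈ ((AffineSubspace.mk' (0 : ℝ) ⊥).comap m : AffineSubspace ℝ (Euc n)) := by
      rw [htop]; trivial
    simpa using this
  have h2 := affine_add_smul m 0 v 1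
  rw [h1, h1] at h2
  apply hv; linarith

/-- Integration by parts for the Lipschitz function `m₊`, whose derivative is almost everywhere the
constant slope on `{m > 0}` and zero elsewhere. -/
lemma setIntegral_halfspace_eq (m : Euc n →ᵃ[ℝ] ℝ) (i : Fin n)
    (hm : m.linear (EuclideanSpace.single i 1) ≠ 0) (hζ : IsTestFun univ ζ) :
    m.linear (EuclideanSpace.single i 1) * ∫ x in {x | 0 < m x}, ζ x =
      -∫ x, posPart m x * partialDeriv i ζ x := by
  set ν := m.linear (EuclideanSpace.single i 1) with hν
  obtain ⟨K, hK⟩ := lipschitzWith_posPart m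
  obtain ⟨D, hD⟩ := (hζ.smooth.of_le (m := 1) (by simp)).lipschitzWith_of_hasCompactSupport
    hζ.compact (by simp)
  have h := hK.integral_lineDeriv_mul_eq (μ := volume) hD hζ.compact (EuclideanSpace.single i 1)
  have hcm := (contDiff_affine m).continuous
  have hS : MeasurableSet {x : Euc n | 0 < m x} := (isOpen_lt continuous_const hcm).measurableSet
  have e1 : ∫ x, lineDeriv ℝ (posPart m) x (EuclideanSpace.single i 1) * ζ x =
      ν * ∫ x in {x | 0 < m x}, ζ x := by
    rw [← integral_const_mul, ← integral_indicator hS]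
    refine integral_congr_ae ?_
    have h0 := addHaar_affine_eq_zero m hm
    filter_upwards [compl_mem_ae_iff.2 h0] with x hx
    rcases lt_or_gt_of_ne (show m x ≠ 0 from hx) with hlt | hgt
    · rw [indicator_of_notMem (by simp [hlt.le])]
      have : posPart m =ᶠ[𝓝 x] fun _ => 0 := by
        filter_upwards [hcm.continuousAt.eventually_lt continuousAt_const hlt] with y hy
        exact max_eq_right hy.le
      rw [this.lineDeriv_eq, show lineDeriv ℝ (fun _ : Euc n => (0 : ℝ)) x
        (EuclideanSpace.single i 1) = 0 by simp [lineDeriv], zero_mul]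
    · rw [indicator_of_mem (by simpa using hgt)]
      have : posPart m =ᶠ[𝓝 x] m := by
        filter_upwards [continuousAt_const.eventually_lt hcm.continuousAt hgt] with y hy
        exact max_eq_left hy.le
      rw [this.lineDeriv_eq, (hasFDerivAt_affine m x).differentiableAt.lineDeriv_eq_fderiv,
        (hasFDerivAt_affine m x).fderiv]
      rfl
  rw [← e1, h, ← integral_neg]
  refine integral_congr_ae (.of_forall fun x => ?_)
  simp only
  rw [(hζ.smooth.differentiable (by simp) x).lineDeriv_eq_fderiv, map_neg, HTV.partialDeriv]
  ring

/-- Exchanges `m` and `c`: the jump `c 1_{m > 0}` tested with `m η` becomes the kink `m₊` tested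
with `c η`. Where `c` does not vanish, `η = θ / c` then gives an arbitrary test function `θ`. -/
lemma setIntegral_halfspace_mul_eq (m c : Euc n →ᵃ[ℝ] ℝ) (i : Fin n)
    (hm : m.linear (EuclideanSpace.single i 1) ≠ 0) (hη : IsTestFun univ η) :
    ∫ x in {x | 0 < m x}, c x * partialDeriv i (partialDeriv i (fun x => m x * η x)) x =
      -∫ x, posPart m x * partialDeriv i (partialDeriv i (fun x => c x * η x)) x := by
  have h1 := hη.partialDeriv i
  have h2 := h1.partialDeriv i
  have hp := continuous_posPart m
  have hint : ∀ ξ, IsTestFun univ ξ → Integrable (fun x => posPart m x * ξ x) := fun ξ hξ =>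
    (hp.mul hξ.smooth.continuous).integrable_of_hasCompactSupport hξ.compact.mul_left
  rw [partialDeriv_partialDeriv_affine_mul m i hη.smooth,
    partialDeriv_partialDeriv_affine_mul c i hη.smooth]
  have h3 := setIntegral_halfspace_eq m i hm (h1.affine_mul c)
  rw [partialDeriv_affine_mul c i h1.smooth] at h3
  have e1 : ∀ x, c x * (m x * partialDeriv i (partialDeriv i η) x +
      2 * m.linear (EuclideanSpace.single i 1) * partialDeriv i η x) =
      m x * (c x * partialDeriv i (partialDeriv i η) x) +
      2 * m.linear (EuclideanSpace.single i 1) * (c x * partialDeriv i η x) := fun x => by ring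
  have e2 : ∀ x, posPart m x * (c x * partialDeriv i (partialDeriv i η) x +
      2 * c.linear (EuclideanSpace.single i 1) * partialDeriv i η x) =
      posPart m x * (c x * partialDeriv i (partialDeriv i η) x) +
      2 * (posPart m x * (c.linear (EuclideanSpace.single i 1) * partialDeriv i η x)) :=
    fun x => by ring
  simp only [e1, e2]
  simp only [mul_add] at h3
  have i1 := hint _ (h2.affine_mul c)
  have i2 := hint _ (h1.mul_left (contDiff_const (c := c.linear (EuclideanSpace.single i 1))))
  rw [integral_add i1 i2] at h3
  rw [integral_add ((h2.affine_mul c).affine_mul m).integrable.integrableOn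
    ((h1.affine_mul c).integrable.const_mul _).integrableOn,
    setIntegral_mul_eq_integral_posPart, integral_const_mul, mul_assoc, h3,
    integral_add i1 (i2.const_mul 2), integral_const_mul]
  ring

/-- Zeros of `c` do no harm, since they stay away from the support of `θ`. -/
lemma IsTestFun.div_affine (hθ : IsTestFun A θ) (c : Euc n →ᵃ[ℝ] ℝ) (hc : ∀ x ∈ A, c x ≠ 0) :
    IsTestFun A (fun x => (c x)⁻¹ * θ x) := by
  refine ⟨?_, hθ.compact.mul_left, (tsupport_mul_subset_right).trans hθ.support⟩
  rw [contDiff_iff_contDiffAt]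
  intro x
  by_cases hx : x ∈ tsupport θ
  · exact ((contDiff_affine c).contDiffAt.inv (hc x (hθ.support hx))).mul hθ.smooth.contDiffAt
  · have : (fun x => (c x)⁻¹ * θ x) =ᶠ[𝓝 x] fun _ => 0 := by
      filter_upwards [(notMem_tsupport_iff_eventuallyEq.1 hx)] with y hy
      rw [hy]; simp
    exact contDiffAt_const.congr_of_eventuallyEq this

/-- The positive part of an affine function is not weakly affine across its zero set. -/
lemma exists_integral_posPart_ne_zero (m : Euc n →ᵃ[ℝ] ℝ) (i : Fin n)
    (hm : m.linear (EuclideanSpace.single i 1) ≠ 0) {z : Euc n} (hz : m z = 0) {r : ℝ}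
    (hr : 0 < r) :
    ¬ ∀ θ, IsTestFun (ball z r) θ →
      ∫ x, posPart m x * partialDeriv i (partialDeriv i θ) x = 0 := by
  intro h0
  set e : Euc n := EuclideanSpace.single i 1 with he
  have hp := continuous_posPart m
  have hloc : LocallyIntegrable (posPart m) := hp.locallyIntegrable
  -- If `∂ᵢ²` of `m₊` vanished weakly near `z`, its mollifications would be affine along the line
  -- through `z` in direction `e`, hence satisfy the midpoint identity. In the limit this fails for
  -- `m₊`, which has a kink at `z`.
  have hev : ∀ᶠ k in atTop, mollify (kernelSeq n k) (posPart m) (z + (r / 4) • e) +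
      mollify (kernelSeq n k) (posPart m) (z + (-(r / 4)) • e) =
      2 * mollify (kernelSeq n k) (posPart m) z := by
    filter_upwards [(tendsto_bumpSeq_rOut (n := n)).eventually_lt_const
      (show (0 : ℝ) < r / 2 by linarith)]
      with k hk
    have h1 := contDiff_kernelSeq (n := n) k
    have h2 := hasCompactSupport_kernelSeq (n := n) k
    set g := mollify (kernelSeq n k) (posPart m) with hg
    have hd : ∀ x, DifferentiableAt ℝ g x := fun x => differentiableAt_mollify h1 h2 hloc x
    have hd' : ∀ x, DifferentiableAt ℝ (partialDeriv i g) x := fun x => by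
      rw [hg, partialDeriv_mollify i h1 h2 hloc]
      exact differentiableAt_mollify (contDiff_partialDeriv i h1)
        (hasCompactSupport_partialDeriv i h2) hloc x
    have hline : ∀ t : ℝ, HasDerivAt (fun t : ℝ => z + t • e) e t := fun t => by
      simpa using ((hasDerivAt_id t).smul_const e).const_add z
    have hgl : ∀ t : ℝ, HasDerivAt (fun t : ℝ => g (z + t • e)) (partialDeriv i g (z + t • e)) t :=
      fun t => (hd _).hasFDerivAt.comp_hasDerivAt t (hline t)
    have hgl' : ∀ t : ℝ, HasDerivAt (fun t : ℝ => partialDeriv i g (z + t • e))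
        (partialDeriv i (partialDeriv i g) (z + t • e)) t :=
      fun t => (hd' _).hasFDerivAt.comp_hasDerivAt t (hline t)
    have hzero : ∀ t ∈ Ioo (-(r / 2)) (r / 2),
        partialDeriv i (partialDeriv i g) (z + t • e) = 0 := by
      intro t ht
      refine partialDeriv_partialDeriv_mollify_eq_zero i i h1 h2 (tsupport_kernelSeq k) hloc
        (U := ball z r) h0 ?_
      refine closedBall_subset_ball' ?_
      rw [dist_eq_norm, add_sub_cancel_left, norm_smul, he, PiLp.norm_single, norm_one, mul_one,
        Real.norm_eq_abs]
      linarith [abs_lt.2 ht]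
    have hconst : ∀ t ∈ Ioo (-(r / 2)) (r / 2),
        partialDeriv i g (z + t • e) = partialDeriv i g (z + (0 : ℝ) • e) := by
      intro t ht
      refine isOpen_Ioo.is_const_of_deriv_eq_zero (𝕜 := ℝ) isPreconnected_Ioo
        (fun s _ => (hgl' s).differentiableAt.differentiableWithinAt)
        (fun s hs => by rw [(hgl' s).deriv, hzero s hs]; rfl) ht ⟨by linarith, by linarith⟩
    set α := partialDeriv i g (z + (0 : ℝ) • e) with hα
    have hconst2 : ∀ t ∈ Ioo (-(r / 2)) (r / 2),
        g (z + t • e) - t * α = g (z + (0 : ℝ) • e) - 0 * α := by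
      intro t ht
      have hder : ∀ s : ℝ, HasDerivAt (fun s : ℝ => g (z + s • e) - s * α)
          (partialDeriv i g (z + s • e) - α) s := fun s => by
        have := (hgl s).fun_sub ((hasDerivAt_id s).mul_const α)
        rwa [one_mul] at this
      refine isOpen_Ioo.is_const_of_deriv_eq_zero (𝕜 := ℝ) isPreconnected_Ioo
        (f := fun s : ℝ => g (z + s • e) - s * α)
        (fun s _ => (hder s).differentiableAt.differentiableWithinAt)
        (fun s hs => by rw [(hder s).deriv, hconst s hs, sub_self]; rfl) ht
        ⟨by linarith, by linarith⟩
    have a1 := hconst2 (r / 4) ⟨by linarith, by linarith⟩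
    have a2 := hconst2 (-(r / 4)) ⟨by linarith, by linarith⟩
    rw [zero_smul, add_zero] at a1 a2
    linarith
  have l1 := (tendsto_mollify_of_continuous hp (z + (r / 4) • e)).add
    (tendsto_mollify_of_continuous hp (z + (-(r / 4)) • e))
  have l2 := (tendsto_mollify_of_continuous hp z).const_mul 2
  have := tendsto_nhds_unique l1 (l2.congr' (hev.mono fun k hk => hk.symm))
  simp only [posPart, affine_add_smul, hz, zero_add, max_self, mul_zero] at this
  have hrne : r / 4 ≠ 0 := by positivity
  have hne : r / 4 * m.linear e ≠ 0 := mul_ne_zero hrne hm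
  rcases lt_or_gt_of_ne hne with hlt | hgt
  · rw [max_eq_right hlt.le, max_eq_left (by linarith)] at this; linarith
  · rw [max_eq_left hgt.le, max_eq_right (by linarith)] at this; linarith

/-- A function of finite variation which is affine on both sides of a hyperplane does not jump
across it. -/
lemma affine_eq_of_variation_ne_top {S : Set (Euc n)} (hS : MeasurableSet S)
    (hvar : variation 1 u S ≠ ⊤) {a b m : Euc n →ᵃ[ℝ] ℝ} {z : Euc n} {r : ℝ}
    (hr : 0 < r) (hball : ball z r ⊆ S) (hz : m z = 0) (hm : m.linear ≠ 0)
    (ha : ∀ᵐ x, x ∈ ball z r → m x < 0 → u x = a x)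
    (hb : ∀ᵐ x, x ∈ ball z r → 0 < m x → u x = b x) : a z = b z := by
  obtain ⟨i, hi⟩ : ∃ i, m.linear (EuclideanSpace.single i 1) ≠ 0 := by
    by_contra! h
    exact hm (eq_zero_of_apply_single _ 0 fun i => by simpa using h i)
  by_contra hne
  let c : Euc n →ᵃ[ℝ] ℝ := b - a
  have hcz : c z ≠ 0 := by
    simp only [c, AffineMap.coe_sub, Pi.sub_apply]
    exact fun h => hne (by linarith)
  have hH : MeasurableSet {x : Euc n | 0 < m x} :=
    (isOpen_lt continuous_const (contDiff_affine m).continuous).measurableSet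
  -- Near `z` one has `u = a + c 1_{m > 0}` almost everywhere, and `a` has zero Hessian. So the jump
  -- part inherits the order-zero bound of `u`.
  have hT : ∀ φ M, IsTestFun (ball z r) φ → 0 < M → (∀ x, |φ x| ≤ M) →
      |∫ x in {x | 0 < m x}, c x * partialDeriv i (partialDeriv i φ) x| ≤
        (variation 1 u S).toReal * M := by
    intro φ M hφ hM hbd
    refine le_trans (le_of_eq ?_)
      (abs_integral_mul_le_of_variation hvar i i (hφ.mono hball) hM hbd)
    have h2 := (hφ.partialDeriv i).partialDeriv i
    have h0 : ∫ x, a x * partialDeriv i (partialDeriv i φ) x = 0 :=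
      integral_affine_mul a i i hφ.smooth hφ.compact
    congr 1
    rw [← zero_add (∫ x in {x | 0 < m x}, c x * partialDeriv i (partialDeriv i φ) x),
      ← integral_indicator hH, ← integral_indicator hS]
    nth_rewrite 1 [← h0]
    rw [← integral_add (h2.affine_mul a).integrable ((h2.affine_mul c).integrable.indicator hH)]
    refine integral_congr_ae ?_
    filter_upwards [ha, hb, compl_mem_ae_iff.2 (addHaar_affine_eq_zero m hi)] with x hxa hxb hx0
    by_cases hxB : x ∈ ball z r
    · rw [indicator_of_mem (hball hxB)]
      rcases lt_or_gt_of_ne (show m x ≠ 0 from hx0) with hlt | hgt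
      · rw [indicator_of_notMem (by simp [hlt.le]), hxa hxB hlt, add_zero]
      · rw [indicator_of_mem (by simpa using hgt), hxb hxB hgt]
        simp only [c, AffineMap.coe_sub, Pi.sub_apply]
        ring
    · have hzero : partialDeriv i (partialDeriv i φ) x = 0 :=
        image_eq_zero_of_notMem_tsupport fun h => hxB (h2.support h)
      simp [hzero, indicator]
  obtain ⟨δ, hδ, hcδ⟩ : ∃ δ > 0, ∀ x ∈ ball z δ, c x ≠ 0 := by
    have := (contDiff_affine c).continuous.continuousAt.eventually_ne hcz
    obtain ⟨δ, hδ, h⟩ := Metric.eventually_nhds_iff_ball.1 this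
    exact ⟨δ, hδ, h⟩
  -- If `c z ≠ 0`, testing the jump with `m θ / c` shows that `m₊` has weakly vanishing `∂ᵢ²` near
  -- `z`, which is absurd.
  refine exists_integral_posPart_ne_zero m i hi hz (lt_min hr hδ) fun θ hθ => ?_
  have hcne : ∀ x ∈ ball z (min r δ), c x ≠ 0 := fun x hx =>
    hcδ x (ball_subset_ball (min_le_right _ _) hx)
  have hη := hθ.div_affine c hcne
  have h1 := setIntegral_halfspace_mul_eq_zero m c i hT
    (hη.mono (ball_subset_ball (min_le_left _ _)))
  rw [setIntegral_halfspace_mul_eq m c i hi (hη.mono (subset_univ _)), neg_eq_zero] at h1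
  have e : (fun x => c x * ((c x)⁻¹ * θ x)) = θ := by
    funext x
    by_cases hx : c x = 0
    · have : x ∉ tsupport θ := fun h => hcne x (hθ.support h) hx
      rw [image_eq_zero_of_notMem_tsupport this]; simp
    · rw [mul_inv_cancel_left₀ hx]
  rwa [e] at h1

end

section

open Filter Topology

/-! ### Polytopes and their intersections -/

/-- An extreme point is determined by its support. If `y` vanishes wherever `x` does, then `x ± δ (x
- y)` both stay in the set for small `δ`, which forces `x = y` when `x` is extreme. There are
finitely many supports. -/
lemma finite_extremePoints_nonneg_fiber {ι M : Type*} [Finite ι] [AddCommGroup M] [Module ℝ M]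
    (L : (ι → ℝ) →ₗ[ℝ] M) (b : M) :
    (extremePoints ℝ {x : ι → ℝ | (∀ i, 0 ≤ x i) ∧ L x = b}).Finite := by
  refine Set.Finite.of_finite_image (f := fun x => {i | x i ≠ 0}) (Set.toFinite _) ?_
  intro x hx y hy hxy
  have hsupp : ∀ i, x i = 0 → y i = 0 := by
    intro i hi
    by_contra hne
    have : i ∈ {i | x i ≠ 0} := by
      rw [show {i | x i ≠ 0} = {i | y i ≠ 0} from hxy]; exact hne
    exact this hi
  obtain ⟨⟨hx0, hxL⟩, hxe⟩ := hx
  obtain ⟨⟨hy0, hyL⟩, -⟩ := hy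
  have hev : ∀ᶠ δ : ℝ in 𝓝[>] 0, ∀ i, 0 ≤ x i + δ * (x i - y i) := by
    rw [eventually_all]
    intro i
    rcases (hx0 i).eq_or_lt with h | h
    · filter_upwards with δ
      rw [← h, hsupp i h.symm]; simp
    · have : Tendsto (fun δ : ℝ => x i + δ * (x i - y i)) (𝓝[>] 0) (𝓝 (x i + 0 * (x i - y i))) :=
        ((continuous_const.add (continuous_id.mul continuous_const)).tendsto 0).mono_left
          nhdsWithin_le_nhds
      rw [zero_mul, add_zero] at this
      filter_upwards [this.eventually_const_lt h] with δ hδ using hδ.le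
  obtain ⟨δ, hδ, hδ0, hδ1⟩ := (hev.and (Ioc_mem_nhdsGT (zero_lt_one' ℝ))).exists
  have m1 : x + δ • (x - y) ∈ {x : ι → ℝ | (∀ i, 0 ≤ x i) ∧ L x = b} := by
    refine ⟨hδ, ?_⟩
    rw [map_add, map_smul, map_sub, hxL, hyL, sub_self, smul_zero, add_zero]
  have m2 : x - δ • (x - y) ∈ {x : ι → ℝ | (∀ i, 0 ≤ x i) ∧ L x = b} := by
    refine ⟨fun i => ?_, ?_⟩
    · simp only [Pi.sub_apply, Pi.smul_apply, smul_eq_mul]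
      nlinarith [hx0 i, hy0 i]
    · rw [map_sub, map_smul, map_sub, hxL, hyL, sub_self, smul_zero, sub_zero]
  have hseg : x ∈ openSegment ℝ (x + δ • (x - y)) (x - δ • (x - y)) := by
    refine ⟨1 / 2, 1 / 2, by norm_num, by norm_num, by norm_num, ?_⟩
    rw [← smul_add, add_add_sub_cancel, ← two_smul ℝ x, smul_smul]
    norm_num
  have h := hxe m1 m2 hseg
  have h2 : δ • (x - y) = 0 := by simpa using h
  exact sub_eq_zero.1 ((smul_eq_zero.1 h2).resolve_left hδ0.ne')

/-- The intersection is a linear image of the compact set `K` of pairs of barycentric weights that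
represent the same point. `K` is a fibre of a linear map in the nonnegative orthant, so it has
finitely many extreme points, and Krein–Milman makes it their convex hull. -/
lemma exists_finite_convexHull_inter {E : Type*} [NormedAddCommGroup E] [NormedSpace ℝ E]
    {s t : Set E} (hs : s.Finite) (ht : t.Finite) :
    ∃ w : Set E, w.Finite ∧ convexHull ℝ s ∩ convexHull ℝ t = convexHull ℝ w := by
  let _ : Fintype s := hs.fintype
  let _ : Fintype t := ht.fintype
  let Φ : (s → ℝ) →ₗ[ℝ] E := ∑ x, (LinearMap.proj (R := ℝ) x).smulRight x.1
  let Ψ : (t → ℝ) →ₗ[ℝ] E := ∑ x, (LinearMap.proj (R := ℝ) x).smulRight x.1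
  let i₁ : (s ⊕ t → ℝ) →ₗ[ℝ] (s → ℝ) := LinearMap.funLeft ℝ ℝ Sum.inl
  let i₂ : (s ⊕ t → ℝ) →ₗ[ℝ] (t → ℝ) := LinearMap.funLeft ℝ ℝ Sum.inr
  let σ₁ : (s → ℝ) →ₗ[ℝ] ℝ := ∑ x, LinearMap.proj x
  let σ₂ : (t → ℝ) →ₗ[ℝ] ℝ := ∑ x, LinearMap.proj x
  let L : (s ⊕ t → ℝ) →ₗ[ℝ] ℝ × ℝ × E :=
    (σ₁ ∘ₗ i₁).prod ((σ₂ ∘ₗ i₂).prod (Φ ∘ₗ i₁ - Ψ ∘ₗ i₂))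
  let K : Set (s ⊕ t → ℝ) := {x | (∀ i, 0 ≤ x i) ∧ L x = (1, 1, 0)}
  have hK : ∀ x, x ∈ K ↔ i₁ x ∈ stdSimplex ℝ s ∧ i₂ x ∈ stdSimplex ℝ t ∧ Φ (i₁ x) = Ψ (i₂ x) := by
    intro x
    have hL : L x = (∑ i, x (Sum.inl i), ∑ i, x (Sum.inr i), Φ (i₁ x) - Ψ (i₂ x)) := by
      have h1 : σ₁ (i₁ x) = ∑ i, x (Sum.inl i) := by simp [σ₁, i₁, LinearMap.sum_apply]
      have h2 : σ₂ (i₂ x) = ∑ i, x (Sum.inr i) := by simp [σ₂, i₂, LinearMap.sum_apply]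
      rw [← h1, ← h2]
      rfl
    change ((∀ i, 0 ≤ x i) ∧ L x = (1, 1, 0)) ↔
      ((∀ i, 0 ≤ x (Sum.inl i)) ∧ ∑ i, x (Sum.inl i) = 1) ∧
      ((∀ i, 0 ≤ x (Sum.inr i)) ∧ ∑ i, x (Sum.inr i) = 1) ∧ Φ (i₁ x) = Ψ (i₂ x)
    rw [hL, Sum.forall, Prod.mk.injEq, Prod.mk.injEq, sub_eq_zero]
    tauto
  have himg : convexHull ℝ s ∩ convexHull ℝ t = (Φ ∘ₗ i₁) '' K := by
    rw [hs.convexHull_eq_image, ht.convexHull_eq_image]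
    ext z
    constructor
    · rintro ⟨⟨a, ha, rfl⟩, ⟨b, hb, hab⟩⟩
      exact ⟨Sum.elim a b, (hK _).2 ⟨ha, hb, hab.symm⟩, rfl⟩
    · rintro ⟨x, hx, rfl⟩
      obtain ⟨h1, h2, h3⟩ := (hK x).1 hx
      exact ⟨⟨i₁ x, h1, rfl⟩, ⟨i₂ x, h2, h3.symm⟩⟩
  have hconv : Convex ℝ K := by
    intro x hx y hy a b ha hb hab
    refine ⟨fun i => ?_, ?_⟩
    · have h1 := hx.1 i
      have h2 := hy.1 i
      simp only [Pi.add_apply, Pi.smul_apply, smul_eq_mul]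
      positivity
    · rw [map_add, map_smul, map_smul, hx.2, hy.2, ← add_smul, hab, one_smul]
  have hcl : IsClosed K := by
    have hL : Continuous L := L.continuous_of_finiteDimensional
    exact (isClosed_le continuous_const continuous_id).inter (isClosed_eq hL continuous_const)
  have hcomp : IsCompact K := by
    refine Metric.isCompact_of_isClosed_isBounded hcl ?_
    refine (Metric.isBounded_Icc (0 : s ⊕ t → ℝ) 1).subset fun x hx => ⟨hx.1, ?_⟩
    obtain ⟨h1, h2, -⟩ := (hK x).1 hx
    rintro (i | i)
    · exact (mem_Icc_of_mem_stdSimplex h1 i).2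
    · exact (mem_Icc_of_mem_stdSimplex h2 i).2
  have hfin : (extremePoints ℝ K).Finite := finite_extremePoints_nonneg_fiber L _
  have hKM := closure_convexHull_extremePoints hcomp hconv
  rw [(hfin.isClosed_convexHull ℝ).closure_eq] at hKM
  refine ⟨(Φ ∘ₗ i₁) '' extremePoints ℝ K, hfin.image _, ?_⟩
  rw [himg, ← (Φ ∘ₗ i₁).image_convexHull, hKM]

variable {n : ℕ} {P Q : Set (Euc n)} {Ps Qs : Set (Set (Euc n))}

lemma IsPolytope.isCompact (h : IsPolytope P) : IsCompact P := by
  obtain ⟨⟨t, ht, rfl⟩, -⟩ := h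
  exact ht.isCompact_convexHull ℝ

lemma IsPolytope.convex (h : IsPolytope P) : Convex ℝ P := by
  obtain ⟨⟨t, ht, rfl⟩, -⟩ := h
  exact convex_convexHull ℝ t

lemma IsPolytope.isClosed (h : IsPolytope P) : IsClosed P := h.isCompact.isClosed

lemma IsPolytope.inter (hP : IsPolytope P) (hQ : IsPolytope Q)
    (h : (interior (P ∩ Q)).Nonempty) : IsPolytope (P ∩ Q) := by
  obtain ⟨⟨s, hs, rfl⟩, -⟩ := hP
  obtain ⟨⟨t, ht, rfl⟩, -⟩ := hQ
  exact ⟨exists_finite_convexHull_inter hs ht, h⟩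

lemma IsPolytopeDecomposition.exists_mem (h : IsPolytopeDecomposition Ps) (x : Euc n) :
    ∃ P ∈ Ps, x ∈ P := by
  have : x ∈ ⋃₀ Ps := by rw [h.cover]; trivial
  exact this

lemma IsPolytopeDecomposition.disjoint_interior (h : IsPolytopeDecomposition Ps) (hP : P ∈ Ps)
    (hQ : Q ∈ Ps) (hne : P ≠ Q) : Disjoint (interior P) Q := by
  rw [Set.disjoint_left]
  intro x hx hxQ
  exact (h.boundary P hP Q hQ hne ⟨interior_subset hx, hxQ⟩).1.2 hx

/-- The common refinement of two polytope decompositions. -/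
def commonRefinement (Ps Qs : Set (Set (Euc n))) : Set (Set (Euc n)) :=
  {R | (∃ P ∈ Ps, ∃ Q ∈ Qs, P ∩ Q = R) ∧ (interior R).Nonempty}

/-- The delicate point is covering, as intersections without interior are discarded. A point lying
only in discarded ones would have a neighbourhood covered by finitely many of them, yet these are
closed convex sets equal to their frontiers, hence null. -/
lemma isPolytopeDecomposition_commonRefinement (hP : IsPolytopeDecomposition Ps)
    (hQ : IsPolytopeDecomposition Qs) : IsPolytopeDecomposition (commonRefinement Ps Qs) where
  polytope := by
    rintro _ ⟨⟨P, hPs, Q, hQs, rfl⟩, hne⟩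
    exact (hP.polytope P hPs).inter (hQ.polytope Q hQs) hne
  cover := by
    refine eq_univ_of_forall fun x => ?_
    by_contra hx
    have hfP := hP.locallyFinite x 1
    have hfQ := hQ.locallyFinite x 1
    set SP := {P ∈ Ps | (P ∩ Metric.ball x 1).Nonempty}
    set SQ := {Q ∈ Qs | (Q ∩ Metric.ball x 1).Nonempty}
    have hfin : (image2 (· ∩ ·) SP SQ).Finite := hfP.image2 _ hfQ
    have hclR : ∀ R ∈ image2 (· ∩ ·) SP SQ, IsClosed R ∧ Convex ℝ R := by
      rintro _ ⟨P, hp, Q, hq, rfl⟩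
      exact ⟨(hP.polytope P hp.1).isClosed.inter (hQ.polytope Q hq.1).isClosed,
        (hP.polytope P hp.1).convex.inter (hQ.polytope Q hq.1).convex⟩
    have hcl : IsClosed (⋃₀ {R ∈ image2 (· ∩ ·) SP SQ | (interior R).Nonempty}) := by
      rw [sUnion_eq_biUnion]
      exact (hfin.subset (sep_subset _ _)).isClosed_biUnion fun R hR => (hclR R hR.1).1
    have hxn : x ∉ ⋃₀ {R ∈ image2 (· ∩ ·) SP SQ | (interior R).Nonempty} := by
      rintro ⟨R, ⟨⟨P, hp, Q, hq, hR⟩, hne⟩, hxR⟩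
      exact hx ⟨R, ⟨⟨P, hp.1, Q, hq.1, hR⟩, hne⟩, hxR⟩
    obtain ⟨δ, hδ, hball⟩ := Metric.isOpen_iff.1 hcl.isOpen_compl x hxn
    have hnull : volume (⋃₀ {R ∈ image2 (· ∩ ·) SP SQ | ¬ (interior R).Nonempty}) = 0 := by
      rw [measure_sUnion_null_iff (hfin.subset (sep_subset _ _)).countable]
      rintro R ⟨hR, hemp⟩
      have h1 : frontier R = R := by
        rw [(hclR R hR).1.frontier_eq, not_nonempty_iff_eq_empty.1 hemp, sdiff_empty]
      rw [← h1]
      exact (hclR R hR).2.addHaar_frontier _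
    have hsub : Metric.ball x (min δ 1) ⊆
        ⋃₀ {R ∈ image2 (· ∩ ·) SP SQ | ¬ (interior R).Nonempty} := by
      intro y hy
      obtain ⟨P, hp, hyP⟩ := hP.exists_mem y
      obtain ⟨Q, hq, hyQ⟩ := hQ.exists_mem y
      have hy1 : y ∈ Metric.ball x 1 := Metric.ball_subset_ball (min_le_right _ _) hy
      have hmem : P ∩ Q ∈ image2 (· ∩ ·) SP SQ :=
        ⟨P, ⟨hp, y, hyP, hy1⟩, Q, ⟨hq, y, hyQ, hy1⟩, rfl⟩
      refine ⟨P ∩ Q, ⟨hmem, fun hne => ?_⟩, hyP, hyQ⟩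
      exact hball (Metric.ball_subset_ball (min_le_left _ _) hy) ⟨P ∩ Q, ⟨hmem, hne⟩, hyP, hyQ⟩
    exact (Metric.measure_ball_pos volume x (lt_min hδ one_pos)).ne' (measure_mono_null hsub hnull)
  boundary := by
    rintro _ ⟨⟨P, hp, Q, hq, rfl⟩, hne⟩ _ ⟨⟨P', hp', Q', hq', rfl⟩, hne'⟩ hdiff x ⟨hx, hx'⟩
    have key : ∀ {P Q P' Q' : Set (Euc n)}, P ∈ Ps → Q ∈ Qs → P' ∈ Ps → Q' ∈ Qs →
        P ∩ Q ≠ P' ∩ Q' → x ∈ P ∩ Q → x ∈ P' ∩ Q' → x ∈ frontier (P ∩ Q) := by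
      intro P Q P' Q' hp hq hp' hq' hdiff hx hx'
      refine ⟨subset_closure hx, fun hint => hdiff ?_⟩
      rw [interior_inter] at hint
      have e1 : P = P' := by
        by_contra h
        exact Set.disjoint_left.1 (hP.disjoint_interior hp hp' h) hint.1 hx'.1
      have e2 : Q = Q' := by
        by_contra h
        exact Set.disjoint_left.1 (hQ.disjoint_interior hq hq' h) hint.2 hx'.2
      rw [e1, e2]
    exact ⟨key hp hq hp' hq' hdiff hx hx', key hp' hq' hp hq hdiff.symm hx' hx⟩
  locallyFinite := by
    intro x r
    refine ((hP.locallyFinite x r).image2 (· ∩ ·) (hQ.locallyFinite x r)).subset ?_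
    rintro _ ⟨⟨⟨P, hp, Q, hq, rfl⟩, -⟩, y, hy, hyb⟩
    exact ⟨P, ⟨hp, y, hy.1, hyb⟩, Q, ⟨hq, y, hy.2, hyb⟩, rfl⟩

/-! ### Convexity of the CPWL classes and of the unit ball. -/

variable {f g : Euc n → ℝ} {Ω : Set (Euc n)}

lemma IsCPWL.add (hf : IsCPWL Ω f) (hg : IsCPWL Ω g) : IsCPWL Ω (fun x => f x + g x) := by
  obtain ⟨hfc, Ps, hP, hfP⟩ := hf
  obtain ⟨hgc, Qs, hQ, hgQ⟩ := hg
  refine ⟨hfc.add hgc, commonRefinement Ps Qs, isPolytopeDecomposition_commonRefinement hP hQ, ?_⟩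
  rintro _ ⟨⟨P, hp, Q, hq, rfl⟩, -⟩
  obtain ⟨a, ha⟩ := hfP P hp
  obtain ⟨b, hb⟩ := hgQ Q hq
  refine ⟨a + b, fun x hx => ?_⟩
  simp only [AffineMap.coe_add, Pi.add_apply]
  rw [ha ⟨hx.1.1, hx.2⟩, hb ⟨hx.1.2, hx.2⟩]

lemma IsCPWL.const_mul (hf : IsCPWL Ω f) (c : ℝ) : IsCPWL Ω (fun x => c * f x) := by
  obtain ⟨hfc, Ps, hP, hfP⟩ := hf
  refine ⟨continuousOn_const.mul hfc, Ps, hP, fun P hp => ?_⟩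
  obtain ⟨a, ha⟩ := hfP P hp
  refine ⟨c • a, fun x hx => ?_⟩
  simp only [ha hx, AffineMap.coe_smul, Pi.smul_apply, smul_eq_mul]

lemma convex_cpwlClasses (n : ℕ) : Convex ℝ (cpwlClasses n) := by
  rintro _ ⟨u, ⟨f, hf, huf⟩, rfl⟩ _ ⟨v, ⟨g, hg, hvg⟩, rfl⟩ a b - - -
  refine ⟨a • u + b • v, ⟨_, (hf.const_mul a).add (hg.const_mul b), ?_⟩, by simp⟩
  filter_upwards [huf, hvg, Lp.coeFn_add (a • u) (b • v), Lp.coeFn_smul a u, Lp.coeFn_smul b v]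
    with x h1 h2 h3 h4 h5
  rw [h3, Pi.add_apply, h4, h5, Pi.smul_apply, Pi.smul_apply, h1, h2]
  rfl

lemma integrableOn_coeFn (u : L1 n) : IntegrableOn u (cube n) := L1.integrable_coeFn u

lemma quotVariation_proj (u : L1 n) : quotVariation 1 (proj n u) = variation 1 u (cube n) := rfl

lemma hessPairing_coe_add (u v : L1 n) {A : Set (Euc n)} {F : Euc n → Fin n → Fin n → ℝ}
    (hF : IsSmoothField A F) : hessPairing (cube n) (u + v : L1 n) F =
      hessPairing (cube n) u F + hessPairing (cube n) v F := by
  rw [← hessPairing_add_left (integrableOn_coeFn u) (integrableOn_coeFn v) hF]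
  exact hessPairing_congr (Lp.coeFn_add u v)

lemma hessPairing_coe_smul (c : ℝ) (u : L1 n) (F : Euc n → Fin n → Fin n → ℝ) :
    hessPairing (cube n) (c • u : L1 n) F = c * hessPairing (cube n) u F := by
  rw [← hessPairing_const_mul_left]
  exact hessPairing_congr (Lp.coeFn_smul c u)

lemma variation_le_one_iff {u : Euc n → ℝ} {A : Set (Euc n)} :
    variation 1 u A ≤ 1 ↔ ∀ F, IsTestField 1 A F → hessPairing A u F ≤ 1 := by
  rw [← variation_le_iff zero_le_one, ENNReal.ofReal_one]

lemma convex_unitBall (n : ℕ) : Convex ℝ (unitBall n) := by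
  intro x hx y hy a b ha hb hab
  obtain ⟨u, rfl⟩ := (affineSubspace n).mkQ_surjective x
  obtain ⟨v, rfl⟩ := (affineSubspace n).mkQ_surjective y
  change quotVariation 1 (proj n u) ≤ 1 at hx
  change quotVariation 1 (proj n v) ≤ 1 at hy
  change quotVariation 1 (a • proj n u + b • proj n v) ≤ 1
  rw [← map_smul, ← map_smul, ← map_add]
  rw [quotVariation_proj, variation_le_one_iff] at hx hy ⊢
  intro F hF
  rw [hessPairing_coe_add _ _ hF.isSmoothField, hessPairing_coe_smul, hessPairing_coe_smul]
  nlinarith [hx F hF, hy F hF]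

end

section

open Filter Topology

/-! ### Minkowski's theorem on extreme points -/

/-- Dimension reduction for Minkowski's theorem: translation by `x₀` moves `K` into the kernel of
`f` and preserves extreme points. -/
lemma subset_convexHull_extremePoints_of_subset_hyperplane {E : Type*} [NormedAddCommGroup E]
    [NormedSpace ℝ E] {K : Set E} {f : E →ₗ[ℝ] ℝ} {x₀ : E}
    (hf : ∀ x ∈ K, f x = f x₀)
    (ih : ((fun y : LinearMap.ker f => x₀ + (y : E)) ⁻¹' K) ⊆
      convexHull ℝ (extremePoints ℝ ((fun y : LinearMap.ker f => x₀ + (y : E)) ⁻¹' K))) :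
    K ⊆ convexHull ℝ (extremePoints ℝ K) := by
  let τ : LinearMap.ker f →ᵃ[ℝ] E :=
    AffineMap.const ℝ _ x₀ + (LinearMap.ker f).subtype.toAffineMap
  have hτ : ∀ y, τ y = x₀ + (y : E) := fun y => rfl
  have hsurj : ∀ x ∈ K, ∃ y : LinearMap.ker f, τ y = x := fun x hx =>
    ⟨⟨x - x₀, by rw [LinearMap.mem_ker, map_sub, hf x hx, sub_self]⟩, by simp [hτ]⟩
  have hinj : Function.Injective τ := fun y z h => by
    rw [hτ, hτ, add_right_inj] at h; exact Subtype.ext h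
  have hext : τ '' extremePoints ℝ (τ ⁻¹' K) ⊆ extremePoints ℝ K := by
    rintro _ ⟨e, he, rfl⟩
    refine ⟨he.1, fun a ha b hb hseg => ?_⟩
    obtain ⟨a, rfl⟩ := hsurj a ha
    obtain ⟨b, rfl⟩ := hsurj b hb
    rw [← image_openSegment ℝ τ a b] at hseg
    obtain ⟨e', he', hee⟩ := hseg
    rw [hinj hee] at he'
    exact congrArg τ (he.2 ha hb he')
  intro x hx
  obtain ⟨y, rfl⟩ := hsurj x hx
  have hy := mem_image_of_mem τ (ih hx)
  rw [AffineMap.image_convexHull] at hy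
  exact convexHull_mono hext hy

/-- **Minkowski's theorem**: a compact convex set in a finite dimensional space is the convex hull
of its extreme points. -/
theorem subset_convexHull_extremePoints (d : ℕ) : ∀ (E : Type) [NormedAddCommGroup E]
    [NormedSpace ℝ E] [FiniteDimensional ℝ E], Module.finrank ℝ E = d → ∀ K : Set E, IsCompact K →
    Convex ℝ K → K ⊆ convexHull ℝ (extremePoints ℝ K) := by
  induction d using Nat.strong_induction_on with
  | _ d ih =>
  intro E _ _ _ hd K hK hc
  -- The induction hypothesis settles every compact convex set inside a hyperplane. It serves both
  -- for sets without interior and for exposed faces.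
  have hyper : ∀ K : Set E, IsCompact K → Convex ℝ K → ∀ f : E →ₗ[ℝ] ℝ, f ≠ 0 → ∀ x₀ ∈ K,
      (∀ x ∈ K, f x = f x₀) → K ⊆ convexHull ℝ (extremePoints ℝ K) := by
    intro K hK hc f hf x₀ hx₀ hfK
    refine subset_convexHull_extremePoints_of_subset_hyperplane hfK ?_
    refine ih (Module.finrank ℝ (LinearMap.ker f)) ?_ _ rfl _ ?_ ?_
    · rw [← hd]
      exact Submodule.finrank_lt (fun h => hf (LinearMap.ker_eq_top.1 h))
    · have hemb : IsClosedEmbedding (fun y : LinearMap.ker f => x₀ + (y : E)) :=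
        (Homeomorph.addLeft x₀).isClosedEmbedding.comp
          (LinearMap.ker f).closed_of_finiteDimensional.isClosedEmbedding_subtypeVal
      exact hemb.isCompact_preimage hK
    · exact hc.affine_preimage
        (AffineMap.const ℝ _ x₀ + (LinearMap.ker f).subtype.toAffineMap)
  rcases (interior K).eq_empty_or_nonempty with hemp | hne
  · intro x hx
    have hspan : affineSpan ℝ K ≠ ⊤ := fun h => by
      have := hc.interior_nonempty_iff_affineSpan_eq_top.2 h
      rw [hemp] at this
      exact not_nonempty_empty this
    have hdir : (affineSpan ℝ K).direction < ⊤ := by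
      refine lt_top_iff_ne_top.2 fun h => hspan ?_
      exact (AffineSubspace.direction_eq_top_iff_of_nonempty ⟨x, subset_affineSpan ℝ K hx⟩).1 h
    obtain ⟨f, hf, hle⟩ := Submodule.exists_le_ker_of_lt_top _ hdir
    refine hyper K hK hc f hf x hx (fun y hy => ?_) hx
    have := hle (AffineSubspace.vsub_mem_direction (subset_affineSpan ℝ K hy)
      (subset_affineSpan ℝ K hx))
    rwa [LinearMap.mem_ker, vsub_eq_sub, map_sub, sub_eq_zero] at this
  -- A boundary point lies on a supporting hyperplane, and extreme points of the exposed face are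
  -- extreme in `K`.
  have hbdry : ∀ x ∈ K, x ∉ interior K → x ∈ convexHull ℝ (extremePoints ℝ K) := by
    intro x hx hxi
    obtain ⟨f, hf⟩ := geometric_hahn_banach_open_point hc.interior isOpen_interior hxi
    have hle : ∀ y ∈ K, f y ≤ f x := by
      intro y hy
      have hy' : y ∈ closure (interior K) := by
        rw [hc.closure_interior_eq_closure_of_nonempty_interior hne]
        exact subset_closure hy
      exact closure_minimal (fun z hz => (hf z hz).le) (isClosed_le f.continuous
        continuous_const) hy'
    have hexp : IsExposed ℝ K {y ∈ K | ∀ z ∈ K, f z ≤ f y} := fun _ => ⟨f, rfl⟩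
    have hxF : x ∈ {y ∈ K | ∀ z ∈ K, f z ≤ f y} := ⟨hx, hle⟩
    refine convexHull_mono hexp.isExtreme.extremePoints_subset_extremePoints ?_
    refine hyper _ (hexp.isCompact hK) (hexp.convex hc) f.toLinearMap ?_ x hxF ?_ hxF
    · intro h0
      obtain ⟨y, hy⟩ := hne
      have h1 := hf y hy
      have h2 : ∀ z, f z = 0 := fun z => LinearMap.congr_fun h0 z
      rw [h2, h2] at h1
      exact lt_irrefl _ h1
    · exact fun y hy => le_antisymm (hle y hy.1) (hy.2 x hx)
  intro x hx
  by_cases hxi : x ∉ interior K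
  · exact hbdry x hx hxi
  rw [not_not] at hxi
  rcases subsingleton_or_nontrivial E with hsub | hnt
  · exact subset_convexHull ℝ _ ⟨hx, fun a _ b _ _ => Subsingleton.elim _ _⟩
  obtain ⟨v, hv⟩ := exists_ne (0 : E)
  -- By compactness each ray from `x` has a last point in `K`, which is not interior. An interior
  -- point thus lies between two boundary points.
  have hfar : ∀ v : E, v ≠ 0 → ∃ t : ℝ, 0 ≤ t ∧ x + t • v ∈ K ∧ x + t • v ∉ interior K := by
    intro v hv
    have hcont : Continuous fun t : ℝ => x + t • v := by fun_prop
    obtain ⟨R, hR⟩ := hK.isBounded.exists_norm_le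
    have hv0 := norm_pos_iff.2 hv
    have hcomp : IsCompact ((fun t : ℝ => x + t • v) ⁻¹' K) := by
      refine Metric.isCompact_of_isClosed_isBounded (hK.isClosed.preimage hcont) ?_
      refine isBounded_iff_forall_norm_le.2 ⟨(R + ‖x‖) / ‖v‖, fun t ht => ?_⟩
      rw [le_div_iff₀ hv0, ← norm_smul]
      have h1 := hR _ ht
      have h2 := norm_sub_le (x + t • v) x
      rw [add_sub_cancel_left] at h2
      linarith
    obtain ⟨t, ht, hmax⟩ := hcomp.exists_isMaxOn ⟨0, by simpa using hx⟩ continuousOn_id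
    refine ⟨t, by simpa using hmax (a := 0) (by simpa using hx), ht, fun hint => ?_⟩
    have hev : ∀ᶠ s in 𝓝 t, x + s • v ∈ interior K :=
      hcont.continuousAt.eventually_mem (isOpen_interior.mem_nhds hint)
    obtain ⟨s, hs, hts⟩ := ((hev.filter_mono nhdsWithin_le_nhds).and
      (self_mem_nhdsWithin : Ioi t ∈ 𝓝[>] t)).exists
    have : s ≤ t := hmax (a := s) (show x + s • v ∈ K from interior_subset hs)
    exact absurd hts (not_lt.2 this)
  obtain ⟨t, ht0, htK, hti⟩ := hfar v hv
  obtain ⟨s, hs0, hsK, hsi⟩ := hfar (-v) (neg_ne_zero.2 hv)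
  have h1 := hbdry _ htK hti
  have h2 := hbdry _ hsK hsi
  rcases (add_nonneg ht0 hs0).eq_or_lt with h0 | hpos
  · have : t = 0 := by linarith
    rw [this, zero_smul, add_zero] at h1
    exact h1
  have hmem := convex_convexHull ℝ (extremePoints ℝ K) h1 h2 (a := s / (t + s)) (b := t / (t + s))
    (by positivity) (by positivity) (by field_simp; ring)
  convert hmem using 1
  rw [smul_add, smul_add, add_add_add_comm, ← add_smul, smul_neg, smul_neg, smul_smul, smul_smul,
    show s / (t + s) + t / (t + s) = 1 by field_simp; ring,
    show s / (t + s) * t = t / (t + s) * s by ring, add_neg_cancel, add_zero, one_smul]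

/-- The unit ball of a norm on a finite dimensional space is the convex hull of its extreme
points. -/
lemma unit_ball_subset_convexHull_extremePoints {E : Type} [AddCommGroup E] [Module ℝ E]
    [FiniteDimensional ℝ E] (N : E → ℝ) (h0 : ∀ x, 0 ≤ N x)
    (hs : ∀ (c : ℝ) x, N (c • x) = |c| * N x)
    (ht : ∀ x y, N (x + y) ≤ N x + N y) (hdef : ∀ x, N x = 0 → x = 0) :
    {x | N x ≤ 1} ⊆ convexHull ℝ (extremePoints ℝ {x | N x ≤ 1}) := by
  let _ : Norm E := ⟨N⟩
  have core : NormedSpace.Core ℝ E :=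
    { norm_nonneg := h0
      norm_smul := fun c x => hs c x
      norm_triangle := ht
      norm_eq_zero_iff := fun x => ⟨hdef x, fun h => by
        have := hs 0 x
        rw [zero_smul, abs_zero, zero_mul] at this
        rw [h]; exact this⟩ }
  let _ : NormedAddCommGroup E := NormedAddCommGroup.ofCore core
  let _ : NormedSpace ℝ E := NormedSpace.ofCore core
  have hball : {x : E | N x ≤ 1} = Metric.closedBall 0 1 := by
    ext x
    rw [mem_closedBall_zero_iff]
    rfl
  have : ProperSpace E := FiniteDimensional.proper_real E
  rw [hball]
  exact subset_convexHull_extremePoints _ E rfl _ (isCompact_closedBall 0 1)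
    (convex_closedBall 0 1)

end

section

open Filter Topology

/-! ### Continuity of piecewise affine functions of finite variation -/

/-- Continuous induction on the interval: the set of `t` with `|H t - H 0| ≤ M * t` is closed and
can be continued to the right of each of its points below `1`. -/
lemma abs_sub_le_of_locally_lipschitz {H : ℝ → ℝ} {M : ℝ}
    (h : ∀ t ∈ Icc (0 : ℝ) 1, ∀ᶠ s in 𝓝[Icc 0 1] t, |H s - H t| ≤ M * |s - t|) :
    |H 1 - H 0| ≤ M := by
  have hcont : ContinuousOn H (Icc 0 1) := by
    intro t ht
    rw [ContinuousWithinAt, tendsto_iff_dist_tendsto_zero]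
    have hlim : Tendsto (fun s => M * |s - t|) (𝓝[Icc 0 1] t) (𝓝 0) := by
      have : Tendsto (fun s => M * |s - t|) (𝓝 t) (𝓝 (M * |t - t|)) :=
        (continuous_const.mul (continuous_id.sub continuous_const).abs).tendsto t
      rw [sub_self, abs_zero, mul_zero] at this
      exact this.mono_left nhdsWithin_le_nhds
    exact squeeze_zero' (.of_forall fun _ => dist_nonneg) (h t ht) hlim
  have hsub : Icc (0 : ℝ) 1 ⊆ {t | |H t - H 0| ≤ M * t} := by
    refine IsClosed.Icc_subset_of_forall_exists_gt ?_ (by simp) ?_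
    · have hc : ContinuousOn (fun t => |H t - H 0| - M * t) (Icc 0 1) :=
        ((hcont.sub continuousOn_const).abs).sub (continuousOn_const.mul continuousOn_id)
      have := hc.preimage_isClosed_of_isClosed isClosed_Icc (isClosed_Iic (a := (0 : ℝ)))
      convert this using 1
      ext t
      simp only [mem_inter_iff, mem_preimage, mem_Iic, sub_nonpos]
      exact and_comm
    · rintro t ⟨ht, ht0, ht1⟩ y hy
      have hloc := h t ⟨ht0, ht1.le⟩
      have hle : 𝓝[>] t ≤ 𝓝[Icc 0 1] t := by
        rw [← nhdsWithin_Ioo_eq_nhdsGT ht1]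
        exact nhdsWithin_mono _ fun s hs => ⟨ht0.trans hs.1.le, hs.2.le⟩
      obtain ⟨s, hs, hsy⟩ := ((hloc.filter_mono hle).and (Ioc_mem_nhdsGT hy)).exists
      refine ⟨s, ?_, hsy⟩
      have h1 : |H s - H t| ≤ M * (s - t) := by rwa [abs_of_pos (sub_pos.2 hsy.1)] at hs
      have h2 : |H t - H 0| ≤ M * t := ht
      change |H s - H 0| ≤ M * s
      calc |H s - H 0| ≤ |H s - H t| + |H t - H 0| := abs_sub_le _ _ _
        _ ≤ M * s := by linarith
  have := hsub (show (1 : ℝ) ∈ Icc 0 1 by simp)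
  simpa using this

variable {n : ℕ} {P Q R S : Set (Euc n)} {Ps : Set (Set (Euc n))} {u : Euc n → ℝ}

/-- By local finiteness the nearby pieces that miss `z` have a closed union. -/
lemma IsPolytopeDecomposition.exists_ball (h : IsPolytopeDecomposition Ps) (z : Euc n) :
    ∃ r > 0, ∀ P ∈ Ps, (P ∩ Metric.ball z r).Nonempty → z ∈ P := by
  have hfin : {P ∈ Ps | (P ∩ Metric.ball z 1).Nonempty ∧ z ∉ P}.Finite :=
    (h.locallyFinite z 1).subset fun P hP => ⟨hP.1, hP.2.1⟩
  have hcl : IsClosed (⋃₀ {P ∈ Ps | (P ∩ Metric.ball z 1).Nonempty ∧ z ∉ P}) := by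
    rw [sUnion_eq_biUnion]
    exact hfin.isClosed_biUnion fun P hP => (h.polytope P hP.1).isClosed
  have hz : z ∉ ⋃₀ {P ∈ Ps | (P ∩ Metric.ball z 1).Nonempty ∧ z ∉ P} := by
    rintro ⟨P, hP, hzP⟩
    exact hP.2.2 hzP
  obtain ⟨δ, hδ, hball⟩ := Metric.isOpen_iff.1 hcl.isOpen_compl z hz
  refine ⟨min δ 1, lt_min hδ one_pos, fun P hP ⟨y, hyP, hy⟩ => ?_⟩
  by_contra hzP
  exact hball (Metric.ball_subset_ball (min_le_left _ _) hy)
    ⟨P, ⟨hP, ⟨y, hyP, Metric.ball_subset_ball (min_le_right _ _) hy⟩, hzP⟩, hyP⟩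

/-- An affine function separating two sets with nonempty interior. -/
structure Separates (m : Euc n →ᵃ[ℝ] ℝ) (P Q : Set (Euc n)) : Prop where
  left : ∀ x ∈ P, m x ≤ 0
  right : ∀ x ∈ Q, 0 ≤ m x
  left_interior : ∀ x ∈ interior P, m x < 0
  right_interior : ∀ x ∈ interior Q, 0 < m x

lemma affine_lineMap (m : Euc n →ᵃ[ℝ] ℝ) (x y : Euc n) (t : ℝ) :
    m (x + t • (y - x)) = (1 - t) * m x + t * m y := by
  have h1 := affine_add_smul m x (y - x) t
  have h2 := affine_add_smul m x (y - x) 1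
  rw [one_smul, add_sub_cancel, one_mul] at h2
  rw [h1, h2]; ring

lemma eventually_add_smul_mem {U : Set (Euc n)} (hU : IsOpen U) {x : Euc n} (hx : x ∈ U)
    (v : Euc n) : ∀ᶠ t : ℝ in 𝓝 0, x + t • v ∈ U := by
  have hcont : Continuous fun t : ℝ => x + t • v := by fun_prop
  exact hcont.continuousAt.eventually_mem (hU.mem_nhds (by simpa using hx))

lemma IsPolytopeDecomposition.exists_separates (h : IsPolytopeDecomposition Ps) (hP : P ∈ Ps)
    (hQ : Q ∈ Ps) (hne : P ≠ Q) : ∃ m, Separates m P Q := by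
  have hPp := h.polytope P hP
  obtain ⟨f, c, hf, hg⟩ := geometric_hahn_banach_open hPp.convex.interior isOpen_interior
    (h.polytope Q hQ).convex (h.disjoint_interior hP hQ hne)
  let m : Euc n →ᵃ[ℝ] ℝ := f.toLinearMap.toAffineMap - AffineMap.const ℝ (Euc n) c
  have hm : ∀ x, m x = f x - c := fun x => rfl
  refine ⟨m, fun x hx => ?_, fun x hx => ?_, fun x hx => ?_, fun x hx => ?_⟩
  · have hx' : x ∈ closure (interior P) := by
      rw [hPp.convex.closure_interior_eq_closure_of_nonempty_interior hPp.2]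
      exact subset_closure hx
    exact closure_minimal (t := {x | m x ≤ 0}) (fun y hy => by
      rw [mem_ofPred_eq, hm]; linarith [hf y hy])
      (isClosed_le (contDiff_affine m).continuous continuous_const) hx'
  · rw [hm]; linarith [hg x hx]
  · rw [hm]; linarith [hf x hx]
  -- Hahn–Banach is strict only on the interior of `P`. For an interior point of `Q`, a small move
  -- towards `p` stays in `Q`, and `m x ≤ 0` would make `m` negative there.
  · obtain ⟨p, hp⟩ := hPp.2
    obtain ⟨t, ht, ht0⟩ := (((eventually_add_smul_mem isOpen_interior hx (p - x)).filter_mono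
      nhdsWithin_le_nhds).and (Ioc_mem_nhdsGT (zero_lt_one' ℝ))).exists
    have h1 := hg _ (interior_subset ht)
    have h2 := affine_lineMap m x p t
    have h3 := hf p hp
    rw [hm, hm, hm] at h2
    rw [hm]
    by_contra hcon
    rw [not_lt] at hcon
    have h4 : (1 - t) * (f x - c) ≤ 0 :=
      mul_nonpos_of_nonneg_of_nonpos (by linarith [ht0.2]) hcon
    have h5 : t * (f p - c) < 0 := mul_neg_of_pos_of_neg ht0.1 (by linarith)
    linarith

lemma Separates.linear_ne_zero {m : Euc n →ᵃ[ℝ] ℝ} (h : Separates m P Q)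
    (hP : (interior P).Nonempty) (hQ : (interior Q).Nonempty) : m.linear ≠ 0 := by
  obtain ⟨p, hp⟩ := hP
  obtain ⟨q, hq⟩ := hQ
  intro h0
  have h1 := affine_add_smul m p (q - p) 1
  rw [one_smul, add_sub_cancel, h0] at h1
  have h2 := h.left_interior p hp
  have h3 := h.right_interior q hq
  simp at h1
  linarith

/-- Affine pieces agree at points which belong to exactly two pieces. -/
lemma IsPolytopeDecomposition.affine_eq (h : IsPolytopeDecomposition Ps) (hS : IsOpen S)
    (hvar : variation 1 u S ≠ ⊤) (a : Set (Euc n) → Euc n →ᵃ[ℝ] ℝ)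
    (ha : ∀ P ∈ Ps, ∀ᵐ x, x ∈ P ∩ S → u x = a P x) (hP : P ∈ Ps) (hQ : Q ∈ Ps) (hne : P ≠ Q)
    {z : Euc n} (hzS : z ∈ S) (hzP : z ∈ P) (hzQ : z ∈ Q)
    (hz : ∀ R ∈ Ps, z ∈ R → R = P ∨ R = Q) : a P z = a Q z := by
  obtain ⟨m, hm⟩ := h.exists_separates hP hQ hne
  obtain ⟨r, hr, hball⟩ := h.exists_ball z
  obtain ⟨δ, hδ, hδS⟩ := Metric.isOpen_iff.1 hS z hzS
  have hcov : ∀ x ∈ Metric.ball z (min r δ), x ∈ P ∨ x ∈ Q := by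
    intro x hx
    obtain ⟨R, hR, hxR⟩ := h.exists_mem x
    rcases hz R hR (hball R hR ⟨x, hxR, Metric.ball_subset_ball (min_le_left _ _) hx⟩) with
      rfl | rfl
    · exact Or.inl hxR
    · exact Or.inr hxR
  have hsub : Metric.ball z (min r δ) ⊆ S :=
    (Metric.ball_subset_ball (min_le_right _ _)).trans hδS
  refine affine_eq_of_variation_ne_top (m := m) hS.measurableSet hvar (lt_min hr hδ) hsub
    (le_antisymm (hm.left z hzP) (hm.right z hzQ))
    (hm.linear_ne_zero (h.polytope P hP).2 (h.polytope Q hQ).2) ?_ ?_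
  · filter_upwards [ha P hP] with x hx hxb hxm
    refine hx ⟨(hcov x hxb).resolve_right fun hxQ => ?_, hsub hxb⟩
    linarith [hm.right x hxQ]
  · filter_upwards [ha Q hQ] with x hx hxb hxm
    refine hx ⟨(hcov x hxb).resolve_left fun hxP => ?_, hsub hxb⟩
    linarith [hm.left x hxP]

/-- By `hgen` no point of the segment lies in three pieces, so the value along it does not depend on
the piece chosen. Pieces met near a given point all contain that point, which gives the local
estimate with constant `L`. -/
lemma IsPolytopeDecomposition.abs_sub_le_of_segment (h : IsPolytopeDecomposition Ps)
    (hS : IsOpen S) (hSc : Convex ℝ S) (hvar : variation 1 u S ≠ ⊤)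
    (a : Set (Euc n) → Euc n →ᵃ[ℝ] ℝ)
    (ha : ∀ P ∈ Ps, ∀ᵐ x, x ∈ P ∩ S → u x = a P x) {L : ℝ}
    (hL : ∀ P ∈ Ps, (P ∩ S).Nonempty → ∀ x y, |a P x - a P y| ≤ L * ‖x - y‖)
    {x y : Euc n} (hx : x ∈ S) (hy : y ∈ S)
    (hgen : ∀ t ∈ Icc (0 : ℝ) 1, ∀ P ∈ Ps, ∀ Q ∈ Ps, ∀ R ∈ Ps, x + t • (y - x) ∈ P →
      x + t • (y - x) ∈ Q → x + t • (y - x) ∈ R → P = Q ∨ P = R ∨ Q = R)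
    (hP : P ∈ Ps) (hQ : Q ∈ Ps) (hxP : x ∈ P) (hyQ : y ∈ Q) :
    |a P x - a Q y| ≤ L * ‖x - y‖ := by
  choose pc hpc hpcm using h.exists_mem
  set γ : ℝ → Euc n := fun t => x + t • (y - x) with hγ
  have hγS : ∀ t ∈ Icc (0 : ℝ) 1, γ t ∈ S := fun t ht => hSc.add_smul_sub_mem hx hy ht
  have hcons : ∀ t ∈ Icc (0 : ℝ) 1, ∀ R ∈ Ps, γ t ∈ R → a R (γ t) = a (pc (γ t)) (γ t) := by
    intro t ht R hR hmem
    by_cases hne : R = pc (γ t)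
    · rw [← hne]
    refine h.affine_eq hS hvar a ha hR (hpc _) hne (hγS t ht) hmem (hpcm _) fun T hT hTm => ?_
    rcases hgen t ht R hR _ (hpc (γ t)) T hT hmem (hpcm _) hTm with h1 | h1 | h1
    · exact absurd h1 hne
    · exact Or.inl h1.symm
    · exact Or.inr h1.symm
  have hγsub : ∀ s t, ‖γ s - γ t‖ = |s - t| * ‖x - y‖ := by
    intro s t
    simp only [hγ, add_sub_add_left_eq_sub, ← sub_smul, norm_smul, Real.norm_eq_abs]
    rw [norm_sub_rev y x]
  have hγcont : Continuous γ := by fun_prop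
  have key := abs_sub_le_of_locally_lipschitz (H := fun t => a (pc (γ t)) (γ t))
    (M := L * ‖x - y‖) (by
      intro t ht
      obtain ⟨r, hr, hball⟩ := h.exists_ball (γ t)
      have hev : ∀ᶠ s in 𝓝 t, γ s ∈ Metric.ball (γ t) r :=
        hγcont.continuousAt.eventually_mem (Metric.ball_mem_nhds _ hr)
      filter_upwards [hev.filter_mono nhdsWithin_le_nhds, self_mem_nhdsWithin] with s hs hs01
      have hmem : γ t ∈ pc (γ s) := hball _ (hpc _) ⟨γ s, hpcm _, hs⟩
      rw [← hcons t ht _ (hpc (γ s)) hmem]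
      refine (hL _ (hpc _) ⟨γ s, hpcm _, hγS s hs01⟩ _ _).trans (le_of_eq ?_)
      rw [hγsub]; ring)
  have h0 : γ 0 = x := by simp [hγ]
  have h1 : γ 1 = y := by simp [hγ]
  have e0 := hcons 0 (by simp) P hP (by rwa [h0])
  have e1 := hcons 1 (by simp) Q hQ (by rwa [h1])
  rw [h0] at e0
  rw [h1] at e1
  simp only [h0, h1] at key
  rw [e0, e1, abs_sub_comm]
  exact key

lemma dense_affine_ne_zero {m : Euc n →ᵃ[ℝ] ℝ} {p : Euc n} (hp : m p ≠ 0) :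
    Dense {x | m x ≠ 0} := by
  intro x
  by_cases hx : m x = 0
  swap
  · exact subset_closure hx
  rw [mem_closure_iff]
  intro U hU hxU
  obtain ⟨t, ht, ht0⟩ := (((eventually_add_smul_mem hU hxU (p - x)).filter_mono
      nhdsWithin_le_nhds).and (Ioc_mem_nhdsGT (zero_lt_one' ℝ))).exists
  refine ⟨_, ht, ?_⟩
  rw [mem_ofPred_eq, affine_lineMap, hx, mul_zero, zero_add]
  exact mul_ne_zero ht0.1.ne' hp

lemma dense_forall_affine_ne_zero {ι : Type*} {I : Set ι} (hI : I.Finite)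
    (m : ι → Euc n →ᵃ[ℝ] ℝ) (hm : ∀ i ∈ I, ∃ p, m i p ≠ 0) :
    Dense {x | ∀ i ∈ I, m i x ≠ 0} := by
  have h := dense_biInter_of_isOpen (S := I) (f := fun i => {x | m i x ≠ 0})
    (fun i _ => isOpen_ne_fun (contDiff_affine _).continuous continuous_const) hI.countable
    (fun i hi => dense_affine_ne_zero (hm i hi).choose_spec)
  convert h using 1
  ext x; simp

/-- No two of the three functions separating three full dimensional sets can be all parallel. -/
lemma false_of_parallel_separates {m₁ m₂ m₃ : Euc n →ᵃ[ℝ] ℝ} (h₁ : Separates m₁ P Q)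
    (h₂ : Separates m₂ P R) (h₃ : Separates m₃ Q R) (hP : (interior P).Nonempty)
    (hQ : (interior Q).Nonempty) (hR : (interior R).Nonempty) {α β γ : ℝ} (hα : α ≠ 0)
    (e₂ : ∀ y, α * m₂ y = β * m₁ y) (e₃ : ∀ y, α * m₃ y = γ * m₁ y) : False := by
  obtain ⟨p, hp⟩ := hP
  obtain ⟨q, hq⟩ := hQ
  obtain ⟨r, hr⟩ := hR
  have e₂' : ∀ y, m₂ y = (β / α) * m₁ y := fun y => by
    rw [div_mul_eq_mul_div, ← e₂, mul_div_cancel_left₀ _ hα]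
  have e₃' : ∀ y, m₃ y = (γ / α) * m₁ y := fun y => by
    rw [div_mul_eq_mul_div, ← e₃, mul_div_cancel_left₀ _ hα]
  have a1 := h₁.left_interior p hp
  have a2 := h₂.left_interior p hp
  have b1 := h₁.right_interior q hq
  have b2 := h₃.left_interior q hq
  have c1 := h₂.right_interior r hr
  have c2 := h₃.right_interior r hr
  rw [e₂'] at a2 c1
  rw [e₃'] at b2 c2
  -- The signs on `P` make `m₂` a positive multiple of `m₁`, and those on `Q` make `m₃` a negative
  -- one. On `R` both `m₂` and `m₃` are positive, a contradiction.
  have l1 : 0 < β / α := by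
    by_contra hcon
    nlinarith [mul_nonneg_of_nonpos_of_nonpos (not_lt.1 hcon) a1.le]
  have l2 : γ / α < 0 := by
    by_contra hcon
    nlinarith [mul_nonneg (not_lt.1 hcon) b1.le]
  have l3 : 0 < m₁ r := (pos_iff_pos_of_mul_pos c1).1 l1
  linarith [mul_neg_of_neg_of_pos l2 l3]

/-- Points common to three pieces lie on two non-parallel separating hyperplanes, a set of
codimension two that generic segments avoid. Endpoints for which this holds are dense, and the
estimate is closed in both of them. -/
lemma IsPolytopeDecomposition.abs_sub_le (h : IsPolytopeDecomposition Ps)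
    (hS : IsOpen S) (hSc : Convex ℝ S) (hSf : {P ∈ Ps | (P ∩ S).Nonempty}.Finite)
    (hvar : variation 1 u S ≠ ⊤) (a : Set (Euc n) → Euc n →ᵃ[ℝ] ℝ)
    (ha : ∀ P ∈ Ps, ∀ᵐ x, x ∈ P ∩ S → u x = a P x) {L : ℝ}
    (hL : ∀ P ∈ Ps, (P ∩ S).Nonempty → ∀ x y, |a P x - a P y| ≤ L * ‖x - y‖)
    (hP : P ∈ Ps) (hQ : Q ∈ Ps) {x y : Euc n} (hx : x ∈ P ∩ S) (hy : y ∈ Q ∩ S) :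
    |a P x - a Q y| ≤ L * ‖x - y‖ := by
  have hsep : ∀ p : Set (Euc n) × Set (Euc n), ∃ m : Euc n →ᵃ[ℝ] ℝ, p.1 ∈ Ps → p.2 ∈ Ps →
      p.1 ≠ p.2 → Separates m p.1 p.2 := by
    intro p
    by_cases hp : p.1 ∈ Ps ∧ p.2 ∈ Ps ∧ p.1 ≠ p.2
    · obtain ⟨m, hm⟩ := h.exists_separates hp.1 hp.2.1 hp.2.2
      exact ⟨m, fun _ _ _ => hm⟩
    · exact ⟨0, fun h1 h2 h3 => absurd ⟨h1, h2, h3⟩ hp⟩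
  choose m hm using hsep
  set I : Set (Set (Euc n) × Set (Euc n)) :=
    {p | (p.1 ∈ Ps ∧ (p.1 ∩ S).Nonempty) ∧ (p.2 ∈ Ps ∧ (p.2 ∩ S).Nonempty) ∧ p.1 ≠ p.2} with hI
  have hIfin : I.Finite := (hSf.prod hSf).subset fun p hp => ⟨hp.1, hp.2.1⟩
  have hmI : ∀ p ∈ I, Separates (m p) p.1 p.2 := fun p hp => hm p hp.1.1 hp.2.1.1 hp.2.2
  have hD1 : Dense {x | ∀ p ∈ I, m p x ≠ 0} := by
    refine dense_forall_affine_ne_zero hIfin m fun p hp => ?_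
    obtain ⟨q, hq⟩ := (h.polytope _ hp.1.1).2
    exact ⟨q, ((hmI p hp).left_interior q hq).ne⟩
  have hclos : ∀ {R D : Set (Euc n)}, R ∈ Ps → Dense D → R ∩ S ⊆ closure (interior R ∩ S ∩ D) := by
    intro R D hR hD x hx
    have h1 : x ∈ closure (interior R) := by
      rw [(h.polytope R hR).convex.closure_interior_eq_closure_of_nonempty_interior
        (h.polytope R hR).2]
      exact subset_closure hx.1
    have h2 : x ∈ closure (interior R ∩ S) := by
      rw [inter_comm]
      exact hS.inter_closure ⟨hx.2, h1⟩
    exact closure_minimal (hD.open_subset_closure_inter (isOpen_interior.inter hS))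
      isClosed_closure h2
  have hgen : ∀ x ∈ interior P ∩ S ∩ {x | ∀ p ∈ I, m p x ≠ 0}, ∀ y ∈ Q ∩ S,
      |a P x - a Q y| ≤ L * ‖x - y‖ := by
    rintro x ⟨⟨hxP, hxS⟩, hxD⟩ y hy
    -- With `x` off all separating hyperplanes, suppose two separating functions vanish at a common
    -- point `z` of the segment. The combination `m p x • m q - m q x • m p` vanishes at `x` and at
    -- `z ≠ x`, hence at `y`. Choosing `y` off the zeros of every nontrivial such combination forces
    -- the two functions to be proportional.
    set J := {pq : (Set (Euc n) × Set (Euc n)) × (Set (Euc n) × Set (Euc n)) |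
      pq ∈ I ×ˢ I ∧ ∃ w, (m pq.1 x • m pq.2 - m pq.2 x • m pq.1) w ≠ 0} with hJ
    have hD2 : Dense {y | ∀ pq ∈ J, (m pq.1 x • m pq.2 - m pq.2 x • m pq.1) y ≠ 0} :=
      dense_forall_affine_ne_zero ((hIfin.prod hIfin).subset fun p hp => hp.1)
        (fun pq => m pq.1 x • m pq.2 - m pq.2 x • m pq.1) (fun pq hpq => hpq.2)
    have hcl : IsClosed {y | |a P x - a Q y| ≤ L * ‖x - y‖} :=
      isClosed_le (continuous_const.sub (contDiff_affine _).continuous).abs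
        (continuous_const.mul (continuous_const.sub continuous_id).norm)
    refine closure_minimal (t := {y | |a P x - a Q y| ≤ L * ‖x - y‖}) ?_ hcl (hclos hQ hD2 hy)
    rintro y ⟨⟨hyQ, hyS⟩, hyD⟩
    refine h.abs_sub_le_of_segment hS hSc hvar a ha hL hxS hyS ?_ hP hQ (interior_subset hxP)
      (interior_subset hyQ)
    intro t ht P₁ h1 P₂ h2 P₃ h3 hz1 hz2 hz3
    by_contra! hcon
    obtain ⟨h12, h13, h23⟩ := hcon
    set z := x + t • (y - x) with hz
    have hzS : z ∈ S := hSc.add_smul_sub_mem hxS hyS ht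
    have k12 : (P₁, P₂) ∈ I := ⟨⟨h1, z, hz1, hzS⟩, ⟨h2, z, hz2, hzS⟩, h12⟩
    have k13 : (P₁, P₃) ∈ I := ⟨⟨h1, z, hz1, hzS⟩, ⟨h3, z, hz3, hzS⟩, h13⟩
    have k23 : (P₂, P₃) ∈ I := ⟨⟨h2, z, hz2, hzS⟩, ⟨h3, z, hz3, hzS⟩, h23⟩
    have s12 := hmI _ k12
    have s13 := hmI _ k13
    have s23 := hmI _ k23
    have hzero : ∀ {p : Set (Euc n) × Set (Euc n)}, p ∈ I → z ∈ p.1 → z ∈ p.2 →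
        (1 - t) * m p x + t * m p y = 0 := by
      intro p hp hz1 hz2
      rw [← affine_lineMap]
      exact le_antisymm ((hmI p hp).left z hz1) ((hmI p hp).right z hz2)
    have z12 := hzero k12 hz1 hz2
    have z13 := hzero k13 hz1 hz3
    have z23 := hzero k23 hz2 hz3
    have ht0 : t ≠ 0 := by
      intro ht0
      rw [ht0, sub_zero, one_mul, zero_mul, add_zero] at z12
      exact hxD _ k12 z12
    have hpar : ∀ {p q : Set (Euc n) × Set (Euc n)}, p ∈ I → q ∈ I →
        (1 - t) * m p x + t * m p y = 0 → (1 - t) * m q x + t * m q y = 0 →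
        ∀ w, m p x * m q w = m q x * m p w := by
      intro p q hp hq zp zq
      by_contra! hw
      obtain ⟨w, hw⟩ := hw
      have hval : ∀ w, (m p x • m q - m q x • m p) w = m p x * m q w - m q x * m p w :=
        fun w => rfl
      have hy0 := hyD (p, q) ⟨⟨hp, hq⟩, w, by
        change (m p x • m q - m q x • m p) w ≠ 0
        rw [hval]; exact sub_ne_zero.2 hw⟩
      change (m p x • m q - m q x • m p) y ≠ 0 at hy0
      rw [hval] at hy0
      apply hy0
      have : t * (m p x * m q y - m q x * m p y) = 0 := by
        linear_combination m p x * zq - m q x * zp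
      exact (mul_eq_zero.1 this).resolve_left ht0
    exact false_of_parallel_separates s12 s13 s23 (h.polytope _ h1).2 (h.polytope _ h2).2
      (h.polytope _ h3).2 (hxD _ k12) (hpar k12 k13 z12 z13) (hpar k12 k23 z12 z23)
  have hcl : IsClosed {x | |a P x - a Q y| ≤ L * ‖x - y‖} :=
    isClosed_le ((contDiff_affine _).continuous.sub continuous_const).abs
      (continuous_const.mul (continuous_id.sub continuous_const).norm)
  exact closure_minimal (t := {x | |a P x - a Q y| ≤ L * ‖x - y‖})
    (fun x hx => hgen x hx y hy) hcl (hclos hP hD1 hx)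

lemma IsPolytopeDecomposition.finite_meeting (h : IsPolytopeDecomposition Ps)
    (hS : Bornology.IsBounded S) : {P ∈ Ps | (P ∩ S).Nonempty}.Finite := by
  obtain ⟨r, hr⟩ := hS.subset_ball 0
  exact (h.locallyFinite 0 r).subset fun P hP =>
    ⟨hP.1, hP.2.mono (inter_subset_inter_right _ hr)⟩

/-- A piecewise affine function with finite variation is continuous. -/
theorem exists_isCPWL_of_variation_ne_top (h : IsPolytopeDecomposition Ps) (hS : IsOpen S)
    (hSc : Convex ℝ S) (hSb : Bornology.IsBounded S) (hvar : variation 1 u S ≠ ⊤)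
    (haff : ∀ P ∈ Ps, ∃ a : Euc n →ᵃ[ℝ] ℝ, ∀ᵐ x, x ∈ P ∩ S → u x = a x) :
    ∃ f, IsCPWL S f ∧ u =ᵐ[volume.restrict S] f := by
  have hfin := h.finite_meeting hSb
  have haff' : ∀ P, ∃ a : Euc n →ᵃ[ℝ] ℝ, P ∈ Ps → ∀ᵐ x, x ∈ P ∩ S → u x = a x := by
    intro P
    by_cases hP : P ∈ Ps
    · exact (haff P hP).imp fun a ha _ => ha
    · exact ⟨0, fun h => absurd h hP⟩
  choose a ha using haff'
  choose K hK using fun P => AffineMap.lipschitzWith_of_finiteDimensional (a P)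
  obtain ⟨L, hL⟩ := (hfin.image K).bddAbove
  have hLip : ∀ P ∈ Ps, (P ∩ S).Nonempty → ∀ x y, |a P x - a P y| ≤ (L : ℝ) * ‖x - y‖ := by
    intro P hP hPS x y
    have h1 := (hK P).dist_le_mul x y
    rw [Real.dist_eq, dist_eq_norm] at h1
    refine h1.trans (mul_le_mul_of_nonneg_right ?_ (norm_nonneg _))
    exact_mod_cast hL (mem_image_of_mem K ⟨hP, hPS⟩)
  choose pc hpc hpcm using h.exists_mem
  have hle : ∀ {P Q}, P ∈ Ps → Q ∈ Ps → ∀ {x y}, x ∈ P ∩ S → y ∈ Q ∩ S →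
      |a P x - a Q y| ≤ (L : ℝ) * ‖x - y‖ := fun hP hQ _ _ hx hy =>
    h.abs_sub_le hS hSc hfin hvar a ha hLip hP hQ hx hy
  have hfa : ∀ P ∈ Ps, ∀ x ∈ P ∩ S, a (pc x) x = a P x := by
    intro P hP x hx
    have := hle (hpc x) hP ⟨hpcm x, hx.2⟩ hx
    rw [sub_self, norm_zero, mul_zero] at this
    exact sub_eq_zero.1 (abs_eq_zero.1 (le_antisymm this (abs_nonneg _)))
  refine ⟨fun x => a (pc x) x, ⟨?_, Ps, h, fun P hP => ⟨a P, fun x hx => hfa P hP x hx⟩⟩, ?_⟩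
  · refine (LipschitzOnWith.of_dist_le_mul (K := L) fun x hx y hy => ?_).continuousOn
    rw [Real.dist_eq, dist_eq_norm]
    exact hle (hpc x) (hpc y) ⟨hpcm x, hx⟩ ⟨hpcm y, hy⟩
  · rw [EventuallyEq, ae_restrict_iff' hS.measurableSet]
    have : ∀ᵐ x, ∀ P ∈ {P ∈ Ps | (P ∩ S).Nonempty}, x ∈ P ∩ S → u x = a P x :=
      (ae_ball_iff hfin.countable).2 fun P hP => ha P hP.1
    filter_upwards [this] with x hx hxS
    exact hx _ ⟨hpc x, x, hpcm x, hxS⟩ ⟨hpcm x, hxS⟩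

end

section

open Filter Topology
open scoped Manifold

variable {n : ℕ} {P Q R S U : Set (Euc n)} {Ps : Set (Set (Euc n))} {u v φ : Euc n → ℝ}
  {F G : Euc n → Fin n → Fin n → ℝ}

/-! ### The cube -/

lemma isOpen_cube (n : ℕ) : IsOpen (cube n) := by
  have : cube n = ⋂ i, {x : Euc n | x i ∈ Ioo (0 : ℝ) 1} := by ext; simp [cube]
  rw [this]
  exact isOpen_iInter_of_finite fun i => isOpen_Ioo.preimage (PiLp.continuous_apply 2 _ i)

lemma convex_cube (n : ℕ) : Convex ℝ (cube n) := by
  intro x hx y hy a b ha hb hab i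
  exact convex_Ioo (0 : ℝ) 1 (hx i) (hy i) ha hb hab

lemma isBounded_cube (n : ℕ) : Bornology.IsBounded (cube n) := by
  refine isBounded_iff_forall_norm_le.2 ⟨∑ _i : Fin n, 1, fun x hx => ?_⟩
  have h1 : x = ∑ i, EuclideanSpace.single i (x i) := by
    ext j
    simp [Finset.sum_apply, Pi.single_apply]
  rw [h1]
  refine norm_sum_le_of_le _ fun i _ => ?_
  rw [PiLp.norm_single, Real.norm_eq_abs, abs_le]
  exact ⟨by linarith [(hx i).1], (hx i).2.le⟩

lemma measurableSet_cube (n : ℕ) : MeasurableSet (cube n) := (isOpen_cube n).measurableSet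

lemma integrableOn_cube_of_continuous (hu : Continuous u) : IntegrableOn u (cube n) := by
  obtain ⟨r, hr⟩ := (isBounded_cube n).subset_closedBall 0
  exact (hu.continuousOn.integrableOn_compact (isCompact_closedBall 0 r)).mono_set hr

/-! ### The variation as a seminorm -/

lemma variation_add_le (u v : L1 n) (hu : variation 1 u (cube n) ≠ ⊤)
    (hv : variation 1 v (cube n) ≠ ⊤) : variation 1 (u + v : L1 n) (cube n) ≤
      ENNReal.ofReal ((variation 1 u (cube n)).toReal + (variation 1 v (cube n)).toReal) := by
  rw [variation_le_iff (by positivity)]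
  intro F hF
  rw [hessPairing_coe_add _ _ hF.isSmoothField]
  exact add_le_add (hessPairing_le_toReal hu hF) (hessPairing_le_toReal hv hF)

lemma variation_smul_le (c : ℝ) (u : L1 n) (hu : variation 1 u (cube n) ≠ ⊤) :
    variation 1 (c • u : L1 n) (cube n) ≤
      ENNReal.ofReal (|c| * (variation 1 u (cube n)).toReal) := by
  rw [variation_le_iff (by positivity)]
  intro F hF
  rw [hessPairing_coe_smul]
  refine (le_abs_self _).trans ?_
  rw [abs_mul]
  exact mul_le_mul_of_nonneg_left (abs_hessPairing_le_toReal hu hF) (abs_nonneg _)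

lemma toReal_variation_smul (c : ℝ) (u : L1 n) (hu : variation 1 u (cube n) ≠ ⊤) :
    (variation 1 (c • u : L1 n) (cube n)).toReal = |c| * (variation 1 u (cube n)).toReal := by
  have hle : ∀ (c : ℝ) (u : L1 n), variation 1 u (cube n) ≠ ⊤ →
      (variation 1 (c • u : L1 n) (cube n)).toReal ≤ |c| * (variation 1 u (cube n)).toReal :=
    fun c u hu => ENNReal.toReal_le_of_le_ofReal (by positivity) (variation_smul_le c u hu)
  refine le_antisymm (hle c u hu) ?_
  rcases eq_or_ne c 0 with rfl | hc
  · simp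
  · have h1 := hle c⁻¹ (c • u)
      (ne_top_of_le_ne_top ENNReal.ofReal_ne_top (variation_smul_le c u hu))
    rw [smul_smul, inv_mul_cancel₀ hc, one_smul, abs_inv] at h1
    rwa [← le_inv_mul_iff₀ (abs_pos.2 hc)]

/-- Any test function, scaled below one and placed in a single matrix entry, is a test field. -/
lemma setIntegral_eq_zero_of_hessPairing_eq_zero
    (h : ∀ F, IsTestField 1 U F → hessPairing S u F = 0) (i j : Fin n) (hφ : IsTestFun U φ) :
    ∫ x in S, u x * partialDeriv i (partialDeriv j φ) x = 0 := by
  obtain ⟨M, hM⟩ := hφ.compact.exists_bound_of_continuous hφ.smooth.continuous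
  have hM0 : 0 < |M| + 1 := by positivity
  have hs : IsTestFun U (fun x => (|M| + 1)⁻¹ * φ x) := hφ.mul_left contDiff_const
  have h1 := h _ (isTestField_singleField i j hs fun x => by
    rw [abs_mul, abs_inv, abs_of_pos hM0, inv_mul_le_iff₀ hM0, mul_one]
    exact (hM x).trans ((le_abs_self M).trans (by linarith)))
  have e : singleField i j (fun x => (|M| + 1)⁻¹ * φ x) =
      fun y k l => (|M| + 1)⁻¹ * singleField i j φ y k l := by
    funext y k l
    simp [singleField, Matrix.single_apply]
  rw [e, hessPairing_const_mul_right _ (isSmoothField_singleField i j hφ),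
    hessPairing_singleField] at h1
  exact (mul_eq_zero.1 h1).resolve_left (inv_ne_zero hM0.ne')

/-- This is the definiteness that makes the variation a norm on the quotient. -/
lemma proj_eq_zero_of_variation_eq_zero (u : L1 n) (h : variation 1 u (cube n) = 0) :
    proj n u = 0 := by
  have h0 : ∀ F, IsTestField 1 (cube n) F → hessPairing (cube n) u F = 0 := by
    intro F hF
    have := abs_hessPairing_le_toReal (by rw [h]; simp) hF
    rw [h, ENNReal.toReal_zero] at this
    exact abs_eq_zero.1 (le_antisymm this (abs_nonneg _))
  have := exists_affine_ae_of_setIntegral_eq_zero (isOpen_cube n) (convex_cube n)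
    (measurableSet_cube n) Subset.rfl (integrableOn_coeFn u)
    (fun i j φ hφ => setIntegral_eq_zero_of_hessPairing_eq_zero h0 i j hφ)
  exact (Submodule.Quotient.mk_eq_zero _).2 this

/-! ### Functions which are affine on the pieces of a decomposition -/

/-- The space of functions of finite variation which are affine on each piece. -/
noncomputable def pieceSpace (Ps : Set (Set (Euc n))) : Submodule ℝ (L1 n) where
  carrier := {u | (∀ P ∈ Ps, ∃ a : Euc n →ᵃ[ℝ] ℝ, ∀ᵐ x ∂(volume.restrict (cube n)),
    x ∈ P → u x = a x) ∧ variation 1 u (cube n) ≠ ⊤}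
  zero_mem' := by
    refine ⟨fun P _ => ⟨0, ?_⟩, ?_⟩
    · filter_upwards [Lp.coeFn_zero ℝ 1 (volume.restrict (cube n))] with x hx _
      rw [hx]; rfl
    · refine ne_top_of_le_ne_top (ENNReal.ofReal_ne_top (r := 0)) ((variation_le_iff le_rfl).2 ?_)
      intro F _
      have := hessPairing_coe_smul 0 (0 : L1 n) F
      rw [zero_smul, zero_mul] at this
      exact this.le
  add_mem' := by
    rintro u v ⟨hu, hu'⟩ ⟨hv, hv'⟩
    refine ⟨fun P hP => ?_, ne_top_of_le_ne_top ENNReal.ofReal_ne_top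
      (variation_add_le u v hu' hv')⟩
    obtain ⟨a, ha⟩ := hu P hP
    obtain ⟨b, hb⟩ := hv P hP
    refine ⟨a + b, ?_⟩
    filter_upwards [Lp.coeFn_add u v, ha, hb] with x h1 h2 h3 hx
    rw [h1, Pi.add_apply, h2 hx, h3 hx]; rfl
  smul_mem' := by
    rintro c u ⟨hu, hu'⟩
    refine ⟨fun P hP => ?_, ne_top_of_le_ne_top ENNReal.ofReal_ne_top (variation_smul_le c u hu')⟩
    obtain ⟨a, ha⟩ := hu P hP
    refine ⟨c • a, ?_⟩
    filter_upwards [Lp.coeFn_smul c u, ha] with x h1 h2 hx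
    rw [h1, Pi.smul_apply, h2 hx]; rfl

lemma ae_mem_inter_cube {p : Euc n → Prop} (hp : ∀ᵐ x ∂(volume.restrict (cube n)), x ∈ P → p x) :
    ∀ᵐ x, x ∈ P ∩ cube n → p x := by
  rw [ae_restrict_iff' (measurableSet_cube n)] at hp
  filter_upwards [hp] with x hx hxP using hx hxP.2 hxP.1

lemma exists_isCPWL_of_mem_pieceSpace (h : IsPolytopeDecomposition Ps) {u : L1 n}
    (hu : u ∈ pieceSpace Ps) : ∃ f, IsCPWL (cube n) f ∧ u =ᵐ[volume.restrict (cube n)] f :=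
  exists_isCPWL_of_variation_ne_top h (isOpen_cube n) (convex_cube n) (isBounded_cube n) hu.2
    fun P hP => (hu.1 P hP).imp fun _ ha => ae_mem_inter_cube ha

lemma integrable_indicator_affine (hP : IsOpen P) (a : Euc n →ᵃ[ℝ] ℝ) :
    Integrable (P.indicator a) (volume.restrict (cube n)) :=
  IntegrableOn.integrable <|
    (integrableOn_cube_of_continuous (contDiff_affine a).continuous).indicator hP.measurableSet

/-- The function which equals an affine function on the interior of `P`, and zero elsewhere. -/
noncomputable def affineOnInterior (P : Set (Euc n)) : (Euc n →ᵃ[ℝ] ℝ) →ₗ[ℝ] L1 n where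
  toFun a := (integrable_indicator_affine (isOpen_interior (s := P)) a).toL1
  map_add' a b := by
    rw [← Integrable.toL1_add]
    congr 1
    exact indicator_add _ _ _
  map_smul' c a := by
    rw [RingHom.id_apply, ← Integrable.toL1_smul]
    congr 1
    funext x
    by_cases hx : x ∈ interior P <;> simp [hx]

lemma coeFn_affineOnInterior (P : Set (Euc n)) (a : Euc n →ᵃ[ℝ] ℝ) :
    affineOnInterior P a =ᵐ[volume.restrict (cube n)] (interior P).indicator a :=
  Integrable.coeFn_toL1 (integrable_indicator_affine (isOpen_interior (s := P)) a)

/-- Frontiers of convex sets are null, so a member is recovered from its affine functions on the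
finitely many pieces that meet the cube. -/
lemma finiteDimensional_pieceSpace (h : IsPolytopeDecomposition Ps) :
    FiniteDimensional ℝ (pieceSpace (n := n) Ps) := by
  classical
  have hfin := h.finite_meeting (isBounded_cube n)
  set T := hfin.toFinset with hT
  let Φ : (T → (Euc n →ᵃ[ℝ] ℝ)) →ₗ[ℝ] L1 n :=
    ∑ P, affineOnInterior P.1 ∘ₗ LinearMap.proj P
  have hle : pieceSpace Ps ≤ LinearMap.range Φ := by
    rintro u ⟨hu, -⟩
    have hu' : ∀ P : T, ∃ a : Euc n →ᵃ[ℝ] ℝ, ∀ᵐ x ∂(volume.restrict (cube n)),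
        x ∈ (P : Set (Euc n)) → u x = a x := fun P => hu P.1 (hfin.mem_toFinset.1 P.2).1
    choose a ha using hu'
    refine ⟨a, ?_⟩
    have hΦ : Φ a = ∑ P, affineOnInterior P.1 (a P) := by
      simp [Φ, LinearMap.sum_apply]
    rw [hΦ]
    apply Lp.ext
    have hfr : ∀ᵐ x ∂(volume.restrict (cube n)), ∀ P : T, x ∉ frontier P.1 := by
      rw [ae_all_iff]
      intro P
      refine ae_restrict_of_ae ?_
      exact compl_mem_ae_iff.2
        ((h.polytope P.1 (hfin.mem_toFinset.1 P.2).1).convex.addHaar_frontier _)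
    filter_upwards [Lp.coeFn_finsetSum Finset.univ (fun P : T => affineOnInterior P.1 (a P)),
      ae_all_iff.2 ha, ae_all_iff.2 (fun P : T => coeFn_affineOnInterior P.1 (a P)), hfr,
      ae_restrict_mem (measurableSet_cube n)] with x h1 h2 h3 h4 hx
    obtain ⟨P, hP, hxP⟩ := h.exists_mem x
    have hPT : P ∈ T := hfin.mem_toFinset.2 ⟨hP, x, hxP, hx⟩
    have hxi : x ∈ interior P := by
      by_contra hcon
      exact h4 ⟨P, hPT⟩ ⟨subset_closure hxP, hcon⟩
    rw [h1, Finset.sum_apply, h2 ⟨P, hPT⟩ hxP, Finset.sum_eq_single ⟨P, hPT⟩, h3,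
      indicator_of_mem hxi]
    · rintro Q - hne
      rw [h3, indicator_of_notMem]
      intro hxQ
      refine Set.disjoint_left.1 (h.disjoint_interior (hfin.mem_toFinset.1 Q.2).1 hP ?_) hxQ hxP
      exact fun h => hne (Subtype.ext h)
    · simp
  exact Submodule.finiteDimensional_of_le hle

/-! ### Extremality -/

lemma exists_cutoff {K : Set (Euc n)} (hK : IsCompact K) (hU : IsOpen U) (hKU : K ⊆ U) :
    ∃ χ : Euc n → ℝ, IsTestFun U χ ∧ (∀ x ∈ K, χ x = 1) ∧ ∀ x, χ x ∈ Icc (0 : ℝ) 1 := by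
  obtain ⟨K', hK', hKK', hK'U⟩ := exists_compact_between hK hU hKU
  obtain ⟨χ, h0, h1, h01⟩ := exists_contMDiffMap_zero_one_of_isClosed (n := (⊤ : ℕ∞)) 𝓘(ℝ, Euc n)
    (isOpen_interior (s := K')).isClosed_compl hK.isClosed
    (disjoint_left.2 fun x hx hxK => hx (hKK' hxK))
  have hts : tsupport χ ⊆ K' := by
    refine closure_minimal (fun x hx => ?_) hK'.isClosed
    by_contra hxK
    exact hx (h0 fun hxi => hxK (interior_subset hxi))
  exact ⟨χ, ⟨χ.contMDiff.contDiff, hK'.of_isClosed_subset (isClosed_tsupport _) hts,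
    hts.trans hK'U⟩, fun x hx => h1 hx, h01⟩

lemma hessPairing_eq_zero_of_affine (hUS : U ⊆ S)
    {a : Euc n →ᵃ[ℝ] ℝ} (hu : ∀ᵐ x ∂(volume.restrict S), x ∈ U → u x = a x)
    (hF : IsSmoothField U F) : hessPairing S u F = 0 := by
  have h1 : hessPairing S u F = hessPairing S a F := by
    refine integral_congr_ae ?_
    filter_upwards [hu] with x hx
    by_cases hxU : x ∈ U
    · rw [hx hxU]
    · rw [hF.hessDiv_eq_zero hxU, mul_zero, mul_zero]
  rw [h1, hessPairing, setIntegral_eq_integral_of_forall_compl_eq_zero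
    (fun x hx => by rw [hF.hessDiv_eq_zero fun h => hx (hUS h), mul_zero])]
  simp only [hessDiv, Finset.mul_sum]
  have hint : ∀ i j, Integrable
      (fun x => a x * partialDeriv i (partialDeriv j (fun y => F y i j)) x) := fun i j =>
    ((((hF.isTestFun i j).partialDeriv j).partialDeriv i).affine_mul a).integrable
  rw [integral_finsetSum _ fun i _ => integrable_finsetSum _ fun j _ => hint i j]
  refine Finset.sum_eq_zero fun i _ => ?_
  rw [integral_finsetSum _ fun j _ => hint i j]
  exact Finset.sum_eq_zero fun j _ => integral_affine_mul a i j (hF.smooth i j) (hF.compact i j)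

lemma IsSmoothField.mul_left {χ : Euc n → ℝ} (hF : IsSmoothField S F) (hχ : ContDiff ℝ ∞ χ) :
    IsSmoothField S (fun x i j => χ x * F x i j) :=
  isSmoothField_of_isTestFun fun i j => (hF.isTestFun i j).mul_left hχ

lemma IsSmoothField.mul_right {χ : Euc n → ℝ} (hF : IsSmoothField S F) (hχ : IsTestFun U χ) :
    IsSmoothField U (fun x i j => χ x * F x i j) :=
  isSmoothField_of_isTestFun fun i j =>
    ⟨hχ.smooth.mul (hF.smooth i j), hχ.compact.mul_right,
      (tsupport_mul_subset_left).trans hχ.support⟩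

/-- If `u` is a proper convex combination of functions of variation at most one and has variation
one, these functions have vanishing Hessian wherever `u` has. -/
lemma hessPairing_eq_zero_of_convex_combination {u v w : L1 n} {s t : ℝ} (hs : 0 < s) (ht : 0 < t)
    (hst : s + t = 1) (huv : u = s • v + t • w) (hu : 1 ≤ variation 1 u (cube n))
    (hv : variation 1 v (cube n) ≤ 1) (hw : variation 1 w (cube n) ≤ 1) (hU : IsOpen U)
    (hUS : U ⊆ cube n) {a : Euc n →ᵃ[ℝ] ℝ}
    (ha : ∀ᵐ x ∂(volume.restrict (cube n)), x ∈ U → u x = a x) :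
    ∀ F, IsTestField 1 U F → hessPairing (cube n) v F = 0 := by
  have hle : ∀ F, IsTestField 1 U F → hessPairing (cube n) v F ≤ 0 := by
    intro F hF
    by_contra! hC
    set C := hessPairing (cube n) v F with hCdef
    have hFs := hF.isSmoothField
    set K := ⋃ i, ⋃ j, tsupport (fun x => F x i j) with hK
    have hKc : IsCompact K := isCompact_iUnion fun i => isCompact_iUnion fun j => hFs.compact i j
    have hKU : K ⊆ U := iUnion_subset fun i => iUnion_subset fun j => hFs.support i j
    obtain ⟨χ, hχ, hχ1, hχ01⟩ := exists_cutoff hKc hU hKU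
    -- The field `G` nearly attains the variation of `u`. Cutting it off near the support of `F`
    -- costs nothing for `u`, which is affine on `U`. Adding `F` in the space thus freed gives `v`
    -- at most `1 - C` on the cut field, so `u` gets at most `s (1 - C) + t = 1 - s C`. The minimum
    -- with `1` keeps `1 - δ` nonnegative, as `variation_le_iff` requires.
    set δ := min (s * C) 1 with hδ
    have hδ0 : 0 < δ := lt_min (mul_pos hs hC) one_pos
    obtain ⟨G, hG, hGδ⟩ : ∃ G, IsTestField 1 (cube n) G ∧ 1 - δ < hessPairing (cube n) u G := by
      by_contra! hcon
      have h1 : 0 ≤ 1 - δ := by linarith [min_le_right (s * C) 1]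
      have h2 := hu.trans ((variation_le_iff h1).2 hcon)
      rw [← ENNReal.ofReal_one, ENNReal.ofReal_le_ofReal_iff h1] at h2
      linarith
    have hGs := hG.isSmoothField
    have hχG := hGs.mul_right hχ
    have hG' : IsSmoothField (cube n) (fun x i j => (1 - χ x) * G x i j) :=
      hGs.mul_left (contDiff_const.sub hχ.smooth)
    have hsplit : hessPairing (cube n) u (fun x i j => (1 - χ x) * G x i j) =
        hessPairing (cube n) u G := by
      have h1 := hessPairing_add_right (integrableOn_coeFn u) hG' hχG
      rw [hessPairing_eq_zero_of_affine hUS ha hχG, add_zero] at h1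
      rw [← h1]
      congr 1
      funext x i j; ring
    have hG't : IsTestField 1 (cube n) (fun x i j => (1 - χ x) * G x i j) := by
      refine hG'.isTestField fun x => schattenNorm_top_smul_le_one (hG.norm_le x) ?_
      rw [abs_le]
      constructor <;> linarith [(hχ01 x).1, (hχ01 x).2]
    -- At each point at most one summand is nonzero, since `χ = 1` on the support of `F`. So the
    -- norm bound survives the sum.
    have hFG : IsTestField 1 (cube n) (fun x i j => F x i j + (1 - χ x) * G x i j) := by
      refine (isSmoothField_of_isTestFun fun i j =>
        ((hFs.mono hUS).isTestFun i j).add (hG'.isTestFun i j)).isTestField fun x => ?_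
      by_cases hx : x ∈ K
      · have : Matrix.of (fun i j => F x i j + (1 - χ x) * G x i j) = Matrix.of (F x) := by
          ext i j; simp [hχ1 x hx]
        rw [this]; exact hF.norm_le x
      · have h0 : ∀ i j, F x i j = 0 := fun i j =>
          image_eq_zero_of_notMem_tsupport (f := fun x => F x i j) fun h =>
            hx (mem_iUnion_of_mem i (mem_iUnion_of_mem j h))
        simp only [h0, zero_add]
        exact hG't.norm_le x
    have h1 := variation_le_one_iff.1 hv _ hFG
    rw [hessPairing_add_right (integrableOn_coeFn v) hFs hG', ← hCdef] at h1
    have h2 := variation_le_one_iff.1 hw _ hG't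
    rw [← hsplit, huv, hessPairing_coe_add _ _ hG', hessPairing_coe_smul,
      hessPairing_coe_smul] at hGδ
    have h3 : δ ≤ s * C := min_le_left _ _
    nlinarith
  intro F hF
  refine le_antisymm (hle F hF) ?_
  have := hle _ hF.neg
  rw [hessPairing_const_mul_right _ hF.isSmoothField] at this
  linarith

/-- The Hessian of `v` vanishes on the interior of each piece, which is convex, so `v` is affine
there. This transfers extremality from the finite dimensional ball to the full one. -/
lemma mem_pieceSpace_of_convex_combination (h : IsPolytopeDecomposition Ps) {u v w : L1 n}
    {s t : ℝ} (hs : 0 < s) (ht : 0 < t) (hst : s + t = 1) (huv : u = s • v + t • w)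
    (hPu : u ∈ pieceSpace Ps) (hu : 1 ≤ variation 1 u (cube n))
    (hv : variation 1 v (cube n) ≤ 1) (hw : variation 1 w (cube n) ≤ 1) : v ∈ pieceSpace Ps := by
  refine ⟨fun P hP => ?_, ne_top_of_le_ne_top ENNReal.one_ne_top hv⟩
  obtain ⟨a, ha⟩ := hPu.1 P hP
  have hPc := (h.polytope P hP).convex
  have hU : IsOpen (interior P ∩ cube n) := isOpen_interior.inter (isOpen_cube n)
  have h0 := hessPairing_eq_zero_of_convex_combination hs ht hst huv hu hv hw hU
    inter_subset_right (a := a) (by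
      filter_upwards [ha] with x hx hxU using hx (interior_subset hxU.1))
  obtain ⟨b, hb⟩ := exists_affine_ae_of_setIntegral_eq_zero hU (hPc.interior.inter (convex_cube n))
    (measurableSet_cube n) inter_subset_right (integrableOn_coeFn v)
    (fun i j φ hφ => setIntegral_eq_zero_of_hessPairing_eq_zero h0 i j hφ)
  refine ⟨b, ?_⟩
  rw [EventuallyEq, ae_restrict_iff' hU.measurableSet] at hb
  rw [ae_restrict_iff' (measurableSet_cube n)]
  filter_upwards [hb, compl_mem_ae_iff.2 (hPc.addHaar_frontier volume)] with x hx hfr hxc hxP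
  refine hx ⟨?_, hxc⟩
  by_contra hcon
  exact hfr ⟨subset_closure hxP, hcon⟩

lemma mem_openSegment_add_smul {E : Type*} [AddCommGroup E] [Module ℝ E] (e w : E) (δ : ℝ) :
    e ∈ openSegment ℝ (e + δ • w) (e + (-δ) • w) := by
  refine ⟨1 / 2, 1 / 2, by norm_num, by norm_num, by norm_num, ?_⟩
  module

lemma quotVariation_ne_top {w : L1ModAffine n} (hw : w ∈ (pieceSpace Ps).map (proj n)) :
    quotVariation 1 w ≠ ⊤ := by
  obtain ⟨u, hu, rfl⟩ := hw
  exact hu.2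

/-- Elements of the unit ball which are affine on the pieces of a fixed decomposition are convex
combinations of extreme points of the unit ball. -/
theorem mem_convexHull_cpwlExtreme (h : IsPolytopeDecomposition Ps)
    (hne : ∃ u ∈ pieceSpace Ps, proj n u ≠ 0) {u : L1 n} (hu : u ∈ pieceSpace Ps)
    (hu1 : proj n u ∈ unitBall n) : proj n u ∈ convexHull ℝ (cpwlExtreme n) := by
  have := finiteDimensional_pieceSpace h
  let W := (pieceSpace Ps).map (proj n)
  let N : W → ℝ := fun w => (quotVariation 1 (w : L1ModAffine n)).toReal
  have hN1 : ∀ w : W, N w ≤ 1 ↔ (w : L1ModAffine n) ∈ unitBall n := fun w => by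
    rw [← ENNReal.le_ofReal_iff_toReal_le (quotVariation_ne_top w.2) zero_le_one,
      ENNReal.ofReal_one]
    rfl
  have hN0 : ∀ w, 0 ≤ N w := fun w => ENNReal.toReal_nonneg
  have hNs : ∀ (c : ℝ) w, N (c • w) = |c| * N w := by
    rintro c ⟨_, u, hu, rfl⟩
    change (quotVariation 1 (c • proj n u)).toReal = |c| * (quotVariation 1 (proj n u)).toReal
    rw [← map_smul]
    exact toReal_variation_smul c u hu.2
  have hNt : ∀ v w, N (v + w) ≤ N v + N w := by
    rintro ⟨_, u, hu, rfl⟩ ⟨_, v, hv, rfl⟩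
    change (quotVariation 1 (proj n u + proj n v)).toReal ≤
      (quotVariation 1 (proj n u)).toReal + (quotVariation 1 (proj n v)).toReal
    rw [← map_add]
    exact ENNReal.toReal_le_of_le_ofReal (by positivity) (variation_add_le u v hu.2 hv.2)
  have hNd : ∀ w, N w = 0 → w = 0 := by
    rintro ⟨_, u, hu, rfl⟩ h0
    refine Subtype.ext (proj_eq_zero_of_variation_eq_zero u ?_)
    exact ((ENNReal.toReal_eq_zero_iff _).1 h0).resolve_right hu.2
  have hext : ∀ e ∈ extremePoints ℝ {w | N w ≤ 1}, (e : L1ModAffine n) ∈ cpwlExtreme n := by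
    intro e he
    -- An extreme point of norm below one could be moved both ways along any nonzero vector. This is
    -- where `W ≠ 0` matters, as in the zero space the origin is extreme.
    have he1 : 1 ≤ N e := by
      by_contra! hlt
      obtain ⟨v, hv, hv0⟩ := hne
      let w : W := ⟨proj n v, v, hv, rfl⟩
      have hw0 : w ≠ 0 := fun h0 => hv0 (congrArg Subtype.val h0)
      have hNw : 0 < N w := (hN0 w).lt_of_ne' fun h0 => hw0 (hNd w h0)
      set δ := (1 - N e) / N w with hδ
      have hδ0 : 0 < δ := div_pos (by linarith) hNw
      have hmem : ∀ c : ℝ, |c| = δ → N (e + c • w) ≤ 1 := by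
        intro c hc
        refine (hNt _ _).trans ?_
        rw [hNs, hc, hδ, div_mul_cancel₀ _ hNw.ne']
        linarith
      have hseg : e ∈ openSegment ℝ (e + δ • w) (e + (-δ) • w) :=
        mem_openSegment_add_smul e w δ
      have h1 := he.2 (hmem δ (abs_of_pos hδ0)) (hmem (-δ) (by rw [abs_neg, abs_of_pos hδ0])) hseg
      have h2 : δ • w = 0 := by simpa using h1
      exact hw0 ((smul_eq_zero.1 h2).resolve_left hδ0.ne')
    obtain ⟨⟨_, u, hu, rfl⟩, rfl⟩ : ∃ e', e' = e := ⟨e, rfl⟩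
    obtain ⟨f, hf, huf⟩ := exists_isCPWL_of_mem_pieceSpace h hu
    have hu1 : 1 ≤ variation 1 u (cube n) := by
      have h1 : 1 ≤ (variation 1 u (cube n)).toReal := he1
      rwa [← ENNReal.toReal_one, ENNReal.toReal_le_toReal ENNReal.one_ne_top hu.2] at h1
    refine ⟨⟨u, ⟨f, hf, huf⟩, rfl⟩, (hN1 _).1 he.1, ?_⟩
    rintro g₁ hg₁ g₂ hg₂ ⟨s, t, hs, ht, hst, hsum⟩
    obtain ⟨v, rfl⟩ : ∃ v, proj n v = g₁ := (affineSubspace n).mkQ_surjective g₁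
    -- The representative of `g₂` is chosen so that the convex combination holds in `L¹` itself and
    -- not only modulo affine functions.
    obtain ⟨w, rfl, hw⟩ : ∃ w, proj n w = g₂ ∧ u = s • v + t • w := by
      refine ⟨t⁻¹ • (u - s • v), ?_, ?_⟩
      · rw [map_smul, map_sub, map_smul, ← (show s • proj n v + t • g₂ = proj n u from hsum),
          add_sub_cancel_left, smul_smul, inv_mul_cancel₀ ht.ne', one_smul]
      · rw [smul_smul, mul_inv_cancel₀ ht.ne', one_smul, add_sub_cancel]
    have hvP := mem_pieceSpace_of_convex_combination h hs ht hst hw hu hu1 hg₁ hg₂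
    have hwP := mem_pieceSpace_of_convex_combination h ht hs (by rw [add_comm, hst])
      (by rw [hw, add_comm]) hu hu1 hg₂ hg₁
    have key := he.2 (x₁ := (⟨proj n v, v, hvP, rfl⟩ : W)) ((hN1 _).2 hg₁)
      (x₂ := (⟨proj n w, w, hwP, rfl⟩ : W)) ((hN1 _).2 hg₂)
      ⟨s, t, hs, ht, hst, Subtype.ext hsum⟩
    exact congrArg Subtype.val key
  have hmem := unit_ball_subset_convexHull_extremePoints N hN0 hNs hNt hNd
    (show (⟨proj n u, u, hu, rfl⟩ : W) ∈ {w | N w ≤ 1} from (hN1 _).2 hu1)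
  have himg := mem_image_of_mem W.subtype hmem
  rw [LinearMap.image_convexHull] at himg
  refine convexHull_mono ?_ himg
  rintro _ ⟨e, he, rfl⟩
  exact hext e he

end

section

open Filter Topology

variable {n : ℕ} {P Q R S U : Set (Euc n)} {Ps : Set (Set (Euc n))} {u v φ : Euc n → ℝ}
  {F G : Euc n → Fin n → Fin n → ℝ}

/-! ### The cubical grid -/

/-- The closed cube of side `1/2` with corner `k/2`. -/
def gridCube (k : Fin n → ℤ) : Set (Euc n) :=
  {x | ∀ i, x i ∈ Icc ((k i : ℝ) / 2) (((k i : ℝ) + 1) / 2)}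

lemma gridCube_eq_convexHull (k : Fin n → ℤ) :
    gridCube k = convexHull ℝ ((WithLp.linearEquiv 2 ℝ (Fin n → ℝ)).symm ''
      Set.univ.pi fun i => {(k i : ℝ) / 2, ((k i : ℝ) + 1) / 2}) := by
  have h1 := ((WithLp.linearEquiv 2 ℝ (Fin n → ℝ)).symm.toLinearMap).image_convexHull
    (Set.univ.pi fun i => {(k i : ℝ) / 2, ((k i : ℝ) + 1) / 2})
  rw [LinearEquiv.coe_coe] at h1
  rw [← h1, convexHull_pi]
  have h2 : ∀ i, convexHull ℝ {(k i : ℝ) / 2, ((k i : ℝ) + 1) / 2} =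
      Icc ((k i : ℝ) / 2) (((k i : ℝ) + 1) / 2) := fun i => by
    rw [convexHull_pair, segment_eq_Icc (by linarith)]
  simp only [h2]
  ext x
  constructor
  · intro hx
    exact ⟨WithLp.linearEquiv 2 ℝ (Fin n → ℝ) x, fun i _ => hx i, by simp⟩
  · rintro ⟨y, hy, rfl⟩ i
    exact hy i trivial

lemma isOpen_setOf_forall_mem_Ioo (a b : Fin n → ℝ) :
    IsOpen {x : Euc n | ∀ i, x i ∈ Ioo (a i) (b i)} := by
  have : {x : Euc n | ∀ i, x i ∈ Ioo (a i) (b i)} = ⋂ i, {x : Euc n | x i ∈ Ioo (a i) (b i)} := by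
    ext; simp
  rw [this]
  exact isOpen_iInter_of_finite fun i => isOpen_Ioo.preimage (PiLp.continuous_apply 2 _ i)

lemma interior_gridCube_subset (k : Fin n → ℤ) {x : Euc n} (hx : x ∈ interior (gridCube k))
    (i : Fin n) : x i ∈ Ioo ((k i : ℝ) / 2) (((k i : ℝ) + 1) / 2) := by
  have h1 := (eventually_add_smul_mem isOpen_interior hx (EuclideanSpace.single i 1)).filter_mono
    (nhdsWithin_le_nhds (s := Ioi 0))
  have h2 := (eventually_add_smul_mem isOpen_interior hx (-EuclideanSpace.single i 1)).filter_mono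
    (nhdsWithin_le_nhds (s := Ioi 0))
  obtain ⟨t, ⟨ht1, ht2⟩, ht0⟩ := ((h1.and h2).and (Ioc_mem_nhdsGT (zero_lt_one' ℝ))).exists
  have e1 := (interior_subset ht1 i).2
  have e2 := (interior_subset ht2 i).1
  simp at e1 e2
  exact ⟨by linarith [ht0.1], by linarith [ht0.1]⟩

/-- The decomposition of the space in cubes of side `1/2`. -/
def gridDecomposition (n : ℕ) : Set (Set (Euc n)) := range (gridCube (n := n))

lemma gridCube_interior_nonempty (k : Fin n → ℤ) : (interior (gridCube k)).Nonempty := by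
  have hsub : {x : Euc n | ∀ i, x i ∈ Ioo ((k i : ℝ) / 2) (((k i : ℝ) + 1) / 2)} ⊆ gridCube k :=
    fun x hx i => Ioo_subset_Icc_self (hx i)
  refine ⟨WithLp.toLp 2 fun i => (k i : ℝ) / 2 + 1 / 4,
    interior_maximal hsub (isOpen_setOf_forall_mem_Ioo _ _) fun i => ⟨?_, ?_⟩⟩ <;>
  · simp only
    linarith

lemma gridCube_mem_frontier {k l : Fin n → ℤ} (hkl : gridCube k ≠ gridCube l) {x : Euc n}
    (hk : x ∈ gridCube k) (hl : x ∈ gridCube l) : x ∈ frontier (gridCube k) := by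
  refine ⟨subset_closure hk, fun hint => hkl ?_⟩
  have : k = l := by
    funext i
    have h1 := interior_gridCube_subset k hint i
    have h2 := hl i
    have h3 : (k i : ℝ) < l i + 1 := by linarith [h1.1, h2.2]
    have h4 : (l i : ℝ) < k i + 1 := by linarith [h1.2, h2.1]
    have h5 : k i < l i + 1 := by exact_mod_cast h3
    have h6 : l i < k i + 1 := by exact_mod_cast h4
    omega
  rw [this]

/-- Side `1/2` makes each hyperplane `xᵢ = 1/2` a union of faces, so `|xᵢ - 1/2|` is affine on every
cube. -/
lemma isPolytopeDecomposition_grid (n : ℕ) : IsPolytopeDecomposition (gridDecomposition n) where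
  polytope := by
    rintro _ ⟨k, rfl⟩
    refine ⟨⟨_, ?_, gridCube_eq_convexHull k⟩, gridCube_interior_nonempty k⟩
    exact (Set.Finite.pi fun i => Set.toFinite _).image _
  cover := by
    refine eq_univ_of_forall fun x => ⟨_, ⟨fun i => ⌊2 * x i⌋, rfl⟩, fun i => ⟨?_, ?_⟩⟩
    · linarith [Int.floor_le (2 * x i)]
    · linarith [Int.lt_floor_add_one (2 * x i)]
  boundary := by
    rintro _ ⟨k, rfl⟩ _ ⟨l, rfl⟩ hkl x ⟨hk, hl⟩
    exact ⟨gridCube_mem_frontier hkl hk hl, gridCube_mem_frontier hkl.symm hl hk⟩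
  locallyFinite := by
    intro x r
    have hfin : (Set.univ.pi fun i => Icc ⌊2 * (x i - r) - 1⌋ ⌈2 * (x i + r)⌉).Finite :=
      Set.Finite.pi fun i => Set.finite_Icc _ _
    refine (hfin.image gridCube).subset ?_
    rintro _ ⟨⟨k, rfl⟩, y, hy, hyr⟩
    refine ⟨k, fun i _ => ?_, rfl⟩
    have h1 : |y i - x i| < r := by
      rw [Metric.mem_ball, dist_eq_norm] at hyr
      exact (PiLp.norm_apply_le (y - x) i).trans_lt hyr
    rw [abs_lt] at h1
    have h2 := hy i
    constructor
    · have : (⌊2 * (x i - r) - 1⌋ : ℝ) ≤ k i := by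
        linarith [Int.floor_le (2 * (x i - r) - 1), h2.2]
      exact_mod_cast this
    · have : (k i : ℝ) ≤ ⌈2 * (x i + r)⌉ := by
        linarith [Int.le_ceil (2 * (x i + r)), h2.1]
      exact_mod_cast this

/-! ### Ridge functions of finite variation -/

lemma integral_mul_partialDeriv (i : Fin n) (hu : ContDiff ℝ ∞ u) (hφ : IsTestFun univ φ) :
    ∫ x, u x * partialDeriv i φ x = -∫ x, partialDeriv i u x * φ x :=
  integral_mul_fderiv_eq_neg_fderiv_mul_of_integrable (μ := (volume : Measure (Euc n)))
    (f := u) (g := φ) (v := EuclideanSpace.single i 1)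
    (hφ.mul_left (contDiff_partialDeriv i hu)).integrable
    ((hφ.partialDeriv i).mul_left hu).integrable (hφ.mul_left hu).integrable
    (fun x _ => hu.differentiable (by simp) x) (fun x _ => hφ.smooth.differentiable (by simp) x)

lemma integral_mul_partialDeriv_partialDeriv (i j : Fin n) (hu : ContDiff ℝ ∞ u)
    (hφ : IsTestFun univ φ) : ∫ x, u x * partialDeriv i (partialDeriv j φ) x =
      ∫ x, partialDeriv j (partialDeriv i u) x * φ x := by
  rw [integral_mul_partialDeriv i hu (hφ.partialDeriv j),
    integral_mul_partialDeriv j (contDiff_partialDeriv i hu) hφ, neg_neg]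

variable {h : ℝ → ℝ}

lemma contDiff_ridge (i : Fin n) (hh : ContDiff ℝ ∞ h) :
    ContDiff ℝ ∞ (fun x : Euc n => h (x i)) :=
  hh.comp (EuclideanSpace.proj (𝕜 := ℝ) i).contDiff

lemma partialDeriv_ridge (i j : Fin n) (hh : Differentiable ℝ h) :
    partialDeriv j (fun x : Euc n => h (x i)) =
      fun x => (if j = i then 1 else 0) * deriv h (x i) := by
  funext x
  have h1 : HasFDerivAt (fun x : Euc n => h (x i))
      (deriv h (x i) • (EuclideanSpace.proj (𝕜 := ℝ) i : Euc n →L[ℝ] ℝ)) x :=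
    (hh (x i)).hasDerivAt.comp_hasFDerivAt x (EuclideanSpace.proj (𝕜 := ℝ) i).hasFDerivAt
  rw [HTV.partialDeriv, h1.fderiv]
  simp [eq_comm, mul_comm]

lemma contDiff_deriv (hh : ContDiff ℝ ∞ h) : ContDiff ℝ ∞ (deriv h) :=
  (contDiff_infty_iff_deriv.1 hh).2

lemma partialDeriv_partialDeriv_ridge (i j l : Fin n) (hh : ContDiff ℝ ∞ h) (x : Euc n) :
    partialDeriv l (partialDeriv j (fun x : Euc n => h (x i))) x =
      if j = i ∧ l = i then deriv (deriv h) (x i) else 0 := by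
  have h1 := contDiff_deriv hh
  rw [partialDeriv_ridge i j (hh.differentiable (by simp)),
    partialDeriv_const_mul l _ (contDiff_ridge i h1),
    partialDeriv_ridge i l (h1.differentiable (by simp))]
  by_cases hj : j = i <;> by_cases hl : l = i <;> simp [hj, hl]

/-- The Hessian of a ridge function has the second derivative of `h` as its only nonzero entry, at
`(i, i)`. -/
lemma hessPairing_ridge (i : Fin n) (hh : ContDiff ℝ ∞ h) (hF : IsSmoothField S F) :
    hessPairing S (fun x => h (x i)) F = ∫ x, deriv (deriv h) (x i) * F x i i := by
  have hg := contDiff_ridge (n := n) i hh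
  rw [hessPairing, setIntegral_eq_integral_of_forall_compl_eq_zero
    (fun x hx => by rw [hF.hessDiv_eq_zero hx, mul_zero])]
  simp only [hessDiv, Finset.mul_sum]
  have hint : ∀ k l, Integrable
      (fun x => h (x i) * partialDeriv k (partialDeriv l (fun y => F y k l)) x) := fun k l =>
    ((((hF.isTestFun k l).partialDeriv l).partialDeriv k).mul_left hg).integrable
  rw [integral_finsetSum _ fun k _ => integrable_finsetSum _ fun l _ => hint k l]
  have hval : ∀ k l, ∫ x, h (x i) * partialDeriv k (partialDeriv l (fun y => F y k l)) x =
      ∫ x, (if k = i ∧ l = i then deriv (deriv h) (x i) else 0) * F x k l := by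
    intro k l
    rw [integral_mul_partialDeriv_partialDeriv k l hg ((hF.isTestFun k l).mono (subset_univ _))]
    simp only [partialDeriv_partialDeriv_ridge i k l hh]
  simp only [integral_finsetSum _ fun l _ => hint _ l, hval]
  rw [Finset.sum_eq_single i, Finset.sum_eq_single i]
  · simp
  · intro l _ hl; simp [hl]
  · simp
  · intro k _ hk; simp [hk]
  · simp

/-- The smooth approximations of `s ↦ |s - 1/2|`. -/
noncomputable def smoothAbs (ε s : ℝ) : ℝ := √((s - 1 / 2) ^ 2 + ε ^ 2)

lemma sq_sub_half_add_sq_pos {ε : ℝ} (hε : 0 < ε) (s : ℝ) : 0 < (s - 1 / 2) ^ 2 + ε ^ 2 := by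
  positivity

lemma contDiff_smoothAbs {ε : ℝ} (hε : 0 < ε) : ContDiff ℝ ∞ (smoothAbs ε) :=
  (((contDiff_id.sub contDiff_const).pow 2).add contDiff_const).sqrt
    fun s => (sq_sub_half_add_sq_pos hε s).ne'

lemma deriv_smoothAbs {ε : ℝ} (hε : 0 < ε) :
    deriv (smoothAbs ε) = fun s => (s - 1 / 2) / smoothAbs ε s := by
  funext s
  have h1 : HasDerivAt (fun s : ℝ => (s - 1 / 2) ^ 2 + ε ^ 2) (2 * (s - 1 / 2)) s := by
    have := (((hasDerivAt_id' s).sub_const (1 / 2)).fun_pow 2).add_const (ε ^ 2)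
    rwa [Nat.cast_ofNat, Nat.add_one_sub_one, pow_one, mul_one] at this
  have h2 := h1.sqrt (sq_sub_half_add_sq_pos hε s).ne'
  rw [mul_div_mul_left _ _ two_ne_zero] at h2
  exact h2.deriv

lemma deriv_deriv_smoothAbs_nonneg {ε : ℝ} (hε : 0 < ε) (s : ℝ) :
    0 ≤ deriv (deriv (smoothAbs ε)) s := by
  have hpos : 0 < smoothAbs ε s := Real.sqrt_pos.2 (sq_sub_half_add_sq_pos hε s)
  have h1 : HasDerivAt (smoothAbs ε) ((s - 1 / 2) / smoothAbs ε s) s := by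
    have := ((contDiff_smoothAbs hε).differentiable (by simp) s).hasDerivAt
    rwa [deriv_smoothAbs hε] at this
  have h2 := ((hasDerivAt_id' s).sub_const (1 / 2)).fun_div h1 hpos.ne'
  rw [deriv_smoothAbs hε, h2.deriv]
  refine div_nonneg ?_ (sq_nonneg _)
  have h3 : smoothAbs ε s * smoothAbs ε s = (s - 1 / 2) ^ 2 + ε ^ 2 :=
    Real.mul_self_sqrt (sq_sub_half_add_sq_pos hε s).le
  rw [one_mul, sub_nonneg, ← mul_div_assoc, div_le_iff₀ hpos, h3]
  nlinarith [sq_nonneg ε]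

lemma abs_smoothAbs_sub_le {ε : ℝ} (hε : 0 < ε) (s : ℝ) :
    abs (smoothAbs ε s - |s - 1 / 2|) ≤ ε := by
  have h1 : |s - 1 / 2| ≤ smoothAbs ε s := by
    rw [← Real.sqrt_sq_eq_abs]
    exact Real.sqrt_le_sqrt (by nlinarith [sq_nonneg ε])
  have h2 : smoothAbs ε s ≤ |s - 1 / 2| + ε := by
    refine Real.sqrt_le_iff.2 ⟨by positivity, ?_⟩
    nlinarith [sq_abs (s - 1 / 2), mul_nonneg (abs_nonneg (s - 1 / 2)) hε.le]
  rw [abs_of_nonneg (by linarith)]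
  linarith

lemma continuous_abs_coord (i : Fin n) : Continuous fun x : Euc n => |x i - 1 / 2| :=
  ((PiLp.continuous_apply 2 _ i).sub continuous_const).abs

/-- Convexity gives the bound. The smooth approximations have nonnegative second derivative, so `F x
i i ≤ 1` may be replaced by a cutoff `χ` equal to one on the cube. Moving both derivatives onto `χ`
yields a constant independent of `F` and `ε`, and uniform convergence lets `ε` tend to zero. -/
lemma variation_abs_coord_ne_top (i : Fin n) :
    variation 1 (fun x : Euc n => |x i - 1 / 2|) (cube n) ≠ ⊤ := by
  obtain ⟨χ, hχ, hχ1, hχ01⟩ := exists_cutoff (isBounded_cube n).isCompact_closure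
    isOpen_univ (subset_univ _)
  have hχ2 := (hχ.partialDeriv i).partialDeriv i
  set C := ∫ x, (|x i - 1 / 2| + 1) * |partialDeriv i (partialDeriv i χ) x| with hC
  have hC0 : 0 ≤ C := integral_nonneg fun x => by positivity
  refine ne_top_of_le_ne_top ENNReal.ofReal_ne_top ((variation_le_iff hC0).2 fun F hF => ?_)
  have hFs := hF.isSmoothField
  set D := ∫ x, |hessDiv F x| with hD
  have hcs : HasCompactSupport (hessDiv F) := by
    refine HasCompactSupport.of_support_subset_isCompact (isBounded_cube n).isCompact_closure ?_
    intro x hx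
    by_contra hcon
    exact hx (hFs.hessDiv_eq_zero fun h => hcon (subset_closure h))
  have hDi : Integrable (fun x => |hessDiv F x|) :=
    (hFs.continuous_hessDiv.integrable_of_hasCompactSupport hcs).abs
  have key : ∀ ε : ℝ, 0 < ε → ε ≤ 1 →
      hessPairing (cube n) (fun x => |x i - 1 / 2|) F ≤ C + ε * D := by
    intro ε hε hε1
    have hsm := contDiff_smoothAbs hε
    have hridge := contDiff_ridge (n := n) i hsm
    have hdd := contDiff_ridge (n := n) i (contDiff_deriv (contDiff_deriv hsm))
    have h1 : hessPairing (cube n) (fun x => smoothAbs ε (x i)) F ≤ C := by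
      rw [hessPairing_ridge i hsm hFs]
      calc ∫ x, deriv (deriv (smoothAbs ε)) (x i) * F x i i
          ≤ ∫ x, deriv (deriv (smoothAbs ε)) (x i) * χ x := by
            refine integral_mono ((hFs.isTestFun i i).mul_left hdd).integrable
              (hχ.mul_left hdd).integrable fun x => ?_
            refine mul_le_mul_of_nonneg_left ?_ (deriv_deriv_smoothAbs_nonneg hε _)
            by_cases hx : x ∈ cube n
            · rw [hχ1 x (subset_closure hx)]
              exact (le_abs_self _).trans (abs_entry_le_one_of_schattenNorm_top (hF.norm_le x) i i)
            · rw [show F x i i = 0 from image_eq_zero_of_notMem_tsupport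
                (f := fun x => F x i i) fun h => hx (hFs.support i i h)]
              exact (hχ01 x).1
        _ = ∫ x, smoothAbs ε (x i) * partialDeriv i (partialDeriv i χ) x := by
            rw [integral_mul_partialDeriv_partialDeriv i i hridge hχ]
            simp only [partialDeriv_partialDeriv_ridge i i i hsm]
            simp
        _ ≤ C := by
            refine integral_mono (hχ2.mul_left hridge).integrable ?_ fun x => ?_
            · refine Continuous.integrable_of_hasCompactSupport ?_ ?_
              · exact ((continuous_abs_coord i).add continuous_const).mul hχ2.smooth.continuous.abs
              · exact (hχ2.compact.comp_left (g := fun t : ℝ => |t|) abs_zero).mul_left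
            · have h2 := abs_smoothAbs_sub_le hε (x i)
              have h3 := (abs_le.1 h2).2
              have h0 : 0 ≤ smoothAbs ε (x i) := Real.sqrt_nonneg _
              refine (le_abs_self _).trans ?_
              rw [abs_mul, abs_of_nonneg h0]
              exact mul_le_mul_of_nonneg_right (by linarith) (abs_nonneg _)
    have i1 := hFs.integrableOn_mul (integrableOn_cube_of_continuous (continuous_abs_coord i))
    have i2 := hFs.integrableOn_mul (integrableOn_cube_of_continuous hridge.continuous)
    have h2 : hessPairing (cube n) (fun x => |x i - 1 / 2|) F -
        hessPairing (cube n) (fun x => smoothAbs ε (x i)) F ≤ ε * D := by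
      rw [hessPairing, hessPairing, ← integral_sub i1 i2, hD, ← integral_const_mul]
      refine (integral_mono (i1.sub i2) (hDi.const_mul ε).integrableOn fun x => ?_).trans
        (setIntegral_le_integral (hDi.const_mul ε) (.of_forall fun x => by positivity))
      simp only [Pi.sub_apply]
      rw [← sub_mul]
      refine (le_abs_self _).trans ?_
      rw [abs_mul, abs_sub_comm]
      exact mul_le_mul_of_nonneg_right (abs_smoothAbs_sub_le hε _) (abs_nonneg _)
    linarith
  have hlim : Tendsto (fun ε : ℝ => C + ε * D) (𝓝[>] 0) (𝓝 C) := by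
    have : Tendsto (fun ε : ℝ => C + ε * D) (𝓝 0) (𝓝 (C + 0 * D)) :=
      (continuous_const.add (continuous_id.mul continuous_const)).tendsto 0
    rw [zero_mul, add_zero] at this
    exact this.mono_left nhdsWithin_le_nhds
  refine ge_of_tendsto hlim ?_
  filter_upwards [Ioc_mem_nhdsGT (zero_lt_one' ℝ)] with ε hε using key ε hε.1 hε.2

lemma variation_congr_ae (h : u =ᵐ[volume.restrict S] v) : variation 1 u S = variation 1 v S := by
  unfold variation
  refine iSup_congr fun F => iSup_congr fun _ => ?_
  congr 1
  refine integral_congr_ae ?_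
  filter_upwards [h] with x hx
  rw [hx]

/-- In positive dimension, there is a nontrivial piecewise affine function. -/
lemma exists_mem_pieceSpace_grid (i : Fin n) :
    ∃ u ∈ pieceSpace (gridDecomposition n), proj n u ≠ 0 := by
  have hint : Integrable (fun x : Euc n => |x i - 1 / 2|) (volume.restrict (cube n)) :=
    integrableOn_cube_of_continuous (continuous_abs_coord i)
  have hcoe := hint.coeFn_toL1
  refine ⟨hint.toL1, ⟨?_, ?_⟩, fun h0 => ?_⟩
  · rintro _ ⟨k, rfl⟩
    let c : Euc n →ᵃ[ℝ] ℝ := (EuclideanSpace.proj (𝕜 := ℝ) i).toLinearMap.toAffineMap -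
      AffineMap.const ℝ (Euc n) (1 / 2)
    have hc : ∀ x, c x = x i - 1 / 2 := fun x => rfl
    rcases le_or_gt 1 (k i) with hk | hk
    · refine ⟨c, ?_⟩
      filter_upwards [hcoe] with x hx hxk
      have h1 : (1 : ℝ) ≤ k i := by exact_mod_cast hk
      rw [hx, hc, abs_of_nonneg]
      linarith [(hxk i).1]
    · refine ⟨-c, ?_⟩
      filter_upwards [hcoe] with x hx hxk
      have h1 : (k i : ℝ) ≤ 0 := by exact_mod_cast Int.lt_add_one_iff.1 hk
      rw [hx, AffineMap.coe_neg, Pi.neg_apply, hc, abs_of_nonpos]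
      linarith [(hxk i).2]
  · rw [variation_congr_ae hcoe]
    exact variation_abs_coord_ne_top i
  · obtain ⟨a, ha⟩ := (Submodule.Quotient.mk_eq_zero _).1 h0
    have heq : EqOn (fun x : Euc n => |x i - 1 / 2|) a (cube n) :=
      Measure.eqOn_open_of_ae_eq (hcoe.symm.trans ha) (isOpen_cube n)
        (continuous_abs_coord i).continuousOn (contDiff_affine a).continuous.continuousOn
    let c : Euc n := WithLp.toLp 2 fun _ => 1 / 2
    have hcoord : ∀ (t : ℝ) (j : Fin n), (c + t • EuclideanSpace.single i (1 : ℝ)) j =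
        1 / 2 + t * (if j = i then 1 else 0) := by
      intro t j
      simp [c]
    -- On the line through the centre in direction `i`, an affine representative would make `|t|`
    -- affine near zero. The values at `0` and `±1/4` refute this.
    have hval : ∀ t : ℝ, |t| < 1 / 2 →
        |t| = a c + t * a.linear (EuclideanSpace.single i 1) := by
      intro t ht
      rw [abs_lt] at ht
      have hmem : c + t • EuclideanSpace.single i (1 : ℝ) ∈ cube n := by
        intro j
        rw [hcoord]
        split_ifs <;> constructor <;> linarith
      have := heq hmem
      simp only [hcoord, affine_add_smul] at this
      simpa using this
    have v0 := hval 0 (by norm_num)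
    have v1 := hval (1 / 4) (by rw [abs_of_pos] <;> norm_num)
    have v2 := hval (-(1 / 4)) (by rw [abs_neg, abs_of_pos] <;> norm_num)
    rw [abs_zero] at v0
    rw [abs_of_pos (by norm_num)] at v1
    rw [abs_neg, abs_of_pos (by norm_num)] at v2
    linarith

/-! ### The zero class. -/

lemma zero_mem_unitBall (n : ℕ) : (0 : L1ModAffine n) ∈ unitBall n := by
  rw [← map_zero (proj n)]
  change quotVariation 1 (proj n 0) ≤ 1
  rw [quotVariation_proj, variation_le_one_iff]
  intro F _
  have := hessPairing_coe_smul 0 (0 : L1 n) F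
  rw [zero_smul, zero_mul] at this
  rw [this]
  exact zero_le_one

lemma subsingleton_L1ModAffine_zero : Subsingleton (L1ModAffine 0) := by
  have h : ∀ g : L1ModAffine 0, g = 0 := by
    intro g
    obtain ⟨u, rfl⟩ := (affineSubspace 0).mkQ_surjective g
    refine (Submodule.Quotient.mk_eq_zero _).2 ⟨AffineMap.const ℝ (Euc 0) (u 0), ?_⟩
    filter_upwards with x
    rw [AffineMap.const_apply, Subsingleton.elim x 0]
  exact ⟨fun a b => (h a).trans (h b).symm⟩

lemma zero_mem_cpwlClasses (n : ℕ) : (0 : L1ModAffine n) ∈ cpwlClasses n := by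
  refine ⟨0, ⟨fun _ => 0, ⟨continuousOn_const, gridDecomposition n,
    isPolytopeDecomposition_grid n, fun P _ => ⟨0, fun x _ => rfl⟩⟩, Lp.coeFn_zero _ _ _⟩,
    map_zero _⟩

/-- In dimension zero the quotient is a point, so zero is itself extreme. Otherwise the grid
provides a nonzero finite dimensional normed space, whose unit ball contains zero. -/
lemma zero_mem_convexHull_cpwlExtreme (n : ℕ) :
    (0 : L1ModAffine n) ∈ convexHull ℝ (cpwlExtreme n) := by
  rcases Nat.eq_zero_or_pos n with rfl | hn
  · have := subsingleton_L1ModAffine_zero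
    exact subset_convexHull ℝ _ ⟨zero_mem_cpwlClasses 0, zero_mem_unitBall 0,
      fun _ _ _ _ _ => Subsingleton.elim _ _⟩
  · have h := mem_convexHull_cpwlExtreme (isPolytopeDecomposition_grid n)
      (exists_mem_pieceSpace_grid ⟨0, hn⟩) (zero_mem (pieceSpace (gridDecomposition n)))
      (by rw [map_zero]; exact zero_mem_unitBall n)
    rwa [map_zero] at h

end

end HTV

/-! ### The theorem. -/

theorem proposition5p2 (n : ℕ) :
    convexHull ℝ (HTV.cpwlExtreme n) = HTV.cpwlClasses n ∩ HTV.unitBall n := by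
  refine Set.Subset.antisymm (convexHull_min (fun g hg => ⟨hg.1, hg.2.1⟩)
    ((HTV.convex_cpwlClasses n).inter (HTV.convex_unitBall n))) ?_
  rintro _ ⟨⟨u, ⟨f, ⟨-, Ps, hPs, hf⟩, huf⟩, rfl⟩, hu1⟩
  have hu : u ∈ HTV.pieceSpace Ps := by
    refine ⟨fun P hP => ?_, ne_top_of_le_ne_top ENNReal.one_ne_top hu1⟩
    obtain ⟨a, ha⟩ := hf P hP
    refine ⟨a, ?_⟩
    filter_upwards [huf, ae_restrict_mem (HTV.measurableSet_cube n)] with x hx hxc hxP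
    rw [hx, ha ⟨hxP, hxc⟩]
  -- The decomposition given for `f` may carry only affine functions on the cube, for instance when
  -- a single piece contains it. The class is then zero.
  by_cases hne : ∃ v ∈ HTV.pieceSpace Ps, HTV.proj n v ≠ 0
  · exact HTV.mem_convexHull_cpwlExtreme hPs hne hu hu1
  · push Not at hne
    rw [hne u hu]
    exact HTV.zero_mem_convexHull_cpwlExtreme n
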